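/- **Setting.** Let $n,s\ge 0$, $\mathscr H=L^2(\mathbb R^n)$, $\Xi_1=\mathbb R^{2n}$, $\Xi_0=\mathbb R^s$, $\Xi=\Xi_1\oplus\Xi_0=\mathbb R^{d}$, $d=2n+s$, and $\mathscr N=\mathscr B(\mathscr H)\otimes L^\infty(\mathbb R^s)=L^\infty(\mathbb R^s;\mathscr B(\mathscr H))$ with predual $\mathscr N_*=L^1(\mathbb R^s;\mathscr T(\mathscr H))$ ($\mathscr T(\mathscr H)$ the trace class) and duality $\langle P|F\rangle=\int_{\mathbb R^s} \mathrm{Tr}\{P(x)F(x)\}\,dx$. Let $R=(Q,P)=(Q_1,\dots,Q_n,P_1,\dots,P_n)$ be the positions and momenta, $[R_i,R_j]=\mathrm i\sigma_{ij}$ with $\sigma=\begin{pmatrix}0&1\\-1&0\end{pmatrix}$, $W_1(\zeta)=e^{\mathrm i\zeta\cdot R}$ the Weyl operators, and $W(\xi)\in\mathscr N$, $W(\xi)(x)=e^{\mathrm i k\cdot x}W_1(\zeta)$ for $\xi=(\zeta,k)\in\Xi$. Let $\{\mathcal T_t\}_{t\ge0}$ be a weak$^*$-continuous one-parameter semigroup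 of bounded, completely positive, unital, normal linear maps on $\mathscr N$, with $\mathcal T_0=\mathrm{Id}$, which is quasi-free with data $(Z,\alpha,A,\nu)$: $\mathcal T_t[W(\xi)]=f_t(\xi)W(S_t\xi)$ with $S_t=e^{Zt}$ and $f_t(\xi)=\exp\left(\int_0^t\psi(S_\tau\xi)\,d\tau\right)$, $$\psi(\xi)=\mathrm i\alpha\cdot\xi-\tfrac12\,\xi\cdot A\xi+\int_\Xi\nu(d\eta)\left(e^{\mathrm i\eta\cdot\xi}-1-\mathrm i\,1_{\{|\eta|<1\}}(\eta)\,\eta\cdot\xi\right).$$ Here $Z$ is a real $d\times d$ matrix, $\alpha=(\beta,\alpha^0)\in\Xi_1\oplus\Xi_0$, $A\ge0$ is real symmetric, $\nu$ is a $\sigma$-finite measure on $\Xi$ with $\nu(\{0\})=0$, $\int_{\{|\eta|<1\}}|\eta|^2\nu(d\eta)<\infty$ and $\nu(\{|\eta|\ge1\})<\infty$, and $A\pm\mathrm iB\ge0$ with $B=\tfrac12(\sigma P_1Z-Z^{\mathtt T}P_1\sigma^{\mathtt T})$, where $P_1$ is the orthogonal projection onto $\Xi_1$ and $\sigma$ is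 extended by $0$ on $\Xi_0$. Write $A,Z$ in blocks $A^{ab},Z^{ab}$, where $a,b\in\{1,0\}$ label $\Xi_1,\Xi_0$, and put $$G=\sigma^{\mathtt T}A^{11}\sigma+\tfrac{\mathrm i}2\left(\sigma^{\mathtt T}{Z^{11}}^{\mathtt T}-Z^{11}\sigma\right),\quad D=\tfrac12\left(Z^{11}\sigma+\sigma^{\mathtt T}{Z^{11}}^{\mathtt T}\right),\quad C=A^{00},\quad E=\sigma^{\mathtt T}A^{10}-\tfrac{\mathrm i}2Z^{10},$$ $$H_{\rm q}=\beta^{\mathtt T}\sigma R+\tfrac12R^{\mathtt T}DR,\qquad H_x=x^{\mathtt T}Z^{01}\sigma R .$$ **Statement.** Let $a$ be in the linear span of the Weyl operators $W_1(\zeta)$ and let $f:\mathbb R^s\to\mathbb C$ be bounded and twice differentiable, with $x_jf(x)$ bounded for $j=1,\dots,s$. Then $\mathrm{Im}\,E=-\frac12Z^{10}$, $\mathrm{Re}\,E=\sigma^{\mathtt T}A^{10}$, $a$ maps the Schwartz space $\mathscr S(\mathbb R^n)$ into itself, and the generator $\mathcal K$ of $\mathcal T_t$ is given on $a\otimes f$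 by $$\mathcal K[a\otimes f](x)=f(x)\sum_{l=1}^2\mathcal L_{\rm q}^l[a]+a\sum_{l=1}^2\mathcal K_{\rm cl}^l[f](x)+\sum_{l=1}^4\mathcal K_{\rm int}^l[a\otimes f](x),$$ where, with $\eta=(\zeta,y)\in\Xi_1\oplus\Xi_0$ and all operators acting on $\mathscr S(\mathbb R^n)$, $$\mathcal L_{\rm q}^1[a]=\sum_{i,j=1}^{2n}G_{ij}\left(R_iaR_j-\tfrac12\{R_iR_j,a\}\right)+\mathrm i[H_{\rm q},a],$$ $$\mathcal L_{\rm q}^2[a]=\int_\Xi\nu(d\eta)\left\{W_1(\sigma\zeta)^\dagger aW_1(\sigma\zeta)-a-1_{\{|\eta|<1\}}(\eta)\,\mathrm i[\zeta^{\mathtt T}\sigma R,a]\right\},$$ $$\mathcal K_{\rm cl}^1[f](x)=\sum_{j=1}^s\alpha^0_j\,\partial_jf(x)+\sum_{i,j=1}^sx_iZ^{00}_{ij}\,\partial_jf(x)+\tfrac12\sum_{i,j=1}^sC_{ij}\,\partial_i\partial_jf(x),$$ $$\mathcal K_{\rm cl}^2[f](x)=\int_\Xi\nu(d\eta)\left\{f(x+y)-f(x)-1_{\{|\eta|<1\}}(\eta)\sum_{j=1}^sy_j\,\partial_jf(x)\right\},$$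 $$\mathcal K_{\rm int}^1[a\otimes f](x)=\mathrm i[H_x,a]f(x),\qquad \mathcal K_{\rm int}^2[a\otimes f](x)=-\sum_{i=1}^{2n}\sum_{j=1}^s(\mathrm{Im}\,E_{ij})\{R_i,a\}\,\partial_jf(x),$$ $$\mathcal K_{\rm int}^3[a\otimes f](x)=\mathrm i\sum_{i=1}^{2n}\sum_{j=1}^s(\mathrm{Re}\,E_{ij})[R_i,a]\,\partial_jf(x),$$ $$\mathcal K_{\rm int}^4[a\otimes f](x)=\int_\Xi\nu(d\eta)\,\bigl(f(x+y)-f(x)\bigr)\left(W_1(\sigma\zeta)^\dagger aW_1(\sigma\zeta)-a\right),$$ the $\nu$-integrals being absolutely convergent (those of operators after application to any $\varphi\in\mathscr S(\mathbb R^n)$). As $\mathcal K[a\otimes f](x)$ is in general an unbounded operator, this means the following. For every $t\ge0$ the class $\mathcal T_t[a\otimes f]$ has a representative $x\mapsto V_t(x)\in\mathscr B(\mathscr H)$ which is continuous in the weak operator topology, and for every $x\in\mathbb R^s$ and all $\varphi,\chi\in\mathscr S(\mathbb R^n)$ $$\frac{d}{dt}\Big|_{t=0^+}\langle\chi|V_t(x)\varphi\rangle=\langle\chi|\mathcal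 K[a\otimes f](x)\varphi\rangle .$$ If moreover the second derivatives of $f$ are continuous, then also $\frac{d}{dt}\big|_{t=0^+}\langle P|\mathcal T_t[a\otimes f]\rangle=\langle P|\mathcal K[a\otimes f]\rangle$, where the right side is $\int_{\mathbb R^s}p(x)\langle\chi|\mathcal K[a\otimes f](x)\varphi\rangle\,dx$ and converges absolutely, for all $P\in\mathscr N_*$ of the form $P(x)=p(x)|\varphi\rangle\langle\chi|$ with $\varphi,\chi\in\mathscr S(\mathbb R^n)$ and $p\in L^1(\mathbb R^s)$ of compact support. -/

import Mathlib

open MeasureTheory Complex Set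
open scoped ComplexOrder SchwartzMap ENNReal Matrix

noncomputable section

namespace HybridQF

/-! ## Phase spaces, the quantum Hilbert space and the Weyl operators -/

/-- The configuration space `ℝⁿ` of the quantum component. -/
abbrev Config (n : ℕ) := EuclideanSpace ℝ (Fin n)

/-- The phase space `Ξ₁ = ℝ²ⁿ` of the quantum component; the indices `Sum.inl j` belong to the
position `Q_j`, the indices `Sum.inr j` to the momentum `P_j`. -/
abbrev QPhase (n : ℕ) := EuclideanSpace ℝ (Fin n ⊕ Fin n)

/-- The phase space `Ξ₀ = ℝˢ` of the classical component. -/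
abbrev CPhase (s : ℕ) := EuclideanSpace ℝ (Fin s)

/-- The total phase space `Ξ = Ξ₁ ⊕ Ξ₀`, with its Euclidean norm. -/
abbrev Phase (n s : ℕ) := EuclideanSpace ℝ ((Fin n ⊕ Fin n) ⊕ Fin s)

/-- The component `ζ` of `(ζ, k)`. -/
def qPart {n s : ℕ} (ξ : Phase n s) : QPhase n := WithLp.toLp 2 fun i => ξ (Sum.inl i)

/-- The component `k` of `(ζ, k)`. -/
def cPart {n s : ℕ} (ξ : Phase n s) : CPhase s := WithLp.toLp 2 fun j => ξ (Sum.inr j)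

/-- The real `d × d` matrices acting on `Ξ`. -/
abbrev PhaseMat (n s : ℕ) := Matrix ((Fin n ⊕ Fin n) ⊕ Fin s) ((Fin n ⊕ Fin n) ⊕ Fin s) ℝ

/-- The Hilbert space `L²(ℝⁿ)`. -/
abbrev Hilb (n : ℕ) := Lp ℂ 2 (volume : Measure (Config n))

/-- The bounded operators on `L²(ℝⁿ)`. -/
abbrev Op (n : ℕ) := Hilb n →L[ℂ] Hilb n

/-- The phase factor `q ↦ exp (i (u · q + u · v / 2))` for `ζ = (u, v)`. -/
def weylPhase {n : ℕ} (ζ : QPhase n) (q : Config n) : ℂ :=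
  cexp (I * ((∑ j, ζ (Sum.inl j) * q j + (∑ j, ζ (Sum.inl j) * ζ (Sum.inr j)) / 2 : ℝ) : ℂ))

theorem weylPhase_memLp {n : ℕ} (ζ : QPhase n) :
    MemLp (weylPhase ζ) ∞ (volume : Measure (Config n)) := by
  refine memLp_top_of_bound (C := 1) ?_ (Filter.Eventually.of_forall fun q => ?_)
  · refine Continuous.aestronglyMeasurable ?_
    unfold weylPhase
    fun_prop
  · rw [weylPhase, mul_comm, Complex.norm_exp_ofReal_mul_I]

/-- The shift `q ↦ q + v` for `ζ = (u, v)`. -/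
def weylShift {n : ℕ} (ζ : QPhase n) (q : Config n) : Config n :=
  q + WithLp.toLp 2 fun j => ζ (Sum.inr j)

theorem weylShift_measurePreserving {n : ℕ} (ζ : QPhase n) :
    MeasurePreserving (weylShift ζ) (volume : Measure (Config n)) volume :=
  measurePreserving_add_right _ _

/-- The Weyl operator `W₁(ζ) = exp (i ζ · R)` on `L²(ℝⁿ)`: for `ζ = (u, v)`,
`(W₁(ζ) φ)(q) = exp (i (u · q + u · v / 2)) φ(q + v)`. -/
def weyl {n : ℕ} (ζ : QPhase n) : Op n :=
  ((ContinuousLinearMap.mul ℂ ℂ).holderL volume ∞ 2 2 ((weylPhase_memLp ζ).toLp _)) ∘L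
    (Lp.compMeasurePreservingₗᵢ ℂ (weylShift ζ)
      (weylShift_measurePreserving ζ)).toContinuousLinearMap

/-- The explicit action of the Weyl operators. -/
theorem weyl_coeFn {n : ℕ} (ζ : QPhase n) (φ : Hilb n) :
    (weyl ζ φ : Config n → ℂ) =ᵐ[volume] fun q => weylPhase ζ q * φ (weylShift ζ q) := by
  have h1 := (ContinuousLinearMap.mul ℂ ℂ).coeFn_holder (r := 2) ((weylPhase_memLp ζ).toLp _)
    (Lp.compMeasurePreserving (weylShift ζ) (weylShift_measurePreserving ζ) φ)
  have h2 := (weylPhase_memLp ζ).coeFn_toLp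
  have h3 := Lp.coeFn_compMeasurePreserving φ (weylShift_measurePreserving ζ)
  refine h1.trans ?_
  filter_upwards [h2, h3] with q h2 h3
  rw [h2, h3]
  rfl

/-- The linear span of the Weyl operators. -/
def weylSpan (n : ℕ) : Submodule ℂ (Op n) := Submodule.span ℂ (range (weyl (n := n)))

/-! ## The algebra of hybrid observables -/

/-- The weakly measurable, essentially bounded functions from `ℝˢ` to the bounded operators. -/
def hybridFun (n s : ℕ) : Submodule ℂ (CPhase s → Op n) where
  carrier := {F | (∀ φ ψ : Hilb n,
      AEStronglyMeasurable (fun x => inner ℂ ψ (F x φ)) (volume : Measure (CPhase s))) ∧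
    ∃ C : ℝ, ∀ᵐ x : CPhase s, ‖F x‖ ≤ C}
  add_mem' := by
    rintro F G ⟨hF, C, hC⟩ ⟨hG, D, hD⟩
    refine ⟨fun φ ψ => ?_, C + D, ?_⟩
    · have h : (fun x => (inner ℂ ψ ((F + G) x φ) : ℂ))
          = (fun x => inner ℂ ψ (F x φ)) + fun x => inner ℂ ψ (G x φ) := by
        funext x
        simp [inner_add_right]
      rw [h]
      exact (hF φ ψ).add (hG φ ψ)
    · filter_upwards [hC, hD] with x h1 h2
      exact (norm_add_le _ _).trans (add_le_add h1 h2)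
  zero_mem' := ⟨fun φ ψ => by simpa using aestronglyMeasurable_const, 0, by simp⟩
  smul_mem' := by
    rintro c F ⟨hF, C, hC⟩
    refine ⟨fun φ ψ => ?_, ‖c‖ * C, ?_⟩
    · simpa [inner_smul_right] using (hF φ ψ).const_mul c
    · filter_upwards [hC] with x h1
      simp only [Pi.smul_apply, norm_smul]
      gcongr

/-- The functions that vanish almost everywhere. -/
def hybridNull (n s : ℕ) : Submodule ℂ (hybridFun n s) where
  carrier := {F | ∀ᵐ x : CPhase s, F.1 x = 0}
  add_mem' := by
    intro F G hF hG
    change ∀ᵐ x : CPhase s, (F + G).1 x = 0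
    filter_upwards [hF, hG] with x h1 h2
    simp [h1, h2]
  zero_mem' := by simp
  smul_mem' := by
    intro c F hF
    change ∀ᵐ x : CPhase s, (c • F).1 x = 0
    filter_upwards [hF] with x h1
    simp [h1]

/-- The algebra `𝒩 = B(L²(ℝⁿ)) ⊗ L^∞(ℝˢ) = L^∞(ℝˢ; B(L²(ℝⁿ)))` of hybrid observables. -/
abbrev HybridAlg (n s : ℕ) := hybridFun n s ⧸ hybridNull n s

/-- The class of a function. -/
def cls {n s : ℕ} (F : hybridFun n s) : HybridAlg n s := (hybridNull n s).mkQ F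

/-- A representative of a class; two representatives agree almost everywhere. -/
def rep {n s : ℕ} (F : HybridAlg n s) : CPhase s → Op n :=
  (Function.surjInv (hybridNull n s).mkQ_surjective F).1

theorem rep_cls {n s : ℕ} (F : hybridFun n s) : ∀ᵐ x : CPhase s, rep (cls F) x = F.1 x := by
  have h : (hybridNull n s).mkQ (Function.surjInv (hybridNull n s).mkQ_surjective (cls F))
      = (hybridNull n s).mkQ F := Function.surjInv_eq _ _
  have h' := (Submodule.Quotient.eq (hybridNull n s)).1 h
  filter_upwards [h'] with x hx
  exact sub_eq_zero.1 hx

/-- `F` is essentially bounded by `c`. -/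
def EssBound {n s : ℕ} (F : HybridAlg n s) (c : ℝ) : Prop := ∀ᵐ x : CPhase s, ‖rep F x‖ ≤ c

/-- Weak measurability implies strong measurability on every vector, as `L²(ℝⁿ)` is separable. -/
theorem hybridFun_apply {n s : ℕ} (F : hybridFun n s) (φ : Hilb n) :
    AEStronglyMeasurable (fun x => F.1 x φ) (volume : Measure (CPhase s)) := by
  obtain ⟨w, b, hb⟩ := exists_hilbertBasis ℂ (Hilb n)
  have : Fact ((2 : ℝ≥0∞) ≠ ∞) := ⟨by simp⟩
  have : Countable w := by
    have ho := b.orthonormal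
    by_contra hc
    obtain ⟨D, hDc, hDd⟩ := TopologicalSpace.exists_countable_dense (Hilb n)
    have hex : ∀ i : w, ∃ d ∈ D, dist (b i) d < 1 / 2 := fun i =>
      hDd.exists_dist_lt (b i) (by norm_num)
    choose d hd hdist using hex
    have hinj : Function.Injective (fun i => (⟨d i, hd i⟩ : D)) := by
      intro i j hij
      by_contra hne
      have hij' : d i = d j := congrArg Subtype.val hij
      have h1 : dist (b i) (b j) < 1 := by
        have := dist_triangle_right (b i) (b j) (d i)
        have h2 := hdist i
        have h3 := hdist j
        rw [← hij'] at h3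
        linarith
      have h4 : ‖b i - b j‖ ^ 2 = 2 := by
        rw [@norm_sub_sq ℂ, ho.1 i, ho.1 j, ho.2 hne]
        norm_num
      rw [dist_eq_norm] at h1
      nlinarith [norm_nonneg (b i - b j)]
    have := hDc.to_subtype
    exact hc hinj.countable
  have hsum : ∀ x, HasSum (fun i => inner ℂ (b i) (F.1 x φ) • b i) (F.1 x φ) := fun x => by
    have := b.hasSum_repr (F.1 x φ)
    simpa [b.repr_apply_apply] using this
  refine aestronglyMeasurable_of_tendsto_ae (u := Filter.atTop)
    (f := fun t : Finset w => fun x => ∑ i ∈ t, inner ℂ (b i) (F.1 x φ) • b i) (fun t => ?_)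
    (Filter.Eventually.of_forall fun x => hsum x)
  refine Finset.aestronglyMeasurable_fun_sum _ fun i _ => ?_
  exact (F.2.1 φ (b i)).smul_const (b i)

/-- The function `x ↦ F(x)† G(x)`, representing the product `F* G` in `𝒩`. -/
def starMul {n s : ℕ} (F G : hybridFun n s) : hybridFun n s :=
  ⟨fun x => ContinuousLinearMap.adjoint (F.1 x) ∘L G.1 x, by
    obtain ⟨C, hC⟩ := F.2.2
    obtain ⟨D, hD⟩ := G.2.2
    refine ⟨fun φ ψ => ?_, C * D, ?_⟩
    · simpa [ContinuousLinearMap.adjoint_inner_right] using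
        (hybridFun_apply F ψ).inner (𝕜 := ℂ) (hybridFun_apply G φ)
    · filter_upwards [hC, hD] with x h1 h2
      refine (ContinuousLinearMap.opNorm_comp_le _ _).trans ?_
      rw [LinearIsometryEquiv.norm_map]
      exact mul_le_mul h1 h2 (norm_nonneg _) ((norm_nonneg _).trans h1)⟩

/-- The element `a ⊗ f`, i.e. the class of `x ↦ f(x) a`, for a bounded continuous `f`. -/
def tensor {n s : ℕ} (a : Op n) (f : CPhase s → ℂ) (hf : Continuous f)
    (hb : ∃ C : ℝ, ∀ x, ‖f x‖ ≤ C) : HybridAlg n s :=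
  cls ⟨fun x => f x • a, by
    obtain ⟨C, hC⟩ := hb
    refine ⟨fun φ ψ => ?_, C * ‖a‖, Filter.Eventually.of_forall fun x => ?_⟩
    · have h : Continuous fun x => (inner ℂ ψ ((f x • a) φ) : ℂ) := by
        simp only [smul_apply, inner_smul_right]
        exact hf.mul continuous_const
      exact h.aestronglyMeasurable
    · rw [norm_smul]
      exact mul_le_mul_of_nonneg_right (hC x) (norm_nonneg _)⟩

/-- The unit of `𝒩`. -/
def unit (n s : ℕ) : HybridAlg n s :=
  tensor (ContinuousLinearMap.id ℂ (Hilb n)) (fun _ => 1) continuous_const ⟨1, by simp⟩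

/-- The hybrid Weyl operators `W(ξ) = W₁(ζ) W₀(k)`, `W₀(k)(x) = exp (i k · x)`, `ξ = (ζ, k)`. -/
def hybridWeyl {n s : ℕ} (ξ : Phase n s) : HybridAlg n s :=
  tensor (weyl (qPart ξ)) (fun x => cexp (((∑ j, cPart ξ j * x j : ℝ) : ℂ) * I))
    (by fun_prop) ⟨1, fun x => by rw [Complex.norm_exp_ofReal_mul_I]⟩

/-- `∫ ⟨g(x) | F(x) h(x)⟩ dx` for `g, h ∈ L²(ℝˢ; L²(ℝⁿ)) = L²(ℝⁿ) ⊗ L²(ℝˢ)`. -/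
def form {n s : ℕ} (F : HybridAlg n s) (g h : Lp (Hilb n) 2 (volume : Measure (CPhase s))) : ℂ :=
  ∫ x : CPhase s, inner ℂ (g x) (rep F x (h x))

/-- An element `P` of the predual `𝒩_* = L¹(ℝˢ; 𝒯(L²(ℝⁿ)))`, presented as
`P(x) = ∑ₖ |hₖ(x)⟩⟨gₖ(x)|` with square summable sequences in `L²(ℝˢ; L²(ℝⁿ))`. -/
structure Predual (n s : ℕ) where
  /-- The bra vectors. -/
  g : ℕ → Lp (Hilb n) 2 (volume : Measure (CPhase s))
  /-- The ket vectors. -/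
  h : ℕ → Lp (Hilb n) 2 (volume : Measure (CPhase s))
  summable_g : Summable fun k => ‖g k‖ ^ 2
  summable_h : Summable fun k => ‖h k‖ ^ 2

/-- The duality form `⟨P | F⟩ = ∫ Tr (P(x) F(x)) dx`. -/
def duality {n s : ℕ} (P : Predual n s) (F : HybridAlg n s) : ℂ := ∑' k, form F (P.g k) (P.h k)

/-! ## Quasi-free hybrid dynamical semigroups -/

/-- Hybrid dynamical semigroups; only the maps `T t` with `0 ≤ t` matter. -/
structure IsHybridSemigroup {n s : ℕ} (T : ℝ → (HybridAlg n s →ₗ[ℂ] HybridAlg n s)) : Prop where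
  bounded : ∀ t, 0 ≤ t → ∃ C : ℝ, 0 ≤ C ∧ ∀ F c, EssBound F c → EssBound (T t F) (C * c)
  completelyPositive : ∀ t, 0 ≤ t → ∀ (N : ℕ) (F : Fin N → hybridFun n s)
    (g : Fin N → Lp (Hilb n) 2 (volume : Measure (CPhase s))),
    0 ≤ ∑ i, ∑ j, form (T t (cls (starMul (F j) (F i)))) (g j) (g i)
  zero : T 0 = LinearMap.id
  unital : ∀ t, 0 ≤ t → T t (unit n s) = unit n s
  /-- `T t` is the adjoint of a map on the predual. -/
  normal : ∀ t, 0 ≤ t → ∀ P : Predual n s, ∃ P' : Predual n s,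
    ∀ F, duality P (T t F) = duality P' F
  comp : ∀ t r, 0 ≤ t → 0 ≤ r → T t ∘ₗ T r = T (t + r)
  weakStarContinuous : ∀ (P : Predual n s) (F : HybridAlg n s),
    ContinuousOn (fun t => duality P (T t F)) (Ici 0)

/-- Quasi-free hybrid dynamical semigroups, `T_t[W(ξ)] = f_t(ξ) W(S_t ξ)`. -/
structure IsQuasiFreeSemigroup {n s : ℕ} (T : ℝ → (HybridAlg n s →ₗ[ℂ] HybridAlg n s))
    (S : ℝ → (Phase n s →ₗ[ℝ] Phase n s)) (noise : ℝ → Phase n s → ℂ) : Prop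
    extends IsHybridSemigroup T where
  noise_continuous : ∀ t, 0 ≤ t → Continuous (noise t)
  quasiFree : ∀ t, 0 ≤ t → ∀ ξ, T t (hybridWeyl ξ) = noise t ξ • hybridWeyl (S t ξ)

/-- The symplectic matrix `σ` on `Ξ₁`: `[R_i, R_j] = i σ_ij`. -/
def sigma (n : ℕ) : Matrix (Fin n ⊕ Fin n) (Fin n ⊕ Fin n) ℝ :=
  Matrix.fromBlocks 0 1 (-1) 0

/-- The matrix `B = (σ P₁ Z - Zᵀ P₁ σᵀ) / 2`, where `P₁` is the projection on `Ξ₁`. -/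
def matB {n s : ℕ} (Z : PhaseMat n s) : PhaseMat n s :=
  let P1 : PhaseMat n s := Matrix.fromBlocks 1 0 0 0
  let sig : PhaseMat n s := Matrix.fromBlocks (sigma n) 0 0 0
  (1 / 2 : ℝ) • (sig * P1 * Z - Zᵀ * P1 * sigᵀ)

/-- Entrywise inclusion of real matrices into complex matrices. -/
def cplx {ι κ : Type*} (M : Matrix ι κ ℝ) : Matrix ι κ ℂ := M.map fun r => (r : ℂ)

/-- Lévy measures on `Ξ`. -/
structure IsLevyMeasure {n s : ℕ} (ν : Measure (Phase n s)) : Prop where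
  sigmaFinite : SigmaFinite ν
  zero : ν {0} = 0
  small : ∫⁻ η in {η | ‖η‖ < 1}, ENNReal.ofReal (‖η‖ ^ 2) ∂ν < ∞
  large : ν {η | 1 ≤ ‖η‖} < ∞

/-- The indicator function of `{|η| < 1}`. -/
def cut {n s : ℕ} (η : Phase n s) : ℝ := indicator {η : Phase n s | ‖η‖ < 1} (fun _ => 1) η

/-- The Lévy-Khintchine exponent `ψ(ξ)`. -/
def levyExponent {n s : ℕ} (α : Phase n s) (A : PhaseMat n s) (ν : Measure (Phase n s))
    (ξ : Phase n s) : ℂ :=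
  I * ((∑ i, α i * ξ i : ℝ) : ℂ) - 1 / 2 * ((∑ i, ∑ j, ξ i * A i j * ξ j : ℝ) : ℂ)
    + ∫ η, (cexp (I * ((∑ i, η i * ξ i : ℝ) : ℂ)) - 1
        - I * (cut η : ℂ) * ((∑ i, η i * ξ i : ℝ) : ℂ)) ∂ν

/-- `(S_t)` and the noise functions are given by the data `(Z, α, A, ν)`: `S_t = exp (Z t)` and
`f_t(ξ) = exp (∫₀ᵗ ψ(S_τ ξ) dτ)`, where `A ≥ 0`, `ν` is a Lévy measure and `A ± i B ≥ 0`. -/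
structure HasData {n s : ℕ} (S : ℝ → (Phase n s →ₗ[ℝ] Phase n s)) (noise : ℝ → Phase n s → ℂ)
    (Z : PhaseMat n s) (α : Phase n s) (A : PhaseMat n s) (ν : Measure (Phase n s)) : Prop where
  posSemidef : A.PosSemidef
  levy : IsLevyMeasure ν
  pos_add : (cplx A + I • cplx (matB Z)).PosSemidef
  pos_sub : (cplx A - I • cplx (matB Z)).PosSemidef
  flow : ∀ t, 0 ≤ t → ∀ ξ, S t ξ = WithLp.toLp 2 (NormedSpace.exp (t • Z) *ᵥ ⇑ξ)
  noise_eq : ∀ t, 0 ≤ t → ∀ ξ,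
    noise t ξ = cexp (∫ τ in (0 : ℝ)..t, levyExponent α A ν (S τ ξ))

/-! ## Position and momentum, and the coefficient matrices -/

/-- Linear operators on the Schwartz space, the common invariant domain of positions, momenta and
Weyl operators. -/
abbrev SOp (n : ℕ) := Module.End ℂ 𝓢(Config n, ℂ)

/-- The vector of `L²(ℝⁿ)` given by a Schwartz function. -/
def toH {n : ℕ} (φ : 𝓢(Config n, ℂ)) : Hilb n := φ.toLp 2 volume

/-- The bounded operator `a` maps Schwartz functions to Schwartz functions, by `a₀`. -/
def Restricts {n : ℕ} (a : Op n) (a₀ : SOp n) : Prop := ∀ φ, toH (a₀ φ) = a (toH φ)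

/-- The position operators, `(Q_j φ)(q) = q_j φ(q)`. -/
def posOp {n : ℕ} (j : Fin n) : SOp n :=
  (SchwartzMap.smulLeftCLM ℂ fun q : Config n => ((q j : ℝ) : ℂ)).toLinearMap

theorem posOp_apply {n : ℕ} (j : Fin n) (φ : 𝓢(Config n, ℂ)) (q : Config n) :
    posOp j φ q = (q j : ℂ) * φ q := by
  have h0 : Function.HasTemperateGrowth fun q : Config n => q j :=
    (EuclideanSpace.proj (𝕜 := ℝ) j).hasTemperateGrowth
  have h : Function.HasTemperateGrowth fun q : Config n => ((q j : ℝ) : ℂ) :=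
    Complex.ofRealCLM.hasTemperateGrowth.comp h0
  exact SchwartzMap.smulLeftCLM_apply_apply h φ q

/-- The momentum operators, `P_j φ = -i ∂_j φ`. -/
def momOp {n : ℕ} (j : Fin n) : SOp n :=
  (-I) • (LineDeriv.lineDerivOpCLM ℂ 𝓢(Config n, ℂ) (EuclideanSpace.single j (1 : ℝ))).toLinearMap

theorem momOp_apply {n : ℕ} (j : Fin n) (φ : 𝓢(Config n, ℂ)) (q : Config n) :
    momOp j φ q = -I * fderiv ℝ φ q (EuclideanSpace.single j 1) := rfl

/-- The vector `R = (Q, P)`. -/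
def R {n : ℕ} : Fin n ⊕ Fin n → SOp n := Sum.elim posOp momOp

/-- The operator `vᵀ R`. -/
def linR {n : ℕ} (v : Fin n ⊕ Fin n → ℝ) : SOp n := ∑ i, (v i : ℂ) • R i

/-- The commutator. -/
def comm {n : ℕ} (b c : SOp n) : SOp n := b * c - c * b

/-- The anticommutator. -/
def acomm {n : ℕ} (b c : SOp n) : SOp n := b * c + c * b

/-- `G = σᵀ A¹¹ σ + (i/2) (σᵀ Z¹¹ᵀ - Z¹¹ σ)`. -/
def matG {n s : ℕ} (Z A : PhaseMat n s) : Matrix (Fin n ⊕ Fin n) (Fin n ⊕ Fin n) ℂ :=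
  cplx ((sigma n)ᵀ * A.toBlocks₁₁ * sigma n)
    + (I / 2) • cplx ((sigma n)ᵀ * (Z.toBlocks₁₁)ᵀ - Z.toBlocks₁₁ * sigma n)

/-- `D = (Z¹¹ σ + σᵀ Z¹¹ᵀ) / 2`. -/
def matD {n s : ℕ} (Z : PhaseMat n s) : Matrix (Fin n ⊕ Fin n) (Fin n ⊕ Fin n) ℝ :=
  (1 / 2 : ℝ) • (Z.toBlocks₁₁ * sigma n + (sigma n)ᵀ * (Z.toBlocks₁₁)ᵀ)

/-- `C = A⁰⁰`. -/
def matC {n s : ℕ} (A : PhaseMat n s) : Matrix (Fin s) (Fin s) ℝ := A.toBlocks₂₂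

/-- `E = σᵀ A¹⁰ - (i/2) Z¹⁰`. -/
def matE {n s : ℕ} (Z A : PhaseMat n s) : Matrix (Fin n ⊕ Fin n) (Fin s) ℂ :=
  cplx ((sigma n)ᵀ * A.toBlocks₁₂) - (I / 2) • cplx Z.toBlocks₁₂

/-- `H_q = βᵀ σ R + Rᵀ D R / 2`, where `β` is the quantum component of `α`. -/
def Hq {n s : ℕ} (Z : PhaseMat n s) (α : Phase n s) : SOp n :=
  linR (⇑(qPart α) ᵥ* sigma n) + (1 / 2 : ℂ) • ∑ i, ∑ j, (matD Z i j : ℂ) • (R i * R j)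

/-- `H_x = xᵀ Z⁰¹ σ R`. -/
def Hx {n s : ℕ} (Z : PhaseMat n s) (x : CPhase s) : SOp n :=
  linR (⇑x ᵥ* (Z.toBlocks₂₁ * sigma n))

/-! ## The terms of the generator

In the quantum jump terms, `a` is the bounded operator and `a₀` its restriction to the Schwartz
space; operator valued expressions are evaluated on a Schwartz function `φ`. -/

/-- The partial derivative `∂f/∂x_j`. -/
def pd {s : ℕ} (j : Fin s) (f : CPhase s → ℂ) (x : CPhase s) : ℂ :=
  fderiv ℝ f x (EuclideanSpace.single j 1)

/-- `σ ζ`. -/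
def sigmaVec {n : ℕ} (ζ : QPhase n) : QPhase n := WithLp.toLp 2 (sigma n *ᵥ ⇑ζ)

/-- `W₁(σζ)† a W₁(σζ)`. -/
def conj {n : ℕ} (ζ : QPhase n) (a : Op n) : Op n :=
  ContinuousLinearMap.adjoint (weyl (sigmaVec ζ)) ∘L a ∘L weyl (sigmaVec ζ)

/-- `L_q¹[a]`. -/
def Lq1 {n s : ℕ} (Z : PhaseMat n s) (α : Phase n s) (A : PhaseMat n s) (a₀ : SOp n) : SOp n :=
  (∑ i, ∑ j, matG Z A i j • (R i * a₀ * R j - (1 / 2 : ℂ) • acomm (R i * R j) a₀))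
    + I • comm (Hq Z α) a₀

/-- The integrand of `L_q²[a]`. -/
def Lq2Integrand {n s : ℕ} (a : Op n) (a₀ : SOp n) (φ : 𝓢(Config n, ℂ)) (η : Phase n s) :
    Hilb n :=
  conj (qPart η) a (toH φ) - a (toH φ)
    - (cut η : ℂ) • I • toH (comm (linR (⇑(qPart η) ᵥ* sigma n)) a₀ φ)

/-- `L_q²[a]`. -/
def Lq2 {n s : ℕ} (ν : Measure (Phase n s)) (a : Op n) (a₀ : SOp n) (φ : 𝓢(Config n, ℂ)) :
    Hilb n :=
  ∫ η, Lq2Integrand a a₀ φ η ∂ν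

/-- `K_cl¹[f]`. -/
def Kcl1 {n s : ℕ} (Z : PhaseMat n s) (α : Phase n s) (A : PhaseMat n s) (f : CPhase s → ℂ)
    (x : CPhase s) : ℂ :=
  ∑ j, (cPart α j : ℂ) * pd j f x
    + ∑ i, ∑ j, (x i : ℂ) * (Z.toBlocks₂₂ i j : ℂ) * pd j f x
    + 1 / 2 * ∑ i, ∑ j, (matC A i j : ℂ) * pd i (pd j f) x

/-- The integrand of `K_cl²[f]`. -/
def Kcl2Integrand {n s : ℕ} (f : CPhase s → ℂ) (x : CPhase s) (η : Phase n s) : ℂ :=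
  f (x + cPart η) - f x - (cut η : ℂ) * ∑ j, (cPart η j : ℂ) * pd j f x

/-- `K_cl²[f]`. -/
def Kcl2 {n s : ℕ} (ν : Measure (Phase n s)) (f : CPhase s → ℂ) (x : CPhase s) : ℂ :=
  ∫ η, Kcl2Integrand f x η ∂ν

/-- `K_int¹[a ⊗ f]`. -/
def Kint1 {n s : ℕ} (Z : PhaseMat n s) (a₀ : SOp n) (f : CPhase s → ℂ) (x : CPhase s) : SOp n :=
  f x • I • comm (Hx Z x) a₀

/-- `K_int²[a ⊗ f]`. -/
def Kint2 {n s : ℕ} (Z A : PhaseMat n s) (a₀ : SOp n) (f : CPhase s → ℂ) (x : CPhase s) : SOp n :=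
  -∑ i, ∑ j, (((matE Z A i j).im : ℂ) * pd j f x) • acomm (R i) a₀

/-- `K_int³[a ⊗ f]`. -/
def Kint3 {n s : ℕ} (Z A : PhaseMat n s) (a₀ : SOp n) (f : CPhase s → ℂ) (x : CPhase s) : SOp n :=
  I • ∑ i, ∑ j, (((matE Z A i j).re : ℂ) * pd j f x) • comm (R i) a₀

/-- The integrand of `K_int⁴[a ⊗ f]`. -/
def Kint4Integrand {n s : ℕ} (a : Op n) (f : CPhase s → ℂ) (x : CPhase s) (φ : 𝓢(Config n, ℂ))
    (η : Phase n s) : Hilb n :=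
  (f (x + cPart η) - f x) • (conj (qPart η) a (toH φ) - a (toH φ))

/-- `K_int⁴[a ⊗ f]`. -/
def Kint4 {n s : ℕ} (ν : Measure (Phase n s)) (a : Op n) (f : CPhase s → ℂ) (x : CPhase s)
    (φ : 𝓢(Config n, ℂ)) : Hilb n :=
  ∫ η, Kint4Integrand a f x φ η ∂ν

/-- `K[a ⊗ f](x)`, applied to the Schwartz function `φ`. -/
def genK {n s : ℕ} (Z : PhaseMat n s) (α : Phase n s) (A : PhaseMat n s)
    (ν : Measure (Phase n s)) (a : Op n) (a₀ : SOp n) (f : CPhase s → ℂ) (x : CPhase s)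
    (φ : 𝓢(Config n, ℂ)) : Hilb n :=
  f x • (toH (Lq1 Z α A a₀ φ) + Lq2 ν a a₀ φ)
    + (Kcl1 Z α A f x + Kcl2 ν f x) • a (toH φ)
    + (toH (Kint1 Z a₀ f x φ) + toH (Kint2 Z A a₀ f x φ) + toH (Kint3 Z A a₀ f x φ)
        + Kint4 ν a f x φ)

/-! ## What it means that an unbounded expression is the value of the generator -/

/-- `k` is the value of the generator of `T` on `F`, pointwise in `x`: every `T_t[F]` has a weakly
continuous version `x ↦ V t x` (necessarily unique), and for every `x` and all Schwartz functions
`φ, ψ` the right derivative at `t = 0` of `⟨ψ| V t x φ⟩` is `⟨ψ| k(x) φ⟩`. -/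
def IsPointwiseGenerator {n s : ℕ} (T : ℝ → (HybridAlg n s →ₗ[ℂ] HybridAlg n s))
    (F : HybridAlg n s) (k : CPhase s → 𝓢(Config n, ℂ) → Hilb n) : Prop :=
  ∃ V : ℝ → CPhase s → Op n,
    (∀ t, 0 ≤ t → (∀ᵐ x : CPhase s, rep (T t F) x = V t x) ∧
      ∀ φ ψ : Hilb n, Continuous fun x => (inner ℂ ψ (V t x φ) : ℂ)) ∧
    ∀ (x : CPhase s) (φ ψ : 𝓢(Config n, ℂ)),
      HasDerivWithinAt (fun t => (inner ℂ (toH ψ) (V t x (toH φ)) : ℂ))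
        (inner ℂ (toH ψ) (k x φ)) (Ici 0) 0

/-- `k` is the value of the generator of `T` on `F` in the weak* sense, tested on the elements
`P(x) = p(x) |φ⟩⟨ψ|` of the predual with Schwartz functions `φ, ψ` and with `p ∈ L¹(ℝˢ)` of compact
support: `⟨P | k⟩` exists and is the right derivative at `t = 0` of `⟨P | T_t[F]⟩`. -/
def IsWeakStarGenerator {n s : ℕ} (T : ℝ → (HybridAlg n s →ₗ[ℂ] HybridAlg n s))
    (F : HybridAlg n s) (k : CPhase s → 𝓢(Config n, ℂ) → Hilb n) : Prop :=
  ∀ (p : CPhase s → ℂ) (φ ψ : 𝓢(Config n, ℂ)), Integrable p → HasCompactSupport p →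
    Integrable (fun x => p x * inner ℂ (toH ψ) (k x φ)) ∧
    HasDerivWithinAt (fun t => ∫ x, p x * inner ℂ (toH ψ) (rep (T t F) x (toH φ)))
      (∫ x, p x * inner ℂ (toH ψ) (k x φ)) (Ici 0) 0

end HybridQF

end

open MeasureTheory Complex Set
open scoped ComplexOrder SchwartzMap ENNReal Matrix

noncomputable section

namespace HybridQF

open Filter Topology FourierTransform

variable {n s : ℕ}

/-! On a Weyl operator everything is explicit. Between Schwartz vectors and at a point `x`, the
matrix element of `T_t[W(ξ)]` is a noise factor times a character of `x` times `⟨ψ|W₁(z)φ⟩`, with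
both arguments moved by the flow `S_t`. Its derivative at `t = 0` is a sum of three contributions:
the Lévy exponent at `ξ`, the classical part of `Zξ` paired with `x`, and `(i/2) ∑ (Zξ)_i ⟨ψ|{R_i,
W₁(ζ)}φ⟩`. The last one is the derivative of Weyl matrix elements in the phase space variable
(`hasFDerivAt_inner_weyl`). The algebraic half of the theorem says that this sum is the asserted
generator evaluated on a character. It rests on `R_i W₁(ζ) = W₁(ζ) R_i - (σζ)_i W₁(ζ)`
(`R_mul_weylS`, `Lq1_weylS`) and on the fact that conjugation by `W₁(σζ')` multiplies `W₁(ζ)` by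
`exp(i ζ'·ζ)` (`conj_weyl`). The jump terms then combine into one compensated kernel.

A Schwartz function `g` is a superposition of characters by Fourier inversion. Normality of `T_t`
carries the superposition through the semigroup and produces a weakly continuous version of
`T_t[W₁(ζ) ⊗ g]` (`exists_version_schwartz`). The orbit of a character is Lipschitz at `t = 0` with
a constant of order `(1 + |ξ|)²`, which the decay of the Fourier transform of `g` absorbs. One may
therefore differentiate under the integral (`hasDerivWithinAt_schwartz`) and recognise the result
(`inner_genK_schwartz`).

A general `f` is only twice differentiable and tends to `0` at infinity, so no integrability of its
Fourier transform is at hand. For a fixed `x` and `ε > 0` there is a Schwartz function `g` with the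
same second order jet at `x` and with `|f(y) - g(y)| ≤ ε min(1, |y - x|²)` for all `y`
(`exists_schwartz_approx`). Replacing `f` by `g` changes the generator at `x` only in the jump
integral, hence by `O(ε)` (`norm_inner_genK_sub_le`).

The change of the semigroup at `x` is `O(tε)`, and this is where complete positivity enters. If `|r|
≤ M w`, then the matrix elements of `T_t[W₁(ζ) ⊗ r]` are dominated by diagonal matrix elements of `M
T_t[1 ⊗ w]` (`version_inner_le`). Taking for `w` a weight that dominates `min(1, |y - x|²)`,
vanishes at `x` and differs from `1` by a Schwartz function, the Schwartz case and unitality give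
`T_t[1 ⊗ w](x) = O(t)` (`exists_remainder_bound`). Together these estimates give the pointwise
derivative for `W₁(ζ) ⊗ f` (`hasDerivWithinAt_weyl`).

When the second derivatives of `f` are continuous, the same domination applied to a cut-off first
order Taylor polynomial makes the orbits Lipschitz at `t = 0` uniformly for bounded `x`
(`exists_weyl_lipschitz`). Dominated convergence then yields the weak* statement. Linearity extends
both statements to the span of the Weyl operators. -/

/-! ### Weyl operators on the Schwartz space and the Weyl relations. -/

theorem hasTemperateGrowth_exp_I :
    Function.HasTemperateGrowth fun t : ℝ => cexp (I * (t : ℂ)) := by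
  have hc : ContDiff ℝ (⊤ : ℕ∞) fun t : ℝ => cexp (I * (t : ℂ)) :=
    (contDiff_const.mul Complex.ofRealCLM.contDiff).cexp
  have hd : ∀ k : ℕ, iteratedDeriv k (fun t : ℝ => cexp (I * (t : ℂ)))
      = fun t : ℝ => I ^ k * cexp (I * (t : ℂ)) := by
    intro k
    induction k with
    | zero => simp
    | succ k ih =>
      rw [iteratedDeriv_succ, ih]
      funext t
      have h : HasDerivAt (fun t : ℝ => I ^ k * cexp (I * (t : ℂ)))
          (I ^ k * (cexp (I * (t : ℂ)) * (I * 1))) t :=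
        ((((hasDerivAt_id t).ofReal_comp).const_mul I).cexp).const_mul _
      rw [h.deriv]
      ring
  refine ⟨hc, fun k => ⟨0, 1, fun t => ?_⟩⟩
  rw [norm_iteratedFDeriv_eq_norm_iteratedDeriv, hd k]
  simp [mul_comm I, Complex.norm_exp_ofReal_mul_I]


/-- The real phase of a Weyl operator. -/
def weylArg (ζ : QPhase n) (q : Config n) : ℝ :=
  ∑ j, ζ (Sum.inl j) * q j + (∑ j, ζ (Sum.inl j) * ζ (Sum.inr j)) / 2

theorem weylPhase_eq (ζ : QPhase n) (q : Config n) :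
    weylPhase ζ q = cexp (I * (weylArg ζ q : ℂ)) := rfl

theorem norm_weylPhase (ζ : QPhase n) (q : Config n) : ‖weylPhase ζ q‖ = 1 := by
  rw [weylPhase_eq, mul_comm, Complex.norm_exp_ofReal_mul_I]

theorem hasTemperateGrowth_weylPhase (ζ : QPhase n) :
    Function.HasTemperateGrowth (weylPhase ζ) := by
  refine hasTemperateGrowth_exp_I.comp (f := weylArg ζ) ?_
  unfold weylArg
  refine Function.HasTemperateGrowth.add (Function.HasTemperateGrowth.sum fun j _ => ?_)
    (Function.HasTemperateGrowth.const _)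
  exact (Function.HasTemperateGrowth.const _).mul
    (EuclideanSpace.proj (𝕜 := ℝ) j).hasTemperateGrowth

/-- The momentum part `v` of `ζ = (u, v)`. -/
def shiftVec (ζ : QPhase n) : Config n := WithLp.toLp 2 fun j => ζ (Sum.inr j)

theorem weylShift_eq (ζ : QPhase n) (q : Config n) : weylShift ζ q = q + shiftVec ζ := rfl

/-- The restriction of the Weyl operator to the Schwartz space. -/
def weylS (ζ : QPhase n) : SOp n :=
  (SchwartzMap.smulLeftCLM ℂ (weylPhase ζ)).toLinearMap ∘ₗ
    (SchwartzMap.compSubConstCLM ℂ (-shiftVec ζ)).toLinearMap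

theorem weylS_apply (ζ : QPhase n) (φ : 𝓢(Config n, ℂ)) (q : Config n) :
    weylS ζ φ q = weylPhase ζ q * φ (q + shiftVec ζ) := by
  simp only [weylS, LinearMap.coe_comp, Function.comp_apply, ContinuousLinearMap.coe_coe]
  rw [SchwartzMap.smulLeftCLM_apply_apply (hasTemperateGrowth_weylPhase ζ),
    SchwartzMap.compSubConstCLM_apply, sub_neg_eq_add, smul_eq_mul]

theorem toH_coeFn (φ : 𝓢(Config n, ℂ)) : (toH φ : Config n → ℂ) =ᵐ[volume] φ :=
  φ.coeFn_toLp 2 volume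

theorem weylS_restricts (ζ : QPhase n) : Restricts (weyl ζ) (weylS ζ) := by
  intro φ
  refine Lp.ext ?_
  have h1 := toH_coeFn φ
  have h2 := (weylShift_measurePreserving ζ).quasiMeasurePreserving.ae_eq_comp h1
  filter_upwards [toH_coeFn (weylS ζ φ), weyl_coeFn ζ (toH φ), h2] with q h3 h4 h5
  rw [h3, h4, weylS_apply]
  simp only [Function.comp_apply] at h5
  rw [h5, weylShift_eq]

/-- `toH` as a linear map. -/
def toHₗ (n : ℕ) : 𝓢(Config n, ℂ) →ₗ[ℂ] Hilb n :=
  (SchwartzMap.toLpCLM ℂ ℂ 2 volume).toLinearMap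

theorem toH_add (φ ψ : 𝓢(Config n, ℂ)) : toH (φ + ψ) = toH φ + toH ψ := map_add (toHₗ n) φ ψ

theorem toH_neg (φ : 𝓢(Config n, ℂ)) : toH (-φ) = -toH φ := map_neg (toHₗ n) φ

theorem toH_smul (c : ℂ) (φ : 𝓢(Config n, ℂ)) : toH (c • φ) = c • toH φ := map_smul (toHₗ n) c φ

theorem toH_sum {ι : Type*} (t : Finset ι) (φ : ι → 𝓢(Config n, ℂ)) :
    toH (∑ i ∈ t, φ i) = ∑ i ∈ t, toH (φ i) := map_sum (toHₗ n) φ t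

theorem denseRange_toH : DenseRange (toH (n := n)) :=
  SchwartzMap.denseRange_toLpCLM (p := 2) (by simp)

/-- Bounded operators agreeing on Schwartz vectors are equal. -/
theorem op_ext_schwartz {a b : Op n} (h : ∀ φ, a (toH φ) = b (toH φ)) : a = b :=
  ContinuousLinearMap.coeFn_injective (denseRange_toH.equalizer a.continuous b.continuous (funext h))

theorem norm_weyl_apply (ζ : QPhase n) (φ : Hilb n) : ‖weyl ζ φ‖ = ‖φ‖ := by
  rw [Lp.norm_def, Lp.norm_def]
  congr 1
  rw [eLpNorm_congr_norm_ae (g := (φ : Config n → ℂ) ∘ weylShift ζ)]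
  · exact eLpNorm_comp_measurePreserving (Lp.aestronglyMeasurable φ) (weylShift_measurePreserving ζ)
  · filter_upwards [weyl_coeFn ζ φ] with q hq
    rw [hq, norm_mul, norm_weylPhase, one_mul]
    rfl

theorem adjoint_weyl_comp (ζ : QPhase n) :
    ContinuousLinearMap.adjoint (weyl ζ) ∘L weyl ζ = 1 :=
  (ContinuousLinearMap.norm_map_iff_adjoint_comp_self _).1 (norm_weyl_apply ζ)

theorem norm_weyl_le (ζ : QPhase n) : ‖weyl ζ‖ ≤ 1 :=
  ContinuousLinearMap.opNorm_le_bound _ zero_le_one fun φ => by rw [norm_weyl_apply, one_mul]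

theorem weyl_zero : weyl (0 : QPhase n) = 1 := by
  refine op_ext_schwartz fun φ => ?_
  rw [← weylS_restricts 0 φ]
  change toH _ = toH φ
  congr 1
  ext q
  have h : shiftVec (0 : QPhase n) = 0 := by ext j; simp [shiftVec]
  rw [weylS_apply, weylPhase_eq, h]
  simp [weylArg]

/-- The half phases `u·v/2` cancel between the two orders of composition; only the symplectic form
of `ζ` and `c` survives. -/
theorem weylArg_shift (ζ c : QPhase n) (q : Config n) :
    weylArg ζ q + weylArg c (q + shiftVec ζ) - (weylArg c q + weylArg ζ (q + shiftVec c))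
      = ∑ j, (c (Sum.inl j) * ζ (Sum.inr j) - ζ (Sum.inl j) * c (Sum.inr j)) := by
  simp only [weylArg, shiftVec, PiLp.add_apply, mul_add, Finset.sum_add_distrib,
    Finset.sum_sub_distrib]
  ring

theorem sigmaVec_inl (ζ : QPhase n) (j : Fin n) : sigmaVec ζ (Sum.inl j) = ζ (Sum.inr j) := by
  simp [sigmaVec, sigma, Matrix.mulVec, dotProduct, Matrix.one_apply]

theorem sigmaVec_inr (ζ : QPhase n) (j : Fin n) : sigmaVec ζ (Sum.inr j) = -ζ (Sum.inl j) := by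
  simp [sigmaVec, sigma, Matrix.mulVec, dotProduct, Matrix.one_apply]

/-- Evaluating the symplectic form at `σ η` turns it into the Euclidean product `η · ζ`, which
explains the argument `σζ` in the jump terms of the generator. -/
theorem weyl_comp_comm (ζ η : QPhase n) :
    weyl ζ ∘L weyl (sigmaVec η)
      = cexp (I * ((∑ i, η i * ζ i : ℝ) : ℂ)) • (weyl (sigmaVec η) ∘L weyl ζ) := by
  refine op_ext_schwartz fun φ => ?_
  simp only [ContinuousLinearMap.comp_apply, smul_apply]
  rw [← weylS_restricts, ← weylS_restricts, ← weylS_restricts, ← weylS_restricts, ← toH_smul]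
  congr 1
  ext q
  rw [smul_apply]
  simp only [weylS_apply, smul_eq_mul]
  rw [show q + shiftVec ζ + shiftVec (sigmaVec η) = q + shiftVec (sigmaVec η) + shiftVec ζ by abel]
  simp only [weylPhase_eq, ← mul_assoc, ← Complex.exp_add]
  congr 2
  have h := weylArg_shift ζ (sigmaVec η) q
  have h2 : ∑ j, (sigmaVec η (Sum.inl j) * ζ (Sum.inr j) - ζ (Sum.inl j) * sigmaVec η (Sum.inr j))
      = ∑ i, η i * ζ i := by
    rw [Fintype.sum_sum_type, ← Finset.sum_add_distrib]
    refine Finset.sum_congr rfl fun j _ => ?_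
    rw [sigmaVec_inl, sigmaVec_inr]
    ring
  rw [h2] at h
  have h3 : weylArg ζ q + weylArg (sigmaVec η) (q + shiftVec ζ) = (∑ i, η i * ζ i) +
      (weylArg (sigmaVec η) q + weylArg ζ (q + shiftVec (sigmaVec η))) := by linarith
  have h4 := congrArg (fun r : ℝ => I * (r : ℂ)) h3
  push_cast at h4 ⊢
  linear_combination h4

/-- Each Weyl operator is an eigenvector of every conjugation, so that operator valued jump
integrals reduce to scalar ones. -/
theorem conj_weyl (ζ η : QPhase n) :
    conj η (weyl ζ) = cexp (I * ((∑ i, η i * ζ i : ℝ) : ℂ)) • weyl ζ := by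
  rw [conj, weyl_comp_comm, ContinuousLinearMap.comp_smul, ← ContinuousLinearMap.comp_assoc,
    adjoint_weyl_comp]
  rfl

theorem shiftVec_apply (ζ : QPhase n) (j : Fin n) : shiftVec ζ j = ζ (Sum.inr j) := rfl

theorem hasFDerivAt_weylPhase_config (ζ : QPhase n) (q : Config n) :
    HasFDerivAt (weylPhase ζ) ((I * weylPhase ζ q) •
      Complex.ofRealCLM ∘L ∑ j, ζ (Sum.inl j) • EuclideanSpace.proj (𝕜 := ℝ) j) q := by
  have h1 : HasFDerivAt (weylArg ζ) (∑ j, ζ (Sum.inl j) • EuclideanSpace.proj (𝕜 := ℝ) j) q := by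
    unfold weylArg
    refine HasFDerivAt.add_const _ (HasFDerivAt.fun_sum fun j _ => ?_)
    exact ((EuclideanSpace.proj (𝕜 := ℝ) j).hasFDerivAt).const_mul _
  have h2 := ((Complex.ofRealCLM.hasFDerivAt.comp q h1).const_mul I).cexp
  refine h2.congr_fderiv ?_
  ext v
  simp only [smul_apply, smul_eq_mul, weylPhase_eq, Function.comp_apply, Complex.ofRealCLM_apply]
  ring

theorem fderiv_weylS (ζ : QPhase n) (φ : 𝓢(Config n, ℂ)) (q v : Config n) :
    fderiv ℝ (weylS ζ φ) q v = (I * ((∑ j, ζ (Sum.inl j) * v j : ℝ) : ℂ)) * weylS ζ φ q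
      + weylPhase ζ q * fderiv ℝ φ (q + shiftVec ζ) v := by
  have h0 : (weylS ζ φ : Config n → ℂ) = fun q => weylPhase ζ q * φ (q + shiftVec ζ) :=
    funext (weylS_apply ζ φ)
  have h1 : HasFDerivAt (fun q => φ (q + shiftVec ζ)) (fderiv ℝ φ (q + shiftVec ζ)) q :=
    (hasFDerivAt_comp_add_right _).2 (φ.hasFDerivAt (q + shiftVec ζ))
  rw [h0, ((hasFDerivAt_weylPhase_config ζ q).fun_mul h1).fderiv]
  simp only [add_apply, smul_apply, smul_eq_mul, ContinuousLinearMap.comp_apply,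
    Complex.ofRealCLM_apply, _root_.sum_apply, PiLp.proj_apply]
  ring

/-- The Weyl commutation relation `[R_i, W₁(ζ)] = -(σζ)_i W₁(ζ)`. -/
theorem R_mul_weylS (ζ : QPhase n) (i : Fin n ⊕ Fin n) :
    R i * weylS ζ = weylS ζ * R i - (sigmaVec ζ i : ℂ) • weylS ζ := by
  refine LinearMap.ext fun φ => ?_
  ext q
  rw [LinearMap.sub_apply, LinearMap.smul_apply, Module.End.mul_apply, Module.End.mul_apply,
    sub_apply, smul_apply]
  rcases i with j | j
  · simp only [R, Sum.elim_inl, posOp_apply, weylS_apply, sigmaVec_inl, smul_eq_mul,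
      PiLp.add_apply, shiftVec_apply]
    push_cast
    ring
  · simp only [R, Sum.elim_inr, momOp_apply, weylS_apply, sigmaVec_inr, smul_eq_mul,
      fderiv_weylS]
    have : ∑ x, ζ (Sum.inl x) * (EuclideanSpace.single j (1 : ℝ) : Config n) x
        = ζ (Sum.inl j) := by
      simp [PiLp.single_apply]
    rw [this]
    push_cast
    linear_combination (-ζ (Sum.inl j) * (weylPhase ζ q * φ (q + shiftVec ζ))) * I_sq

/-! ### Matrix elements of Weyl operators as functions of the phase space point. -/

/-- The shift as a continuous linear map. -/
def shiftCLM (n : ℕ) : QPhase n →L[ℝ] Config n :=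
  LinearMap.toContinuousLinearMap
    { toFun := shiftVec
      map_add' := fun _ _ => rfl
      map_smul' := fun _ _ => rfl }

theorem shiftCLM_apply (ζ : QPhase n) : shiftCLM n ζ = shiftVec ζ := rfl

/-- The derivative of the phase argument in the phase space variable. -/
def weylArgD (z : QPhase n) (q : Config n) : QPhase n →L[ℝ] ℝ :=
  ∑ j, (q j • EuclideanSpace.proj (𝕜 := ℝ) (Sum.inl j : Fin n ⊕ Fin n)
    + (1 / 2 : ℝ) • (z (Sum.inr j) • EuclideanSpace.proj (𝕜 := ℝ) (Sum.inl j : Fin n ⊕ Fin n)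
      + z (Sum.inl j) • EuclideanSpace.proj (𝕜 := ℝ) (Sum.inr j : Fin n ⊕ Fin n)))

theorem weylArgD_apply (z z' : QPhase n) (q : Config n) :
    weylArgD z q z' = ∑ j, (q j * z' (Sum.inl j)
      + (1 / 2 : ℝ) * (z (Sum.inr j) * z' (Sum.inl j) + z (Sum.inl j) * z' (Sum.inr j))) := by
  rw [weylArgD, _root_.sum_apply]
  refine Finset.sum_congr rfl fun j _ => ?_
  simp only [add_apply, smul_apply, PiLp.proj_apply, smul_eq_mul]

theorem norm_weylArgD_le (z : QPhase n) (q : Config n) :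
    ‖weylArgD z q‖ ≤ n * (‖q‖ + ‖z‖) := by
  refine ContinuousLinearMap.opNorm_le_bound _ (by positivity) fun z' => ?_
  rw [weylArgD_apply]
  refine (norm_sum_le _ _).trans ?_
  calc ∑ j : Fin n, ‖q j * z' (Sum.inl j)
      + (1 / 2 : ℝ) * (z (Sum.inr j) * z' (Sum.inl j) + z (Sum.inl j) * z' (Sum.inr j))‖
      ≤ ∑ _j : Fin n, (‖q‖ + ‖z‖) * ‖z'‖ := by
        refine Finset.sum_le_sum fun j _ => ?_
        have h1 := PiLp.norm_apply_le q j
        have h2 := PiLp.norm_apply_le z (Sum.inl j)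
        have h3 := PiLp.norm_apply_le z (Sum.inr j)
        have h4 := PiLp.norm_apply_le z' (Sum.inl j)
        have h5 := PiLp.norm_apply_le z' (Sum.inr j)
        calc _ ≤ ‖q j‖ * ‖z' (Sum.inl j)‖ + (1 / 2 : ℝ) * (‖z (Sum.inr j)‖ * ‖z' (Sum.inl j)‖
              + ‖z (Sum.inl j)‖ * ‖z' (Sum.inr j)‖) := by
              refine (norm_add_le _ _).trans ?_
              rw [norm_mul, norm_mul]
              refine add_le_add le_rfl ?_
              rw [show ‖(1 / 2 : ℝ)‖ = 1 / 2 by norm_num]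
              gcongr
              refine (norm_add_le _ _).trans ?_
              rw [norm_mul, norm_mul]
          _ ≤ ‖q‖ * ‖z'‖ + (1 / 2 : ℝ) * (‖z‖ * ‖z'‖ + ‖z‖ * ‖z'‖) := by gcongr
          _ = (‖q‖ + ‖z‖) * ‖z'‖ := by ring
    _ = n * (‖q‖ + ‖z‖) * ‖z'‖ := by simp [mul_assoc]

theorem hasFDerivAt_weylArg (z : QPhase n) (q : Config n) :
    HasFDerivAt (fun z : QPhase n => weylArg z q) (weylArgD z q) z := by
  have h : ∀ i : Fin n ⊕ Fin n, HasFDerivAt (fun z : QPhase n => z i)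
      (EuclideanSpace.proj (𝕜 := ℝ) i) z :=
    fun i => (EuclideanSpace.proj (𝕜 := ℝ) i).hasFDerivAt
  have h1 : HasFDerivAt (fun z : QPhase n => weylArg z q)
      (∑ j, q j • EuclideanSpace.proj (𝕜 := ℝ) (Sum.inl j : Fin n ⊕ Fin n)
        + (1 / 2 : ℝ) • ∑ j, (z (Sum.inl j) • EuclideanSpace.proj (𝕜 := ℝ) (Sum.inr j : Fin n ⊕ Fin n)
          + z (Sum.inr j) • EuclideanSpace.proj (𝕜 := ℝ) (Sum.inl j : Fin n ⊕ Fin n))) z := by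
    unfold weylArg
    refine HasFDerivAt.add (HasFDerivAt.fun_sum fun j _ => (h _).mul_const _) ?_
    have h2 := (HasFDerivAt.fun_sum (u := Finset.univ) fun j _ =>
      (h (Sum.inl j)).fun_mul (h (Sum.inr j))).mul_const (1 / 2 : ℝ)
    simpa only [div_eq_mul_inv, one_mul] using h2
  refine h1.congr_fderiv ?_
  ext z'
  rw [weylArgD_apply]
  simp only [add_apply, _root_.sum_apply, smul_apply, PiLp.proj_apply,
    smul_eq_mul, Finset.mul_sum, ← Finset.sum_add_distrib]
  refine Finset.sum_congr rfl fun j _ => by ring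

/-- The derivative of the matrix element integrand in the phase space variable. -/
def weylIntegrandD (φ ψ : 𝓢(Config n, ℂ)) (z : QPhase n) (q : Config n) : QPhase n →L[ℝ] ℂ :=
  (inner ℂ (ψ q) 1 * weylPhase z q) •
    ((I * φ (q + shiftVec z)) • (Complex.ofRealCLM ∘L weylArgD z q)
      + fderiv ℝ φ (q + shiftVec z) ∘L shiftCLM n)

theorem hasFDerivAt_weylIntegrand (φ ψ : 𝓢(Config n, ℂ)) (z : QPhase n) (q : Config n) :
    HasFDerivAt (fun z => (inner ℂ (ψ q) (weylS z φ q) : ℂ)) (weylIntegrandD φ ψ z q) z := by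
  have h1 : HasFDerivAt (fun z => weylPhase z q)
      ((I * weylPhase z q) • Complex.ofRealCLM ∘L weylArgD z q) z := by
    have h2 := ((Complex.ofRealCLM.hasFDerivAt.comp z (hasFDerivAt_weylArg z q)).const_mul I).cexp
    refine h2.congr_fderiv ?_
    ext v
    simp only [smul_apply, smul_eq_mul, weylPhase_eq, Function.comp_apply, Complex.ofRealCLM_apply]
    ring
  have h3 : HasFDerivAt (fun z => φ (q + shiftVec z))
      (fderiv ℝ φ (q + shiftVec z) ∘L shiftCLM n) z :=
    (φ.hasFDerivAt (q + shiftVec z)).comp z ((shiftCLM n).hasFDerivAt.const_add q)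
  have h4 := (h1.mul h3).const_mul (inner ℂ (ψ q) 1 : ℂ)
  have h5 : (fun z => (inner ℂ (ψ q) (weylS z φ q) : ℂ))
      = fun z => (inner ℂ (ψ q) 1 : ℂ) * (weylPhase z q * φ (q + shiftVec z)) := by
    funext z
    rw [weylS_apply]
    simp [RCLike.inner_apply]
    ring
  rw [h5]
  refine h4.congr_fderiv ?_
  ext v
  simp only [weylIntegrandD, add_apply, smul_apply, smul_eq_mul, ContinuousLinearMap.comp_apply,
    Complex.ofRealCLM_apply]
  ring

/-- The half phase `u·v/2` accounts for the symmetric ordering. For positions it turns `q_j` into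
`q_j + v_j/2`, half of `{Q_j, W}`; for momenta it adds `u_j/2` to the derivative produced by the
shift, half of `{P_j, W}`. -/
theorem weylIntegrandD_apply (φ ψ : 𝓢(Config n, ℂ)) (z z' : QPhase n) (q : Config n) :
    weylIntegrandD φ ψ z q z' = (I / 2) * ∑ i, (z' i : ℂ) *
      inner ℂ (ψ q) (acomm (R i) (weylS z) φ q) := by
  have hq : ∀ j : Fin n, acomm (R (Sum.inl j)) (weylS z) φ q
      = ((2 * q j + z (Sum.inr j) : ℝ) : ℂ) * (weylPhase z q * φ (q + shiftVec z)) := by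
    intro j
    rw [acomm, LinearMap.add_apply, Module.End.mul_apply, Module.End.mul_apply, add_apply]
    simp only [R, Sum.elim_inl, posOp_apply, weylS_apply, PiLp.add_apply, shiftVec_apply]
    push_cast
    ring
  have hp : ∀ j : Fin n, acomm (R (Sum.inr j)) (weylS z) φ q
      = weylPhase z q * (z (Sum.inl j) * φ (q + shiftVec z)
        - 2 * I * fderiv ℝ φ (q + shiftVec z) (EuclideanSpace.single j 1)) := by
    intro j
    rw [acomm, LinearMap.add_apply, Module.End.mul_apply, Module.End.mul_apply, add_apply]
    simp only [R, Sum.elim_inr, momOp_apply, weylS_apply, fderiv_weylS]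
    have : ∑ x, z (Sum.inl x) * (EuclideanSpace.single j (1 : ℝ) : Config n) x
        = z (Sum.inl j) := by
      simp [PiLp.single_apply]
    rw [this]
    linear_combination (-z (Sum.inl j) * (weylPhase z q * φ (q + shiftVec z))) * I_sq
  have hv : fderiv ℝ φ (q + shiftVec z) (shiftVec z')
      = ∑ j, (z' (Sum.inr j) : ℂ) *
        fderiv ℝ φ (q + shiftVec z) (EuclideanSpace.single j 1) := by
    have : shiftVec z' = ∑ j, z' (Sum.inr j) • (EuclideanSpace.single j (1 : ℝ) : Config n) := by
      ext i
      simp [shiftVec_apply, Finset.sum_apply, Pi.single_apply]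
    rw [this, map_sum]
    refine Finset.sum_congr rfl fun j _ => ?_
    rw [map_smul, Complex.real_smul]
  have hi : ∀ w : ℂ, (inner ℂ (ψ q) w : ℂ) = inner ℂ (ψ q) 1 * w := by
    intro w
    simp [RCLike.inner_apply, mul_comm]
  rw [Fintype.sum_sum_type]
  simp only [hq, hp]
  simp only [hi (_ * _)]
  simp only [weylIntegrandD, add_apply, smul_apply, smul_eq_mul, ContinuousLinearMap.comp_apply,
    Complex.ofRealCLM_apply, shiftCLM_apply, hv, weylArgD_apply]
  push_cast
  simp only [Finset.mul_sum, mul_add, ← Finset.sum_add_distrib]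
  refine Finset.sum_congr rfl fun j _ => ?_
  linear_combination ((z' (Sum.inr j) : ℂ) * inner ℂ (ψ q) 1 * weylPhase z q *
    fderiv ℝ φ (q + shiftVec z) (EuclideanSpace.single j 1)) * I_sq

theorem schwartz_bounded {E F : Type*} [NormedAddCommGroup E] [NormedSpace ℝ E]
    [NormedAddCommGroup F] [NormedSpace ℝ F] (φ : 𝓢(E, F)) : ∃ C, 0 ≤ C ∧ ∀ q, ‖φ q‖ ≤ C :=
  ⟨SchwartzMap.seminorm ℝ 0 0 φ, apply_nonneg _ _, SchwartzMap.norm_le_seminorm ℝ φ⟩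

theorem schwartz_fderiv_bounded {E F : Type*} [NormedAddCommGroup E] [NormedSpace ℝ E]
    [NormedAddCommGroup F] [NormedSpace ℝ F] (φ : 𝓢(E, F)) :
    ∃ C, 0 ≤ C ∧ ∀ q, ‖fderiv ℝ φ q‖ ≤ C :=
  schwartz_bounded (SchwartzMap.fderivCLM ℝ E F φ)

theorem inner_toH_weyl (φ ψ : 𝓢(Config n, ℂ)) (z : QPhase n) :
    inner ℂ (toH ψ) (weyl z (toH φ)) = ∫ q, (inner ℂ (ψ q) (weylS z φ q) : ℂ) := by
  rw [← weylS_restricts]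
  exact SchwartzMap.inner_toL2_toL2_eq ψ (weylS z φ) volume

/-- The unbounded factor `‖q‖` is charged to `ψ`, which is not shifted, while `φ` and its derivative
enter only through their suprema. The integrable majorant is thus the same for all `z` up to a
factor of linear growth. -/
theorem norm_weylIntegrandD_le (φ ψ : 𝓢(Config n, ℂ)) :
    ∃ K, 0 ≤ K ∧ ∀ z q, ‖weylIntegrandD φ ψ z q‖ ≤ K * (1 + ‖z‖) * (‖ψ q‖ + ‖q‖ ^ 1 * ‖ψ q‖) := by
  obtain ⟨C, hC0, hC⟩ := schwartz_bounded φ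
  obtain ⟨D, hD0, hD⟩ := schwartz_fderiv_bounded φ
  refine ⟨C * n + D * ‖shiftCLM n‖, by positivity, fun z q => ?_⟩
  have h1 : ‖(inner ℂ (ψ q) 1 * weylPhase z q : ℂ)‖ = ‖ψ q‖ := by
    rw [norm_mul, norm_weylPhase]
    simp [RCLike.inner_apply]
  have h2 : ‖(I * φ (q + shiftVec z)) • (Complex.ofRealCLM ∘L weylArgD z q)‖
      ≤ C * (n * (‖q‖ + ‖z‖)) := by
    rw [norm_smul, norm_mul, norm_I, one_mul]
    refine mul_le_mul (hC _) ?_ (norm_nonneg _) hC0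
    refine (ContinuousLinearMap.opNorm_comp_le _ _).trans ?_
    rw [Complex.ofRealCLM_norm, one_mul]
    exact norm_weylArgD_le z q
  have h3 : ‖fderiv ℝ φ (q + shiftVec z) ∘L shiftCLM n‖ ≤ D * ‖shiftCLM n‖ :=
    (ContinuousLinearMap.opNorm_comp_le _ _).trans (mul_le_mul_of_nonneg_right (hD _)
      (norm_nonneg _))
  rw [weylIntegrandD, norm_smul, h1]
  calc ‖ψ q‖ * _ ≤ ‖ψ q‖ * (C * (n * (‖q‖ + ‖z‖)) + D * ‖shiftCLM n‖) := by
        gcongr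
        exact (norm_add_le _ _).trans (add_le_add h2 h3)
    _ ≤ ‖ψ q‖ * ((C * n + D * ‖shiftCLM n‖) * ((1 + ‖z‖) * (1 + ‖q‖))) := by
        gcongr
        have a1 : 0 ≤ ‖z‖ * ‖q‖ := by positivity
        have a2 : 0 ≤ C * n := by positivity
        have a3 : 0 ≤ D * ‖shiftCLM n‖ := by positivity
        nlinarith [norm_nonneg z, norm_nonneg q, mul_nonneg a2 a1, mul_nonneg a3 a1,
          mul_nonneg a3 (norm_nonneg z), mul_nonneg a3 (norm_nonneg q)]
    _ = _ := by ring

theorem integrable_schwartz_weight (ψ : 𝓢(Config n, ℂ)) :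
    Integrable (fun q => ‖ψ q‖ + ‖q‖ ^ 1 * ‖ψ q‖) :=
  ψ.integrable.norm.add (ψ.integrable_pow_mul volume 1)

theorem continuous_weylArgD (z : QPhase n) : Continuous (weylArgD z) := by
  unfold weylArgD
  fun_prop

theorem continuous_weylPhase (z : QPhase n) : Continuous (weylPhase z) := by
  unfold weylPhase
  fun_prop

theorem continuous_weylIntegrandD (φ ψ : 𝓢(Config n, ℂ)) (z : QPhase n) :
    Continuous (weylIntegrandD φ ψ z) := by
  have h1 : Continuous fun q => fderiv ℝ φ (q + shiftVec z) :=
    (SchwartzMap.fderivCLM ℝ (Config n) ℂ φ).continuous.comp (continuous_add_const _)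
  have h2 := continuous_weylArgD z
  have h3 := continuous_weylPhase z
  have h4 : Continuous fun q => φ (q + shiftVec z) := φ.continuous.comp (continuous_add_const _)
  have h5 : Continuous fun q => (inner ℂ (ψ q) 1 : ℂ) := ψ.continuous.inner continuous_const
  unfold weylIntegrandD
  exact (h5.mul h3).smul (((continuous_const.mul h4).smul (continuous_const.clm_comp h2)).add
    (h1.clm_comp continuous_const))

/-- Matrix elements of the Weyl operators between Schwartz vectors are differentiable, with a
derivative of linear growth. -/
theorem hasFDerivAt_inner_weyl (φ ψ : 𝓢(Config n, ℂ)) :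
    ∃ (K : ℝ) (G : QPhase n → QPhase n →L[ℝ] ℂ), 0 ≤ K ∧ (∀ z, ‖G z‖ ≤ K * (1 + ‖z‖)) ∧
      (∀ z, HasFDerivAt (fun z => (inner ℂ (toH ψ) (weyl z (toH φ)) : ℂ)) (G z) z) ∧
      ∀ z z', G z z' = (I / 2) * ∑ i, (z' i : ℂ) *
        inner ℂ (toH ψ) (toH (acomm (R i) (weylS z) φ)) := by
  obtain ⟨K, hK0, hK⟩ := norm_weylIntegrandD_le φ ψ
  have hint : ∀ z, Integrable (weylIntegrandD φ ψ z) := fun z =>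
    ((integrable_schwartz_weight ψ).const_mul (K * (1 + ‖z‖))).mono'
      (continuous_weylIntegrandD φ ψ z).aestronglyMeasurable (Eventually.of_forall (hK z))
  have hw := integrable_schwartz_weight ψ
  refine ⟨K * ∫ q, (‖ψ q‖ + ‖q‖ ^ 1 * ‖ψ q‖), fun z => ∫ q, weylIntegrandD φ ψ z q, ?_, fun z => ?_,
    fun z => ?_, fun z z' => ?_⟩
  · exact mul_nonneg hK0 (integral_nonneg fun q => by positivity)
  · calc _ ≤ ∫ q, K * (1 + ‖z‖) * (‖ψ q‖ + ‖q‖ ^ 1 * ‖ψ q‖) :=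
          norm_integral_le_of_norm_le (hw.const_mul _) (Eventually.of_forall (hK z))
      _ = _ := by rw [integral_const_mul]; ring
  · simp only [inner_toH_weyl]
    refine hasFDerivAt_integral_of_dominated_of_fderiv_le (Metric.ball_mem_nhds z zero_lt_one)
      (F' := fun z q => weylIntegrandD φ ψ z q)
      (bound := fun q => K * (1 + (‖z‖ + 1)) * (‖ψ q‖ + ‖q‖ ^ 1 * ‖ψ q‖)) ?_ ?_ ?_ ?_ ?_ ?_
    · exact Eventually.of_forall fun z =>
        (ψ.continuous.inner (weylS z φ).continuous).aestronglyMeasurable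
    · obtain ⟨C, hC0, hC⟩ := schwartz_bounded (weylS z φ)
      refine (ψ.integrable.norm.mul_const C).mono'
        (ψ.continuous.inner (weylS z φ).continuous).aestronglyMeasurable
        (Eventually.of_forall fun q => ?_)
      exact (norm_inner_le_norm _ _).trans (mul_le_mul_of_nonneg_left (hC q) (norm_nonneg _))
    · exact (continuous_weylIntegrandD φ ψ z).aestronglyMeasurable
    · refine Eventually.of_forall fun q y hy => (hK y q).trans ?_
      have : ‖y‖ ≤ ‖z‖ + 1 := by
        have := norm_le_norm_add_norm_sub z y
        rw [mem_ball_iff_norm'] at hy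
        linarith
      gcongr
    · exact hw.const_mul _
    · exact Eventually.of_forall fun q y _ => hasFDerivAt_weylIntegrand φ ψ y q
  · rw [ContinuousLinearMap.integral_apply (hint z)]
    simp only [weylIntegrandD_apply]
    rw [integral_const_mul, integral_finsetSum]
    · congr 1
      refine Finset.sum_congr rfl fun i _ => ?_
      rw [integral_const_mul]
      congr 1
      exact (SchwartzMap.inner_toL2_toL2_eq ψ (acomm (R i) (weylS z) φ) volume).symm
    · intro i _
      refine Integrable.const_mul ?_ _
      obtain ⟨C, hC0, hC⟩ := schwartz_bounded (acomm (R i) (weylS z) φ)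
      refine (ψ.integrable.norm.mul_const C).mono'
        (ψ.continuous.inner (acomm (R i) (weylS z) φ).continuous).aestronglyMeasurable
        (Eventually.of_forall fun q => ?_)
      exact (norm_inner_le_norm _ _).trans (mul_le_mul_of_nonneg_left (hC q) (norm_nonneg _))

/-- Matrix elements of the Weyl operators between Schwartz vectors are locally Lipschitz. -/
theorem inner_weyl_lipschitz (φ ψ : 𝓢(Config n, ℂ)) :
    ∃ K, 0 ≤ K ∧ ∀ (r : ℝ) (z z' : QPhase n), ‖z‖ ≤ r → ‖z'‖ ≤ r →
      ‖(inner ℂ (toH ψ) (weyl z (toH φ)) - inner ℂ (toH ψ) (weyl z' (toH φ)) : ℂ)‖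
        ≤ K * (1 + r) * ‖z - z'‖ := by
  obtain ⟨K, G, hK0, hK, hG, -⟩ := hasFDerivAt_inner_weyl φ ψ
  refine ⟨K, hK0, fun r z z' hz hz' => ?_⟩
  refine (convex_closedBall (0 : QPhase n) r).norm_image_sub_le_of_norm_hasFDerivWithin_le
    (f := fun z => (inner ℂ (toH ψ) (weyl z (toH φ)) : ℂ))
    (fun y _ => (hG y).hasFDerivWithinAt) (fun y hy => (hK y).trans ?_)
    (mem_closedBall_zero_iff.2 hz') (mem_closedBall_zero_iff.2 hz)
  have := mem_closedBall_zero_iff.1 hy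
  gcongr

/-- Weak continuity of isometries is strong continuity: `‖W(z)φ - W(z₀)φ‖² = 2‖φ‖² - 2
Re⟨W(z₀)φ|W(z)φ⟩`, and `W(z₀)φ` is again a Schwartz vector, so the matrix element on the right is
already known to be continuous. -/
theorem continuous_weyl_toH (φ : 𝓢(Config n, ℂ)) : Continuous fun z => weyl z (toH φ) := by
  refine continuous_iff_continuousAt.2 fun z₀ => tendsto_iff_norm_sub_tendsto_zero.2 ?_
  obtain ⟨K, G, -, -, hG, -⟩ := hasFDerivAt_inner_weyl φ (weylS z₀ φ)
  have h1 : Tendsto (fun z => (inner ℂ (toH (weylS z₀ φ)) (weyl z (toH φ)) : ℂ)) (𝓝 z₀)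
      (𝓝 (inner ℂ (toH (weylS z₀ φ)) (weyl z₀ (toH φ)))) := (hG z₀).continuousAt
  rw [weylS_restricts] at h1
  have h2 : ∀ z, ‖weyl z (toH φ) - weyl z₀ (toH φ)‖
      = √(2 * ‖toH φ‖ ^ 2 - 2 * (inner ℂ (weyl z₀ (toH φ)) (weyl z (toH φ)) : ℂ).re) := by
    intro z
    rw [← Real.sqrt_sq (norm_nonneg (weyl z (toH φ) - weyl z₀ (toH φ))), norm_sub_rev,
      @norm_sub_sq ℂ, norm_weyl_apply, norm_weyl_apply]
    congr 1
    simp only [RCLike.re_to_complex]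
    ring
  simp only [h2]
  have h3 : Tendsto (fun z => √(2 * ‖toH φ‖ ^ 2
      - 2 * (inner ℂ (weyl z₀ (toH φ)) (weyl z (toH φ)) : ℂ).re)) (𝓝 z₀)
      (𝓝 √(2 * ‖toH φ‖ ^ 2 - 2 * (inner ℂ (weyl z₀ (toH φ)) (weyl z₀ (toH φ)) : ℂ).re)) :=
    (Real.continuous_sqrt.tendsto _).comp
      (((Complex.continuous_re.tendsto _).comp h1).const_mul 2 |>.const_sub _)
  have h4 : (inner ℂ (weyl z₀ (toH φ)) (weyl z₀ (toH φ)) : ℂ).re = ‖toH φ‖ ^ 2 := by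
    rw [← norm_weyl_apply z₀ (toH φ)]
    exact inner_self_eq_norm_sq (𝕜 := ℂ) _
  rwa [h4, sub_self, Real.sqrt_zero] at h3

/-- The Weyl operators are strongly continuous. -/
theorem continuous_weyl_apply (φ : Hilb n) : Continuous fun z => weyl z φ := by
  refine continuous_of_uniform_approx_of_continuous fun u hu => ?_
  obtain ⟨ε, hε, hu⟩ := Metric.mem_uniformity_dist.1 hu
  obtain ⟨φ', hφ'⟩ := denseRange_toH.exists_dist_lt φ hε
  refine ⟨_, continuous_weyl_toH φ', fun z => hu ?_⟩
  rwa [dist_eq_norm, ← map_sub, norm_weyl_apply, ← dist_eq_norm]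

/-! ### Classes and their representatives. -/

theorem rep_mem (X : HybridAlg n s) : rep X ∈ hybridFun n s :=
  (Function.surjInv (hybridNull n s).mkQ_surjective X).2

theorem cls_rep (X : HybridAlg n s) : cls ⟨rep X, rep_mem X⟩ = X :=
  Function.surjInv_eq (hybridNull n s).mkQ_surjective X

theorem cls_eq_iff (F G : hybridFun n s) : cls F = cls G ↔ ∀ᵐ x, F.1 x = G.1 x := by
  constructor
  · intro h
    filter_upwards [rep_cls F, rep_cls G] with x h1 h2
    rw [← h1, h, h2]
  · intro h
    refine (Submodule.Quotient.eq (hybridNull n s)).2 ?_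
    change ∀ᵐ x, (F - G).1 x = 0
    filter_upwards [h] with x hx
    simp [hx]

theorem rep_add (X Y : HybridAlg n s) : ∀ᵐ x, rep (X + Y) x = rep X x + rep Y x := by
  have h : X + Y = cls (⟨rep X, rep_mem X⟩ + ⟨rep Y, rep_mem Y⟩) := by
    conv_lhs => rw [← cls_rep X, ← cls_rep Y]
    exact (map_add (hybridNull n s).mkQ _ _).symm
  rw [h]
  exact rep_cls _

theorem rep_smul (c : ℂ) (X : HybridAlg n s) : ∀ᵐ x, rep (c • X) x = c • rep X x := by
  have h : c • X = cls (c • ⟨rep X, rep_mem X⟩) := by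
    conv_lhs => rw [← cls_rep X]
    exact (map_smul (hybridNull n s).mkQ _ _).symm
  rw [h]
  exact rep_cls _

/-! ### Weakly continuous versions -/

/-- `V` is a weakly continuous representative of the class `X`. -/
structure IsVersion (X : HybridAlg n s) (V : CPhase s → Op n) : Prop where
  ae_eq : ∀ᵐ x : CPhase s, rep X x = V x
  continuous : ∀ φ ψ : Hilb n, Continuous fun x => (inner ℂ ψ (V x φ) : ℂ)

/-- A closed property that holds almost everywhere holds everywhere. -/
theorem forall_of_ae {p : CPhase s → Prop} (hc : IsClosed {x | p x}) (h : ∀ᵐ x, p x) (x) : p x :=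
  (hc.closure_eq ▸ (Measure.dense_of_ae h).closure_eq ▸ mem_univ x : x ∈ {x | p x})

theorem op_ext_inner {a b : Op n} (h : ∀ φ ψ : Hilb n, (inner ℂ ψ (a φ) : ℂ) = inner ℂ ψ (b φ)) :
    a = b :=
  ContinuousLinearMap.ext fun φ => ext_inner_left ℂ fun ψ => h φ ψ

theorem op_norm_le_of_inner {a : Op n} {c : ℝ} (hc : 0 ≤ c)
    (h : ∀ φ ψ : Hilb n, ‖(inner ℂ ψ (a φ) : ℂ)‖ ≤ c * ‖φ‖ * ‖ψ‖) : ‖a‖ ≤ c := by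
  refine ContinuousLinearMap.opNorm_le_bound _ hc fun φ => ?_
  have h1 := h φ (a φ)
  rw [inner_self_eq_norm_sq_to_K] at h1
  have h2 : ‖((‖a φ‖ : ℂ) ^ 2 : ℂ)‖ = ‖a φ‖ * ‖a φ‖ := by
    simp [sq]
  rcases eq_or_lt_of_le (norm_nonneg (a φ)) with h3 | h3
  · rw [← h3]; positivity
  · refine le_of_mul_le_mul_right ?_ h3
    rw [← h2]
    exact h1

/-- Equality of matrix elements is a closed condition in `x` and holds on a dense set. Uniqueness
gives a meaning to the value of a class at a single point. -/
theorem IsVersion.unique {X : HybridAlg n s} {V V' : CPhase s → Op n} (h : IsVersion X V)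
    (h' : IsVersion X V') (x) : V x = V' x := by
  have hcl : IsClosed {x | ∀ φ ψ : Hilb n, (inner ℂ ψ (V x φ) : ℂ) = inner ℂ ψ (V' x φ)} := by
    simp only [ofPred_forall]
    exact isClosed_iInter fun φ => isClosed_iInter fun ψ =>
      isClosed_eq (h.continuous φ ψ) (h'.continuous φ ψ)
  refine op_ext_inner (forall_of_ae hcl ?_ x)
  filter_upwards [h.ae_eq, h'.ae_eq] with x h1 h2
  intro φ ψ
  rw [← h1, ← h2]

theorem IsVersion.add {X Y : HybridAlg n s} {V W : CPhase s → Op n} (hX : IsVersion X V)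
    (hY : IsVersion Y W) : IsVersion (X + Y) fun x => V x + W x where
  ae_eq := by
    filter_upwards [hX.ae_eq, hY.ae_eq, rep_add X Y] with x h1 h2 h3
    rw [h3, h1, h2]
  continuous φ ψ := by
    simp only [add_apply, inner_add_right]
    exact (hX.continuous φ ψ).add (hY.continuous φ ψ)

theorem IsVersion.smul {X : HybridAlg n s} {V : CPhase s → Op n} (hX : IsVersion X V) (c : ℂ) :
    IsVersion (c • X) fun x => c • V x where
  ae_eq := by
    filter_upwards [hX.ae_eq, rep_smul c X] with x h1 h3
    rw [h3, h1]
  continuous φ ψ := by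
    simpa only [smul_apply, inner_smul_right] using (hX.continuous φ ψ).const_mul c

theorem IsVersion.sub {X Y : HybridAlg n s} {V W : CPhase s → Op n} (hX : IsVersion X V)
    (hY : IsVersion Y W) : IsVersion (X - Y) fun x => V x - W x := by
  have h := hX.add (hY.smul (-1))
  simpa only [neg_smul, one_smul, ← sub_eq_add_neg] using h

/-- The operator norm need not be continuous along a weakly continuous function, so the bound is
transported through the matrix elements, where it is a closed condition. -/
theorem IsVersion.norm_le {X : HybridAlg n s} {V : CPhase s → Op n} (h : IsVersion X V) {c : ℝ}
    (hc : EssBound X c) (x) : ‖V x‖ ≤ c := by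
  have hcl : IsClosed {x | ∀ φ ψ : Hilb n, ‖(inner ℂ ψ (V x φ) : ℂ)‖ ≤ c * ‖φ‖ * ‖ψ‖} := by
    simp only [ofPred_forall]
    exact isClosed_iInter fun φ => isClosed_iInter fun ψ =>
      isClosed_le (h.continuous φ ψ).norm continuous_const
  have hae : ∀ᵐ x, ‖V x‖ ≤ c := by
    filter_upwards [h.ae_eq, hc] with x h1 h2
    rwa [← h1]
  obtain ⟨x₀, hx₀⟩ := hae.exists
  refine op_norm_le_of_inner ((norm_nonneg _).trans hx₀) (forall_of_ae hcl ?_ x)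
  filter_upwards [hae] with x hx φ ψ
  calc _ ≤ ‖ψ‖ * ‖V x φ‖ := norm_inner_le_norm _ _
    _ ≤ ‖ψ‖ * (c * ‖φ‖) := by gcongr; exact (V x).le_of_opNorm_le hx φ
    _ = _ := by ring

theorem EssBound.sub_comm {X Y : HybridAlg n s} {c : ℝ} (h : EssBound (X - Y) c) :
    EssBound (Y - X) c := by
  have h1 : Y - X = (-1 : ℂ) • (X - Y) := by simp
  rw [h1]
  filter_upwards [h, rep_smul (-1) (X - Y)] with x h2 h3
  rw [h3, norm_smul]
  simpa using h2

theorem EssBound.add {X Y : HybridAlg n s} {c d : ℝ} (h : EssBound X c) (h' : EssBound Y d) :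
    EssBound (X + Y) (c + d) := by
  filter_upwards [h, h', rep_add X Y] with x h1 h2 h3
  rw [h3]
  exact (norm_add_le _ _).trans (add_le_add h1 h2)

/-- A uniform limit of elements with weakly continuous versions has such a version. -/
theorem exists_version_of_approx (X : HybridAlg n s)
    (h : ∀ ε > 0, ∃ Y V, IsVersion Y V ∧ EssBound (X - Y) ε) : ∃ V, IsVersion X V := by
  have hpos : ∀ k : ℕ, (0 : ℝ) < 1 / (k + 1) := fun k => Nat.one_div_pos_of_nat
  choose Y V hV hY using fun k : ℕ => h (1 / (k + 1)) (hpos k)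
  have hdist : ∀ k l x, ‖V k x - V l x‖ ≤ 1 / ((k : ℝ) + 1) + 1 / (l + 1) := by
    intro k l x
    refine ((hV k).sub (hV l)).norm_le ?_ x
    have := (hY k).sub_comm.add (hY l)
    rwa [sub_add_sub_cancel] at this
  have htend : Tendsto (fun k : ℕ => 1 / ((k : ℝ) + 1)) atTop (𝓝 0) :=
    tendsto_one_div_add_atTop_nhds_zero_nat
  have hcau : ∀ x, CauchySeq fun k => V k x := by
    intro x
    refine Metric.cauchySeq_iff'.2 fun ε hε => ?_
    obtain ⟨N, hN⟩ := exists_nat_one_div_lt (half_pos hε)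
    refine ⟨N, fun k hk => ?_⟩
    rw [dist_eq_norm]
    have h1 := hdist k N x
    have h2 : 1 / ((k : ℝ) + 1) ≤ 1 / ((N : ℝ) + 1) := Nat.one_div_le_one_div hk
    linarith
  choose U hU using fun x => cauchySeq_tendsto_of_complete (hcau x)
  have hUV : ∀ k x, ‖U x - V k x‖ ≤ 1 / ((k : ℝ) + 1) := by
    intro k x
    have h1 : Tendsto (fun l : ℕ => 1 / ((k : ℝ) + 1) + 1 / ((l : ℝ) + 1)) atTop
        (𝓝 (1 / ((k : ℝ) + 1) + 0)) := htend.const_add _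
    rw [add_zero] at h1
    refine le_of_tendsto_of_tendsto ((hU x).sub_const (V k x)).norm h1
      (Eventually.of_forall fun l => ?_)
    have := hdist l k x
    simp only
    linarith
  refine ⟨U, ?_, fun φ ψ => ?_⟩
  · have h1 : ∀ᵐ x, ∀ k, ‖rep X x - V k x‖ ≤ 1 / ((k : ℝ) + 1) := by
      refine ae_all_iff.2 fun k => ?_
      filter_upwards [hY k, (hV k).ae_eq, rep_add (X - Y k) (Y k)] with x h1 h2 h3
      rw [sub_add_cancel] at h3
      rw [h3, h2, add_sub_cancel_right]
      exact h1
    filter_upwards [h1] with x hx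
    refine sub_eq_zero.1 (norm_le_zero_iff.1 ?_)
    have h2 : Tendsto (fun k : ℕ => 1 / ((k : ℝ) + 1) + 1 / ((k : ℝ) + 1)) atTop (𝓝 0) := by
      simpa using htend.add htend
    refine ge_of_tendsto h2 (Eventually.of_forall fun k => ?_)
    calc ‖rep X x - U x‖ = ‖(rep X x - V k x) - (U x - V k x)‖ := by congr 1; abel
      _ ≤ _ := (norm_sub_le _ _).trans (add_le_add (hx k) (hUV k x))
  · refine continuous_of_uniform_approx_of_continuous fun u hu => ?_
    obtain ⟨ε, hε, hu⟩ := Metric.mem_uniformity_dist.1 hu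
    have h3 : Tendsto (fun k : ℕ => ‖ψ‖ * (1 / ((k : ℝ) + 1) * ‖φ‖)) atTop (𝓝 0) := by
      simpa using (htend.mul_const ‖φ‖).const_mul ‖ψ‖
    obtain ⟨k, hk⟩ := (h3.eventually_lt_const hε).exists
    refine ⟨_, (hV k).continuous φ ψ, fun x => hu (lt_of_le_of_lt ?_ hk)⟩
    rw [dist_eq_norm, ← inner_sub_right, ← sub_apply]
    refine (norm_inner_le_norm _ _).trans ?_
    gcongr
    exact (U x - V k x).le_of_opNorm_le (hUV k x) φ

/-! ### Products of an operator and a bounded function -/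

/-- The function `x ↦ f(x) a` for a measurable bounded `f`. -/
def mulFun (a : Op n) (f : CPhase s → ℂ) (hf : AEStronglyMeasurable f volume)
    (hb : ∃ C : ℝ, ∀ x, ‖f x‖ ≤ C) : hybridFun n s :=
  ⟨fun x => f x • a, by
    obtain ⟨C, hC⟩ := hb
    refine ⟨fun φ ψ => ?_, C * ‖a‖, Eventually.of_forall fun x => ?_⟩
    · simp only [smul_apply, inner_smul_right]
      exact hf.mul_const _
    · rw [norm_smul]
      exact mul_le_mul_of_nonneg_right (hC x) (norm_nonneg _)⟩

theorem rep_tensor (a : Op n) (f : CPhase s → ℂ) (hf : Continuous f)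
    (hb : ∃ C : ℝ, ∀ x, ‖f x‖ ≤ C) : ∀ᵐ x, rep (tensor a f hf hb) x = f x • a :=
  rep_cls _

theorem isVersion_tensor (a : Op n) (f : CPhase s → ℂ) (hf : Continuous f)
    (hb : ∃ C : ℝ, ∀ x, ‖f x‖ ≤ C) : IsVersion (tensor a f hf hb) fun x => f x • a where
  ae_eq := rep_tensor a f hf hb
  continuous φ ψ := by
    simp only [smul_apply, inner_smul_right]
    exact hf.mul continuous_const

theorem IsVersion.ext {X Y : HybridAlg n s} {V W : CPhase s → Op n} (hX : IsVersion X V)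
    (hY : IsVersion Y W) (h : ∀ x, V x = W x) : X = Y := by
  rw [← cls_rep X, ← cls_rep Y]
  refine (cls_eq_iff _ _).2 ?_
  filter_upwards [hX.ae_eq, hY.ae_eq] with x h1 h2
  rw [h1, h2, h x]

theorem IsVersion.essBound {X : HybridAlg n s} {V : CPhase s → Op n} (h : IsVersion X V) {c : ℝ}
    (hc : ∀ x, ‖V x‖ ≤ c) : EssBound X c := by
  filter_upwards [h.ae_eq] with x hx
  rw [hx]
  exact hc x

theorem tensor_add_left (a b : Op n) (f : CPhase s → ℂ) (hf hb) :
    tensor (a + b) f hf hb = tensor a f hf hb + tensor b f hf hb :=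
  (isVersion_tensor _ f hf hb).ext ((isVersion_tensor a f hf hb).add (isVersion_tensor b f hf hb))
    fun _ => smul_add _ _ _

theorem tensor_smul_left (c : ℂ) (a : Op n) (f : CPhase s → ℂ) (hf hb) :
    tensor (c • a) f hf hb = c • tensor a f hf hb :=
  (isVersion_tensor _ f hf hb).ext ((isVersion_tensor a f hf hb).smul c) fun _ => smul_comm _ _ _

/-! ### Consequences of complete positivity -/

theorem aestronglyMeasurable_inner_rep (X : HybridAlg n s) (φ ψ : Hilb n) :
    AEStronglyMeasurable (fun x => (inner ℂ ψ (rep X x φ) : ℂ)) volume :=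
  (rep_mem X).1 φ ψ

theorem exists_inner_rep_bound (X : HybridAlg n s) (φ ψ : Hilb n) :
    ∃ C : ℝ, ∀ᵐ x, ‖(inner ℂ ψ (rep X x φ) : ℂ)‖ ≤ C := by
  obtain ⟨C, hC⟩ := (rep_mem X).2
  refine ⟨‖ψ‖ * (C * ‖φ‖), ?_⟩
  filter_upwards [hC] with x hx
  refine (norm_inner_le_norm _ _).trans ?_
  gcongr
  exact (rep X x).le_of_opNorm_le hx φ

theorem integrableOn_inner_rep (X : HybridAlg n s) (φ ψ : Hilb n) {B : Set (CPhase s)}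
    (hB : volume B < ∞) : IntegrableOn (fun x => (inner ℂ ψ (rep X x φ) : ℂ)) B := by
  obtain ⟨C, hC⟩ := exists_inner_rep_bound X φ ψ
  exact Measure.integrableOn_of_bounded hB.ne (aestronglyMeasurable_inner_rep X φ ψ)
    (ae_restrict_of_ae hC)

/-- Indicator vectors reduce the positivity and normality axioms, stated with `L²` vectors, to
integrals of matrix elements over sets of finite measure. -/
theorem form_indicator (X : HybridAlg n s) (φ ψ : Hilb n) {B : Set (CPhase s)}
    (hB : MeasurableSet B) (hμ : volume B ≠ ∞) :
    form X (indicatorConstLp 2 hB hμ ψ) (indicatorConstLp 2 hB hμ φ)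
      = ∫ x in B, inner ℂ ψ (rep X x φ) := by
  rw [form, ← integral_indicator hB]
  refine integral_congr_ae ?_
  filter_upwards [indicatorConstLp_coeFn (p := 2) (hs := hB) (hμs := hμ) (c := ψ),
    indicatorConstLp_coeFn (p := 2) (hs := hB) (hμs := hμ) (c := φ)] with x h1 h2
  rw [h1, h2]
  by_cases hx : x ∈ B <;> simp [hx]

theorem cls_starMul_mulFun (a b c : Op n) (u v w : CPhase s → ℂ) (hu hub hv hvb hw hwb)
    (hc : ContinuousLinearMap.adjoint a ∘L b = c) (h : ∀ x, starRingEnd ℂ (u x) * v x = w x) :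
    cls (starMul (mulFun a u hu hub) (mulFun b v hv hvb)) = cls (mulFun c w hw hwb) := by
  refine (cls_eq_iff _ _).2 (Eventually.of_forall fun x => ?_)
  change ContinuousLinearMap.adjoint (u x • a) ∘L (v x • b) = w x • c
  rw [← h, ← hc, map_smulₛₗ, ContinuousLinearMap.smul_comp, ContinuousLinearMap.comp_smul, smul_smul]

theorem adjoint_one_comp (a : Op n) : ContinuousLinearMap.adjoint (1 : Op n) ∘L a = a := by
  rw [ContinuousLinearMap.adjoint_one]
  rfl

/-- Ordinary positivity is complete positivity for one element, applied to `1 ⊗ √q`. -/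
theorem integral_inner_nonneg {T : ℝ → (HybridAlg n s →ₗ[ℂ] HybridAlg n s)}
    (hT : IsHybridSemigroup T) {t : ℝ} (ht : 0 ≤ t) (q : CPhase s → ℝ)
    (hq : Measurable q) (hq0 : ∀ x, 0 ≤ q x) (hb : ∃ C : ℝ, ∀ x, ‖(q x : ℂ)‖ ≤ C)
    (φ : Hilb n) {B : Set (CPhase s)} (hB : MeasurableSet B) (hμ : volume B ≠ ∞) :
    0 ≤ (∫ x in B, (inner ℂ φ (rep (T t (cls (mulFun 1 (fun x => (q x : ℂ))
      (by fun_prop) hb))) x φ) : ℂ)).re := by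
  have hb' : ∃ C : ℝ, ∀ x, ‖((√(q x) : ℝ) : ℂ)‖ ≤ C := by
    obtain ⟨C, hC⟩ := hb
    refine ⟨√C, fun x => ?_⟩
    have := hC x
    rw [Complex.norm_real, Real.norm_eq_abs] at this ⊢
    rw [abs_of_nonneg (Real.sqrt_nonneg _)]
    exact Real.sqrt_le_sqrt ((le_abs_self _).trans this)
  let F : hybridFun n s := mulFun 1 (fun x => ((√(q x) : ℝ) : ℂ)) (by fun_prop) hb'
  have h := hT.completelyPositive t ht 1 (fun _ => F) (fun _ => indicatorConstLp 2 hB hμ φ)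
  simp only [Finset.univ_unique, Finset.sum_singleton] at h
  have he : cls (starMul F F) = cls (mulFun 1 (fun x => (q x : ℂ)) (by fun_prop) hb) :=
    cls_starMul_mulFun _ _ _ _ _ _ _ _ _ _ _ _ (adjoint_one_comp 1) fun x => by
      rw [conj_ofReal, ← ofReal_mul, Real.mul_self_sqrt (hq0 x)]
  rw [he, form_indicator] at h
  exact (Complex.le_def.1 h).1

/-- Nonnegative complex numbers are real, so testing at `1`, `-1` and `I` forces `J'` to be the
conjugate of `J`. The inequality is then the real part of the hypothesis at minus the conjugate of
`c`. -/
theorem two_mul_re_le_of_nonneg {S J J' : ℂ}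
    (h : ∀ c : ℂ, ‖c‖ = 1 → 0 ≤ S + (starRingEnd ℂ c) * J + c * J') (c : ℂ) (hc : ‖c‖ = 1) :
    2 * (c * J).re ≤ S.re := by
  have h1 := (Complex.le_def.1 (h 1 (by simp))).2
  have h2 := (Complex.le_def.1 (h (-1) (by simp))).2
  have h3 := (Complex.le_def.1 (h I (by simp))).2
  have h4 := (Complex.le_def.1 (h (-starRingEnd ℂ c) (by simpa using hc))).1
  simp [Complex.add_re, Complex.add_im, Complex.mul_re, Complex.mul_im] at h1 h2 h3 h4 ⊢
  have e1 : J'.im = -J.im := by linarith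
  have e2 : J'.re = J.re := by linarith
  rw [e1, e2] at h4
  linarith

theorem measurable_div_sqrt_norm {r : CPhase s → ℂ} (hr : Measurable r) :
    Measurable fun x => r x / ((√‖r x‖ : ℝ) : ℂ) := by
  fun_prop

theorem form_pair_nonneg {T : ℝ → (HybridAlg n s →ₗ[ℂ] HybridAlg n s)}
    (hT : IsHybridSemigroup T) {t : ℝ} (ht : 0 ≤ t) {F₀ F₁ : hybridFun n s}
    {Y X X' : HybridAlg n s} (h00 : Y = cls (starMul F₀ F₀)) (h11 : Y = cls (starMul F₁ F₁))
    (h10 : X = cls (starMul F₁ F₀)) (h01 : X' = cls (starMul F₀ F₁))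
    (g₀ g₁ : Lp (Hilb n) 2 (volume : Measure (CPhase s))) :
    0 ≤ form (T t Y) g₀ g₀ + form (T t X) g₁ g₀ + (form (T t X') g₀ g₁ + form (T t Y) g₁ g₁) := by
  have h := hT.completelyPositive t ht 2 ![F₀, F₁] ![g₀, g₁]
  rw [Fin.sum_univ_two, Fin.sum_univ_two, Fin.sum_univ_two] at h
  have e00 := congrArg (fun Y => form (T t Y) g₀ g₀) h00
  have e11 := congrArg (fun Y => form (T t Y) g₁ g₁) h11
  have e10 := congrArg (fun Y => form (T t Y) g₁ g₀) h10
  have e01 := congrArg (fun Y => form (T t Y) g₀ g₁) h01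
  exact h.trans_eq (congrArg₂ (· + ·) (congrArg₂ (· + ·) e00.symm e10.symm)
    (congrArg₂ (· + ·) e01.symm e11.symm))

theorem integral_inner_smul_left (X : HybridAlg n s) (φ ψ : Hilb n) (c : ℂ) (B : Set (CPhase s)) :
    ∫ x in B, (inner ℂ (c • ψ) (rep X x φ) : ℂ)
      = starRingEnd ℂ c * ∫ x in B, (inner ℂ ψ (rep X x φ) : ℂ) := by
  rw [← integral_const_mul]
  exact integral_congr_ae (Eventually.of_forall fun x => inner_smul_left _ _ _)

theorem integral_inner_smul_right (X : HybridAlg n s) (φ ψ : Hilb n) (c : ℂ) (B : Set (CPhase s)) :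
    ∫ x in B, (inner ℂ ψ (rep X x (c • φ)) : ℂ) = c * ∫ x in B, (inner ℂ ψ (rep X x φ) : ℂ) := by
  rw [← integral_const_mul]
  refine integral_congr_ae (Eventually.of_forall fun x => ?_)
  simp only [map_smul, inner_smul_right]

-- Complete positivity for two elements, with both diagonal products equal to `Y`. A unimodular
-- factor placed in the second vector makes the resulting inequality available for every phase,
-- which is what isolates the off-diagonal term.
set_option maxHeartbeats 1000000 in
theorem two_mul_re_integral_le_of_starMul {T : ℝ → (HybridAlg n s →ₗ[ℂ] HybridAlg n s)}
    (hT : IsHybridSemigroup T) {t : ℝ} (ht : 0 ≤ t) {F₀ F₁ : hybridFun n s} {X X' Y : HybridAlg n s}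
    (h00 : Y = cls (starMul F₀ F₀)) (h11 : Y = cls (starMul F₁ F₁))
    (h10 : X = cls (starMul F₁ F₀)) (h01 : X' = cls (starMul F₀ F₁))
    (φ ψ : Hilb n) {B : Set (CPhase s)} (hB : MeasurableSet B)
    (hμ : volume B ≠ ∞) (c : ℂ) (hc : ‖c‖ = 1) :
    2 * (c * ∫ x in B, (inner ℂ ψ (rep (T t X) x φ) : ℂ)).re ≤
      (∫ x in B, (inner ℂ φ (rep (T t Y) x φ) : ℂ)).re +
      (∫ x in B, (inner ℂ ψ (rep (T t Y) x ψ) : ℂ)).re := by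
  rw [← Complex.add_re]
  refine two_mul_re_le_of_nonneg
    (J' := ∫ x in B, (inner ℂ φ (rep (T t X') x ψ) : ℂ)) (fun c hc => ?_) c hc
  have h := form_pair_nonneg hT ht h00 h11 h10 h01 (indicatorConstLp 2 hB hμ φ)
    (indicatorConstLp 2 hB hμ (c • ψ))
  rw [form_indicator, form_indicator, form_indicator, form_indicator,
    integral_inner_smul_left, integral_inner_smul_right, integral_inner_smul_left,
    integral_inner_smul_right] at h
  have key : ∀ a J J' b : ℂ, a + starRingEnd ℂ c * J + (c * J' + starRingEnd ℂ c * (c * b))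
      = a + b + starRingEnd ℂ c * J + c * J' := by
    intro a J J' b
    rw [← mul_assoc (starRingEnd ℂ c) c, Complex.conj_mul', hc]
    push_cast
    ring
  exact h.trans_eq (key _ _ _ _)

/-- Factor `r = √|r| · (r / √|r|)` and take `F₁ = 1 ⊗ √|r|`, `F₀ = W ⊗ r / √|r|`. As `W` is an
isometry, both diagonal products are `1 ⊗ |r|`, while `F₁* F₀ = W ⊗ r`. -/
theorem two_mul_re_integral_le {T : ℝ → (HybridAlg n s →ₗ[ℂ] HybridAlg n s)}
    (hT : IsHybridSemigroup T) {t : ℝ} (ht : 0 ≤ t) {W : Op n}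
    (hW : ContinuousLinearMap.adjoint W ∘L W = 1) (r : CPhase s → ℂ) (hr : Measurable r)
    (hb : ∃ C : ℝ, ∀ x, ‖r x‖ ≤ C) (hb' : ∃ C : ℝ, ∀ x, ‖((‖r x‖ : ℝ) : ℂ)‖ ≤ C)
    {X Y : HybridAlg n s} (hX : X = cls (mulFun W r hr.aestronglyMeasurable hb))
    (hY : Y = cls (mulFun 1 (fun x => ((‖r x‖ : ℝ) : ℂ)) (by fun_prop) hb'))
    (φ ψ : Hilb n) {B : Set (CPhase s)} (hB : MeasurableSet B)
    (hμ : volume B ≠ ∞) (c : ℂ) (hc : ‖c‖ = 1) :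
    2 * (c * ∫ x in B, (inner ℂ ψ (rep (T t X) x φ) : ℂ)).re ≤
      (∫ x in B, (inner ℂ φ (rep (T t Y) x φ) : ℂ)).re +
      (∫ x in B, (inner ℂ ψ (rep (T t Y) x ψ) : ℂ)).re := by
  -- At the zeros of `r` the quotient is `0` by the convention for division by zero, so all the
  -- factorisation identities hold there as well.
  have hmul : ∀ x, r x / ((√‖r x‖ : ℝ) : ℂ) * ((√‖r x‖ : ℝ) : ℂ) = r x := by
    intro x
    by_cases h0 : r x = 0
    · simp [h0]
    · refine div_mul_cancel₀ _ ?_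
      rw [ofReal_ne_zero, Real.sqrt_ne_zero']
      exact norm_pos_iff.2 h0
  have hnorm : ∀ x, ‖r x / ((√‖r x‖ : ℝ) : ℂ)‖ = √‖r x‖ := by
    intro x
    rw [norm_div, Complex.norm_real, Real.norm_eq_abs, abs_of_nonneg (Real.sqrt_nonneg _),
      Real.div_sqrt]
  have hsq : ∀ x, starRingEnd ℂ (r x / ((√‖r x‖ : ℝ) : ℂ)) * (r x / ((√‖r x‖ : ℝ) : ℂ))
      = ((‖r x‖ : ℝ) : ℂ) := by
    intro x
    rw [Complex.conj_mul', hnorm, ← ofReal_pow, Real.sq_sqrt (norm_nonneg _)]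
  obtain ⟨C, hC⟩ := hb
  have hu : ∃ C : ℝ, ∀ x, ‖r x / ((√‖r x‖ : ℝ) : ℂ)‖ ≤ C :=
    ⟨√C, fun x => by rw [hnorm]; exact Real.sqrt_le_sqrt (hC x)⟩
  have hv : ∃ C : ℝ, ∀ x, ‖((√‖r x‖ : ℝ) : ℂ)‖ ≤ C :=
    ⟨√C, fun x => by
      rw [Complex.norm_real, Real.norm_eq_abs, abs_of_nonneg (Real.sqrt_nonneg _)]
      exact Real.sqrt_le_sqrt (hC x)⟩
  let F₀ : hybridFun n s := mulFun W (fun x => r x / ((√‖r x‖ : ℝ) : ℂ))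
    (measurable_div_sqrt_norm hr).aestronglyMeasurable hu
  let F₁ : hybridFun n s := mulFun 1 (fun x => ((√‖r x‖ : ℝ) : ℂ)) (by fun_prop) hv
  have h00 : cls (starMul F₀ F₀) = Y := by
    rw [hY]
    exact cls_starMul_mulFun _ _ _ _ _ _ _ _ _ _ _ _ hW hsq
  have h11 : cls (starMul F₁ F₁) = Y := by
    rw [hY]
    refine cls_starMul_mulFun _ _ _ _ _ _ _ _ _ _ _ _ (adjoint_one_comp 1) fun x => ?_
    rw [conj_ofReal, ← ofReal_mul, Real.mul_self_sqrt (norm_nonneg _)]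
  have h10 : cls (starMul F₁ F₀) = X := by
    rw [hX]
    refine cls_starMul_mulFun _ _ _ _ _ _ _ _ _ _ _ _ (adjoint_one_comp W) fun x => ?_
    rw [conj_ofReal, mul_comm, hmul]
  exact two_mul_re_integral_le_of_starMul hT ht h00.symm h11.symm h10.symm rfl φ ψ hB hμ c hc

set_option maxHeartbeats 1000000 in
/-- Domination of the off-diagonal matrix elements by a weight function. -/
theorem version_inner_le {T : ℝ → (HybridAlg n s →ₗ[ℂ] HybridAlg n s)}
    (hT : IsHybridSemigroup T) {t : ℝ} (ht : 0 ≤ t) {W : Op n}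
    (hW : ContinuousLinearMap.adjoint W ∘L W = 1) (r : CPhase s → ℂ) (hr : Continuous r)
    (hb : ∃ C : ℝ, ∀ x, ‖r x‖ ≤ C) (w : CPhase s → ℝ) (hw : Continuous fun x => (w x : ℂ))
    (hwb : ∃ C : ℝ, ∀ x, ‖(w x : ℂ)‖ ≤ C) {M : ℝ} (hM : ∀ x, ‖r x‖ ≤ M * w x)
    {V Vw : CPhase s → Op n} (hV : IsVersion (T t (tensor W r hr hb)) V)
    (hVw : IsVersion (T t (tensor 1 (fun x => (w x : ℂ)) hw hwb)) Vw) (x : CPhase s) (φ ψ : Hilb n) :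
    2 * ‖(inner ℂ ψ (V x φ) : ℂ)‖ ≤
      M * ((inner ℂ φ (Vw x φ) : ℂ).re + (inner ℂ ψ (Vw x ψ) : ℂ).re) := by
  have hwm : Measurable w := by
    have h := Complex.measurable_re.comp hw.measurable
    exact h
  have hb' : ∃ C : ℝ, ∀ x, ‖((‖r x‖ : ℝ) : ℂ)‖ ≤ C := by
    obtain ⟨C, hC⟩ := hb
    exact ⟨C, fun x => by simpa using hC x⟩
  have hbq : ∃ C : ℝ, ∀ x, ‖((M * w x - ‖r x‖ : ℝ) : ℂ)‖ ≤ C := by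
    obtain ⟨C, hC⟩ := hb
    obtain ⟨D, hD⟩ := hwb
    refine ⟨|M| * D + C, fun x => ?_⟩
    push_cast
    refine (norm_sub_le _ _).trans (add_le_add ?_ (by simpa using hC x))
    rw [norm_mul, Complex.norm_real, Real.norm_eq_abs]
    exact mul_le_mul_of_nonneg_left (hD x) (abs_nonneg _)
  obtain ⟨X, hX⟩ : ∃ X, X = tensor W r hr hb := ⟨_, rfl⟩
  rw [← hX] at hV
  obtain ⟨Xw, hXw⟩ : ∃ Xw, Xw = tensor (1 : Op n) (fun x => (w x : ℂ)) hw hwb := ⟨_, rfl⟩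
  rw [← hXw] at hVw
  obtain ⟨Y, hY⟩ : ∃ Y, Y = cls (mulFun (1 : Op n) (fun x => ((‖r x‖ : ℝ) : ℂ)) (by fun_prop) hb') :=
    ⟨_, rfl⟩
  obtain ⟨Q, hQ⟩ : ∃ Q, Q = cls (mulFun (1 : Op n) (fun x => ((M * w x - ‖r x‖ : ℝ) : ℂ))
      (by fun_prop) hbq) := ⟨_, rfl⟩
  -- The weight splits as `M w = |r| + (M w - |r|)` with a nonnegative second summand, to which
  -- positivity applies.
  have hQY : (M : ℂ) • Xw = Y + Q := by
    rw [hY, hQ, hXw]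
    refine (map_smul (hybridNull n s).mkQ _ _).symm.trans
      (Eq.trans ?_ (map_add (hybridNull n s).mkQ _ _))
    refine (cls_eq_iff _ _).2 (Eventually.of_forall fun x => ?_)
    change (M : ℂ) • (w x : ℂ) • (1 : Op n)
      = ((‖r x‖ : ℝ) : ℂ) • (1 : Op n) + ((M * w x - ‖r x‖ : ℝ) : ℂ) • (1 : Op n)
    rw [← add_smul, smul_smul]
    congr 1
    push_cast
    ring
  -- The class `Y` of `1 ⊗ |r|` comes without a weakly continuous version of `T_t Y`, so `|r|` is
  -- compared with `w` under integrals over sets; only the outer terms of the inequality are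
  -- evaluated at points later.
  have hdiag : ∀ (χ : Hilb n) {B : Set (CPhase s)} (_ : MeasurableSet B) (_ : volume B < ∞),
      (∫ x in B, (inner ℂ χ (rep (T t Y) x χ) : ℂ)).re
        ≤ ∫ x in B, M * (inner ℂ χ (rep (T t Xw) x χ) : ℂ).re := by
    intro χ B hB hμ
    have h1 := integral_inner_nonneg hT ht (fun x => M * w x - ‖r x‖) (by fun_prop)
      (fun x => sub_nonneg.2 (hM x)) hbq χ hB hμ.ne
    rw [← hQ] at h1
    have h2 : ∫ x in B, (M : ℂ) * inner ℂ χ (rep (T t Xw) x χ)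
        = (∫ x in B, (inner ℂ χ (rep (T t Y) x χ) : ℂ)) + ∫ x in B, inner ℂ χ (rep (T t Q) x χ) := by
      rw [← integral_add (integrableOn_inner_rep _ _ _ hμ) (integrableOn_inner_rep _ _ _ hμ)]
      refine integral_congr_ae (ae_restrict_of_ae ?_)
      have h3 : (M : ℂ) • T t Xw = T t Y + T t Q := by
        rw [← (T t).map_smul, hQY, (T t).map_add]
      have h4 := rep_smul (M : ℂ) (T t Xw)
      rw [h3] at h4
      filter_upwards [h4, rep_add (T t Y) (T t Q)] with x h5 h6
      rw [← inner_smul_right, ← smul_apply, ← h5, h6, add_apply, inner_add_right]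
    have h3 : ∫ x in B, M * (inner ℂ χ (rep (T t Xw) x χ) : ℂ).re
        = (∫ x in B, (M : ℂ) * inner ℂ χ (rep (T t Xw) x χ)).re := by
      have := integral_re ((integrableOn_inner_rep (T t Xw) χ χ hμ).const_mul (M : ℂ))
      simp only [RCLike.re_to_complex, Complex.re_ofReal_mul] at this
      exact this
    rw [h3, h2, Complex.add_re]
    linarith
  have key : ∀ c : ℂ, ‖c‖ = 1 → ∀ x, 0 ≤ M * (inner ℂ φ (Vw x φ) : ℂ).re
      + M * (inner ℂ ψ (Vw x ψ) : ℂ).re - 2 * (c * (inner ℂ ψ (V x φ) : ℂ)).re := by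
    intro c hc
    refine forall_of_ae ?_ ?_
    · refine isClosed_le continuous_const ?_
      have h1 := Complex.continuous_re.comp (hVw.continuous φ φ)
      have h2 := Complex.continuous_re.comp (hVw.continuous ψ ψ)
      have h3 := Complex.continuous_re.comp ((hV.continuous φ ψ).const_mul c)
      exact ((h1.const_mul M).add (h2.const_mul M)).sub (h3.const_mul 2)
    · have hint : ∀ B : Set (CPhase s), MeasurableSet B → volume B < ∞ →
          IntegrableOn (fun x => M * (inner ℂ φ (rep (T t Xw) x φ) : ℂ).re) B ∧
          IntegrableOn (fun x => M * (inner ℂ ψ (rep (T t Xw) x ψ) : ℂ).re) B ∧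
          IntegrableOn (fun x => 2 * (c * (inner ℂ ψ (rep (T t X) x φ) : ℂ)).re) B :=
        fun B _ hμ => ⟨(integrableOn_inner_rep _ _ _ hμ).re.const_mul M,
          (integrableOn_inner_rep _ _ _ hμ).re.const_mul M,
          ((integrableOn_inner_rep _ _ _ hμ).const_mul c).re.const_mul 2⟩
      have hae := ae_nonneg_of_forall_setIntegral_nonneg_of_sigmaFinite
        (f := fun x => M * (inner ℂ φ (rep (T t Xw) x φ) : ℂ).re
          + M * (inner ℂ ψ (rep (T t Xw) x ψ) : ℂ).re
          - 2 * (c * (inner ℂ ψ (rep (T t X) x φ) : ℂ)).re) (μ := volume)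
        (fun B hB hμ => ((hint B hB hμ).1.add (hint B hB hμ).2.1).sub (hint B hB hμ).2.2) ?_
      · filter_upwards [hae, hV.ae_eq, hVw.ae_eq] with x h1 h2 h3
        rw [← h2, ← h3]
        exact h1
      · intro B hB hμ
        obtain ⟨i1, i2, i3⟩ := hint B hB hμ
        have i12 : IntegrableOn (fun x => M * (inner ℂ φ (rep (T t Xw) x φ) : ℂ).re
          + M * (inner ℂ ψ (rep (T t Xw) x ψ) : ℂ).re) B := i1.add i2
        rw [integral_sub i12 i3, integral_add i1 i2, integral_const_mul 2]
        have h1 := two_mul_re_integral_le hT ht hW r hr.measurable hb hb' hX hY φ ψ hB hμ.ne c hc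
        have h2 : ∫ x in B, (c * (inner ℂ ψ (rep (T t X) x φ) : ℂ)).re
            = (c * ∫ x in B, (inner ℂ ψ (rep (T t X) x φ) : ℂ)).re := by
          rw [← integral_const_mul]
          exact integral_re ((integrableOn_inner_rep (T t X) φ ψ hμ).const_mul c)
        rw [h2]
        have h3 := hdiag φ hB hμ
        have h4 := hdiag ψ hB hμ
        linarith [h1]
  -- The phase that rotates the matrix element onto its modulus.
  obtain ⟨c, hc, hc'⟩ : ∃ c : ℂ, ‖c‖ = 1 ∧ c * inner ℂ ψ (V x φ) = ‖(inner ℂ ψ (V x φ) : ℂ)‖ := by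
    obtain ⟨c, hc, h⟩ := RCLike.exists_norm_mul_eq_self (inner ℂ ψ (V x φ) : ℂ)
    have hc0 : c ≠ 0 := by rw [← norm_ne_zero_iff, hc]; exact one_ne_zero
    refine ⟨c⁻¹, by rw [norm_inv, hc, inv_one], ?_⟩
    rw [inv_mul_eq_iff_eq_mul₀ hc0]
    exact h.symm
  have h := key c hc x
  rw [hc', ofReal_re] at h
  linarith

/-! ### Fourier representation of the semigroup -/

/-- The phase space point `(ζ, 2πk)`. -/
def freq (ζ : QPhase n) (k : CPhase s) : Phase n s :=
  WithLp.toLp 2 (Sum.elim ζ fun j => 2 * Real.pi * k j)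

@[simp] theorem freq_inl (ζ : QPhase n) (k : CPhase s) (i) : freq ζ k (Sum.inl i) = ζ i := rfl

@[simp] theorem freq_inr (ζ : QPhase n) (k : CPhase s) (j) :
    freq ζ k (Sum.inr j) = 2 * Real.pi * k j := rfl

@[simp] theorem qPart_freq (ζ : QPhase n) (k : CPhase s) : qPart (freq ζ k) = ζ := rfl

theorem qPart_apply (ξ : Phase n s) (i) : qPart ξ i = ξ (Sum.inl i) := rfl

theorem cPart_apply (ξ : Phase n s) (j) : cPart ξ j = ξ (Sum.inr j) := rfl

theorem continuous_freq (ζ : QPhase n) : Continuous (freq (s := s) ζ) := by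
  refine (PiLp.continuous_toLp 2 _).comp (continuous_pi fun i => ?_)
  rcases i with i | j
  · exact continuous_const
  · exact continuous_const.mul (by fun_prop)

theorem continuous_qPart : Continuous (qPart (n := n) (s := s)) :=
  (PiLp.continuous_toLp 2 _).comp (by fun_prop)

theorem continuous_cPart : Continuous (cPart (n := n) (s := s)) :=
  (PiLp.continuous_toLp 2 _).comp (by fun_prop)

/-- The character `x ↦ exp (i k · x)` of the classical space. -/
def char (k x : CPhase s) : ℂ := cexp (((∑ j, k j * x j : ℝ) : ℂ) * I)

theorem norm_char (k x : CPhase s) : ‖char k x‖ = 1 := Complex.norm_exp_ofReal_mul_I _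

theorem continuous_char : Continuous fun p : CPhase s × CPhase s => char p.1 p.2 := by
  unfold char
  fun_prop

/-- Fourier inversion. The factor `2π` inside `freq` absorbs the normalisation of the Fourier
transform, so the exponentials are exactly the characters occurring in the hybrid Weyl operators;
`ζ` plays no role in the classical component. -/
theorem schwartz_eq_integral (g : 𝓢(CPhase s, ℂ)) (ζ : QPhase n) (y : CPhase s) :
    g y = ∫ k, 𝓕 g k * char (cPart (freq ζ k)) y := by
  have h : g y = 𝓕⁻ (𝓕 g) y := by rw [FourierTransform.fourierInv_fourier_eq]
  rw [h, SchwartzMap.fourierInv_coe, Real.fourierInv_eq']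
  refine integral_congr_ae (Eventually.of_forall fun k => ?_)
  simp only [smul_eq_mul]
  rw [mul_comm]
  congr 2
  rw [PiLp.inner_apply]
  simp only [cPart_apply, freq_inr, RCLike.inner_apply, conj_trivial]
  push_cast
  rw [Finset.mul_sum]
  congr 1
  exact Finset.sum_congr rfl fun j _ => by ring

theorem integrable_inner_Lp (W : Op n) (g h : Lp (Hilb n) 2 (volume : Measure (CPhase s))) :
    Integrable fun x => (inner ℂ (g x) (W (h x)) : ℂ) := by
  refine (L2.integrable_inner (𝕜 := ℂ) g (W.compLp h)).congr ?_
  filter_upwards [W.coeFn_compLp h] with x hx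
  rw [hx]

/-- The bound is a sum of squares rather than a product of norms, since the sums of `‖g k‖²` and `‖h
k‖²` are exactly what converges for an element of the predual. -/
theorem integral_norm_inner_le {W : Op n} (hW : ‖W‖ ≤ 1)
    (g h : Lp (Hilb n) 2 (volume : Measure (CPhase s))) :
    ∫ x, ‖(inner ℂ (g x) (W (h x)) : ℂ)‖ ≤ 1 / 2 * (‖g‖ ^ 2 + ‖h‖ ^ 2) := by
  have hsq : ∀ f : Lp (Hilb n) 2 (volume : Measure (CPhase s)),
      Integrable (fun x => ‖f x‖ ^ 2) ∧ ∫ x, ‖f x‖ ^ 2 = ‖f‖ ^ 2 := by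
    intro f
    refine ⟨(Lp.memLp f).integrable_norm_pow (by norm_num), ?_⟩
    have h1 := inner_self_eq_norm_sq_to_K (𝕜 := ℂ) f
    rw [L2.inner_def] at h1
    have h2 : ∫ x, (inner ℂ (f x) (f x) : ℂ) = ((∫ x, ‖f x‖ ^ 2 : ℝ) : ℂ) := by
      have h3 : ((∫ x, ‖f x‖ ^ 2 : ℝ) : ℂ) = ∫ x, ((‖f x‖ ^ 2 : ℝ) : ℂ) := integral_ofReal.symm
      rw [h3]
      refine integral_congr_ae (Eventually.of_forall fun x => ?_)
      simp only
      rw [inner_self_eq_norm_sq_to_K]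
      push_cast
      rfl
    rw [h2] at h1
    exact Complex.ofReal_injective (h1.trans (by push_cast; rfl))
  rw [← (hsq g).2, ← (hsq h).2, ← integral_add (hsq g).1 (hsq h).1, ← integral_const_mul]
  refine integral_mono (integrable_inner_Lp W g h).norm (((hsq g).1.add (hsq h).1).const_mul _)
    fun x => ?_
  have h1 : ‖(inner ℂ (g x) (W (h x)) : ℂ)‖ ≤ ‖g x‖ * ‖h x‖ := by
    refine (norm_inner_le_norm _ _).trans ?_
    gcongr
    exact (W.le_of_opNorm_le hW (h x)).trans_eq (one_mul _)
  refine h1.trans ?_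
  nlinarith [sq_nonneg (‖g x‖ - ‖h x‖)]

theorem form_tensor (a : Op n) (f : CPhase s → ℂ) (hf : Continuous f)
    (hb : ∃ C : ℝ, ∀ x, ‖f x‖ ≤ C) (g h : Lp (Hilb n) 2 (volume : Measure (CPhase s))) :
    form (tensor a f hf hb) g h = ∫ x, f x * inner ℂ (g x) (a (h x)) := by
  refine integral_congr_ae ?_
  filter_upwards [rep_tensor a f hf hb] with x hx
  rw [hx, smul_apply, inner_smul_right]

theorem integrable_fourier_prod (g : 𝓢(CPhase s, ℂ)) (ζ : QPhase n) {F : CPhase s → ℂ}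
    {μ : Measure (CPhase s)} [SFinite μ] (hF : Integrable F μ) :
    Integrable (fun p : CPhase s × CPhase s => 𝓕 g p.1 * char (cPart (freq ζ p.1)) p.2 * F p.2)
      ((volume : Measure (CPhase s)).prod μ) := by
  have h1 : Integrable (fun p : CPhase s × CPhase s => 𝓕 g p.1 * F p.2)
      ((volume : Measure (CPhase s)).prod μ) := (𝓕 g).integrable.mul_prod hF
  have h2 : Continuous fun p : CPhase s × CPhase s => char (cPart (freq ζ p.1)) p.2 :=
    continuous_char.comp (((continuous_cPart.comp (continuous_freq ζ)).comp continuous_fst).prodMk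
      continuous_snd)
  have h3 := h1.bdd_mul (c := 1) h2.aestronglyMeasurable
    (Eventually.of_forall fun p => (norm_char _ _).le)
  refine h3.congr (Eventually.of_forall fun p => ?_)
  simp only
  ring

/-- Fubini for the inverse Fourier integral inside the form; the Fourier transform supplies
integrability in `k`, the product of the two vectors integrability in `x`. -/
theorem form_tensor_schwartz (ζ : QPhase n) (φ : 𝓢(CPhase s, ℂ)) (hc hb)
    (g h : Lp (Hilb n) 2 (volume : Measure (CPhase s))) :
    Integrable (fun k => 𝓕 φ k * form (hybridWeyl (freq ζ k)) g h) ∧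
    form (tensor (weyl ζ) φ hc hb) g h
      = ∫ k, 𝓕 φ k * form (hybridWeyl (freq ζ k)) g h := by
  have hI := integrable_fourier_prod φ ζ (integrable_inner_Lp (weyl ζ) g h)
  have hform : ∀ k, 𝓕 φ k * form (hybridWeyl (freq ζ k)) g h
      = ∫ x, 𝓕 φ k * char (cPart (freq ζ k)) x * inner ℂ (g x) (weyl ζ (h x)) := by
    intro k
    rw [hybridWeyl, form_tensor, ← integral_const_mul]
    refine integral_congr_ae (Eventually.of_forall fun x => ?_)
    simp only [char, qPart_freq]
    ring
  simp only [hform]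
  refine ⟨hI.integral_prod_left, ?_⟩
  rw [form_tensor, integral_integral_swap hI]
  refine integral_congr_ae (Eventually.of_forall fun x => ?_)
  simp only
  rw [integral_mul_const, ← schwartz_eq_integral]

theorem norm_form_hybridWeyl_le (ξ : Phase n s)
    (g h : Lp (Hilb n) 2 (volume : Measure (CPhase s))) :
    ‖form (hybridWeyl ξ) g h‖ ≤ 1 / 2 * (‖g‖ ^ 2 + ‖h‖ ^ 2) := by
  rw [hybridWeyl, form_tensor]
  refine (norm_integral_le_integral_norm _).trans
    (Eq.trans_le ?_ (integral_norm_inner_le (norm_weyl_le (qPart ξ)) g h))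
  refine integral_congr_ae (Eventually.of_forall fun x => ?_)
  simp only
  rw [norm_mul, Complex.norm_exp_ofReal_mul_I, one_mul]

/-- The element of the predual furnished by normality is in general not of rank one, so the
superposition formula is needed for infinite sums. The bound on `form (hybridWeyl ξ)` uniform in `ξ`
permits the exchange of sum and integral. -/
theorem duality_tensor_schwartz (P : Predual n s) (ζ : QPhase n) (φ : 𝓢(CPhase s, ℂ)) (hc hb) :
    duality P (tensor (weyl ζ) φ hc hb) = ∫ k, 𝓕 φ k * duality P (hybridWeyl (freq ζ k)) := by
  have hsum : Summable fun i => 1 / 2 * (‖P.g i‖ ^ 2 + ‖P.h i‖ ^ 2) :=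
    (P.summable_g.add P.summable_h).mul_left _
  have h := hasSum_integral_of_summable_integral_norm
    (F := fun i k => 𝓕 φ k * form (hybridWeyl (freq ζ k)) (P.g i) (P.h i))
    (fun i => (form_tensor_schwartz ζ φ hc hb (P.g i) (P.h i)).1) ?_
  · simp only [duality, tsum_mul_left] at h ⊢
    rw [← h.tsum_eq]
    exact tsum_congr fun i => (form_tensor_schwartz ζ φ hc hb (P.g i) (P.h i)).2
  · refine Summable.of_nonneg_of_le (fun i => integral_nonneg fun k => norm_nonneg _) (fun i => ?_)
      (hsum.mul_left (∫ k, ‖𝓕 φ k‖))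
    rw [← integral_mul_const]
    refine integral_mono (form_tensor_schwartz ζ φ hc hb (P.g i) (P.h i)).1.norm
      ((𝓕 φ).integrable.norm.mul_const _) fun k => ?_
    simp only [norm_mul]
    gcongr
    exact norm_form_hybridWeyl_le _ _ _

theorem form_zero_zero (X : HybridAlg n s) : form X 0 0 = 0 := by
  refine integral_eq_zero_of_ae ?_
  filter_upwards [Lp.coeFn_zero (Hilb n) 2 (volume : Measure (CPhase s))] with x hx
  rw [hx]
  simp

/-- The rank one element of the predual with given bra and ket. -/
def Predual.single (g h : Lp (Hilb n) 2 (volume : Measure (CPhase s))) : Predual n s where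
  g k := if k = 0 then g else 0
  h k := if k = 0 then h else 0
  summable_g := summable_of_ne_finset_zero (s := {0}) fun k hk => by
    simp [Finset.notMem_singleton.1 hk]
  summable_h := summable_of_ne_finset_zero (s := {0}) fun k hk => by
    simp [Finset.notMem_singleton.1 hk]

theorem duality_single (g h : Lp (Hilb n) 2 (volume : Measure (CPhase s))) (X : HybridAlg n s) :
    duality (Predual.single g h) X = form X g h := by
  rw [duality, tsum_eq_single 0]
  · simp [Predual.single]
  · intro k hk
    simp only [Predual.single, if_neg hk]
    exact form_zero_zero X

/-! ### Superpositions of Weyl operators and versions of their images. -/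

section

theorem integrable_smul_weyl {h : CPhase s → ℂ} {z : CPhase s → QPhase n} (hh : Integrable h)
    (hz : Continuous z) (φ : Hilb n) : Integrable fun k => h k • weyl (z k) φ := by
  have hm : AEStronglyMeasurable (fun k => weyl (z k) φ) (volume : Measure (CPhase s)) :=
    ((continuous_weyl_apply φ).comp hz).aestronglyMeasurable
  refine (hh.norm.mul_const ‖φ‖).mono' (hh.aestronglyMeasurable.smul hm)
    (Eventually.of_forall fun k => ?_)
  rw [norm_smul, norm_weyl_apply]

/-- The weak integral of Weyl operators against an integrable density. -/
def weylInt {h : CPhase s → ℂ} {z : CPhase s → QPhase n} (hh : Integrable h)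
    (hz : Continuous z) : Op n :=
  LinearMap.mkContinuous
    { toFun := fun φ => ∫ k, h k • weyl (z k) φ
      map_add' := fun φ ψ => by
        simp only [map_add, smul_add]
        exact integral_add (integrable_smul_weyl hh hz φ) (integrable_smul_weyl hh hz ψ)
      map_smul' := fun c φ => by
        simp only [map_smul, smul_comm _ c]
        exact integral_smul c _ }
    (∫ k, ‖h k‖) fun φ => by
      refine (norm_integral_le_integral_norm _).trans_eq ?_
      rw [← integral_mul_const]
      refine integral_congr_ae (Eventually.of_forall fun k => ?_)
      simp only
      rw [norm_smul, norm_weyl_apply]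

theorem inner_weylInt {h : CPhase s → ℂ} {z : CPhase s → QPhase n} (hh : Integrable h)
    (hz : Continuous z) (φ ψ : Hilb n) :
    inner ℂ ψ (weylInt hh hz φ) = ∫ k, h k * inner ℂ ψ (weyl (z k) φ) := by
  change inner ℂ ψ (∫ k, h k • weyl (z k) φ) = _
  rw [← integral_inner (integrable_smul_weyl hh hz φ)]
  simp only [inner_smul_right]

/-- The matrix elements of `T_t[W(ξ)](x)`. -/
def orbitElem (S : ℝ → (Phase n s →ₗ[ℝ] Phase n s)) (noise : ℝ → Phase n s → ℂ) (x : CPhase s)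
    (φ ψ : Hilb n) (t : ℝ) (ξ : Phase n s) : ℂ :=
  noise t ξ * char (cPart (S t ξ)) x * inner ℂ ψ (weyl (qPart (S t ξ)) φ)

theorem hilb_op_ext_of_dense {a b : Op n} {D : Set (Hilb n)} (hD : Dense D)
    (h : ∀ φ ∈ D, ∀ ψ ∈ D, (inner ℂ ψ (a φ) : ℂ) = inner ℂ ψ (b φ)) : a = b := by
  refine ContinuousLinearMap.coeFn_injective
    (Continuous.ext_on hD a.continuous b.continuous fun φ hφ => ?_)
  have h1 : (fun ψ : Hilb n => (inner ℂ ψ (a φ) : ℂ)) = fun ψ => inner ℂ ψ (b φ) :=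
    Continuous.ext_on hD (continuous_id.inner continuous_const)
      (continuous_id.inner continuous_const) fun ψ hψ => h φ hφ ψ hψ
  exact ext_inner_left ℂ fun ψ => congrFun h1 ψ

/-- Set integrals determine each matrix element up to a null set depending on the two vectors.
Letting the vectors run through a countable dense set leaves a single null set, off which the
operators agree. -/
theorem isVersion_of_setIntegral {X : HybridAlg n s} {V : CPhase s → Op n}
    (hc : ∀ φ ψ : Hilb n, Continuous fun x => (inner ℂ ψ (V x φ) : ℂ))
    (hb : ∀ φ ψ : Hilb n, ∃ C, ∀ x, ‖(inner ℂ ψ (V x φ) : ℂ)‖ ≤ C)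
    (h : ∀ (φ ψ : Hilb n) (B : Set (CPhase s)), MeasurableSet B → volume B < ∞ →
      ∫ x in B, inner ℂ ψ (rep X x φ) = ∫ x in B, inner ℂ ψ (V x φ)) : IsVersion X V := by
  refine ⟨?_, hc⟩
  have key : ∀ φ ψ : Hilb n, ∀ᵐ x, (inner ℂ ψ (rep X x φ) : ℂ) = inner ℂ ψ (V x φ) := by
    intro φ ψ
    obtain ⟨C, hC⟩ := hb φ ψ
    exact ae_eq_of_forall_setIntegral_eq_of_sigmaFinite
      (fun B _ hμ => integrableOn_inner_rep X φ ψ hμ)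
      (fun B _ hμ => Measure.integrableOn_of_bounded hμ.ne
        (hc φ ψ).aestronglyMeasurable (Eventually.of_forall hC)) (h φ ψ)
  have : Fact ((2 : ℝ≥0∞) ≠ ∞) := ⟨by simp⟩
  obtain ⟨D, hDc, hDd⟩ := TopologicalSpace.exists_countable_dense (Hilb n)
  have hall : ∀ᵐ x, ∀ φ ∈ D, ∀ ψ ∈ D, (inner ℂ ψ (rep X x φ) : ℂ) = inner ℂ ψ (V x φ) :=
    (ae_ball_iff hDc).2 fun φ _ => (ae_ball_iff hDc).2 fun ψ _ => key φ ψ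
  filter_upwards [hall] with x hx
  exact hilb_op_ext_of_dense hDd hx

variable {T : ℝ → (HybridAlg n s →ₗ[ℂ] HybridAlg n s)}
  {S : ℝ → (Phase n s →ₗ[ℝ] Phase n s)} {noise : ℝ → Phase n s → ℂ}

theorem setIntegral_rep_hybridWeyl (hT : IsQuasiFreeSemigroup T S noise) {t : ℝ} (ht : 0 ≤ t)
    (ξ : Phase n s) (φ ψ : Hilb n) (B : Set (CPhase s)) :
    ∫ x in B, inner ℂ ψ (rep (T t (hybridWeyl ξ)) x φ)
      = ∫ x in B, orbitElem S noise x φ ψ t ξ := by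
  refine integral_congr_ae (ae_restrict_of_ae ?_)
  rw [hT.quasiFree t ht ξ]
  filter_upwards [rep_smul (noise t ξ) (hybridWeyl (S t ξ)), rep_tensor (weyl (qPart (S t ξ)))
    (fun x => cexp (((∑ j, cPart (S t ξ) j * x j : ℝ) : ℂ) * I)) (by fun_prop)
    ⟨1, fun x => by rw [Complex.norm_exp_ofReal_mul_I]⟩] with x h1 h2
  rw [h1]
  rw [hybridWeyl, h2]
  simp only [smul_apply, inner_smul_right, orbitElem, char]
  ring

/-- The weakly continuous version of `T_t[W₁(ζ) ⊗ g]` for a Schwartz function `g`. -/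
theorem exists_version_schwartz (hT : IsQuasiFreeSemigroup T S noise) {t : ℝ} (ht : 0 ≤ t)
    (hnoise : ∀ ξ, ‖noise t ξ‖ ≤ 1) (ζ : QPhase n) (g : 𝓢(CPhase s, ℂ)) (hc hb) :
    ∃ V, IsVersion (T t (tensor (weyl ζ) g hc hb)) V ∧
      ∀ x φ ψ, inner ℂ ψ (V x φ) = ∫ k, 𝓕 g k * orbitElem S noise x φ ψ t (freq ζ k) := by
  have hS : Continuous (S t) := LinearMap.continuous_of_finiteDimensional _
  have hSf : Continuous fun k : CPhase s => S t (freq ζ k) := hS.comp (continuous_freq ζ)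
  have hz : Continuous fun k : CPhase s => qPart (S t (freq ζ k)) := continuous_qPart.comp hSf
  have hchar : Continuous fun p : CPhase s × CPhase s => char (cPart (S t (freq ζ p.1))) p.2 :=
    continuous_char.comp (((continuous_cPart.comp hSf).comp continuous_fst).prodMk continuous_snd)
  have hn : Continuous fun k : CPhase s => noise t (freq ζ k) :=
    (hT.noise_continuous t ht).comp (continuous_freq ζ)
  have hh : ∀ x, Integrable fun k =>
      𝓕 g k * (noise t (freq ζ k) * char (cPart (S t (freq ζ k))) x) := by
    intro x
    refine (𝓕 g).integrable.mul_bdd (c := 1) ?_ (Eventually.of_forall fun k => ?_)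
    · exact (hn.mul (hchar.comp (continuous_id.prodMk continuous_const))).aestronglyMeasurable
    · rw [norm_mul, norm_char, mul_one]
      exact hnoise _
  have hV : ∀ x φ ψ, inner ℂ ψ (weylInt (hh x) hz φ)
      = ∫ k, 𝓕 g k * orbitElem S noise x φ ψ t (freq ζ k) := by
    intro x φ ψ
    rw [inner_weylInt]
    refine integral_congr_ae (Eventually.of_forall fun k => ?_)
    simp only [orbitElem]
    ring
  have horb : ∀ φ ψ, Continuous fun p : CPhase s × CPhase s =>
      𝓕 g p.1 * orbitElem S noise p.2 φ ψ t (freq ζ p.1) := by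
    intro φ ψ
    unfold orbitElem
    refine ((𝓕 g).continuous.comp continuous_fst).mul (((hn.comp continuous_fst).mul hchar).mul
      (continuous_const.inner (((continuous_weyl_apply φ).comp hz).comp continuous_fst)))
  have hbd : ∀ (φ ψ : Hilb n) x k, ‖𝓕 g k * orbitElem S noise x φ ψ t (freq ζ k)‖
      ≤ ‖𝓕 g k‖ * (‖ψ‖ * ‖φ‖) := by
    intro φ ψ x k
    rw [norm_mul, orbitElem, norm_mul, norm_mul, norm_char, mul_one]
    refine mul_le_mul_of_nonneg_left ?_ (norm_nonneg _)
    have h1 : ‖(inner ℂ ψ (weyl (qPart (S t (freq ζ k))) φ) : ℂ)‖ ≤ ‖ψ‖ * ‖φ‖ := by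
      rw [← norm_weyl_apply (qPart (S t (freq ζ k))) φ]
      exact norm_inner_le_norm _ _
    exact (mul_le_mul (hnoise _) h1 (norm_nonneg _) zero_le_one).trans_eq (one_mul _)
  have hcont : ∀ φ ψ : Hilb n, Continuous fun x =>
      ∫ k, 𝓕 g k * orbitElem S noise x φ ψ t (freq ζ k) := by
    intro φ ψ
    refine continuous_of_dominated (bound := fun k => ‖𝓕 g k‖ * (‖ψ‖ * ‖φ‖)) (fun x => ?_)
      (fun x => Eventually.of_forall (hbd φ ψ x)) ((𝓕 g).integrable.norm.mul_const _)
      (Eventually.of_forall fun k => ?_)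
    · have h1 : Continuous fun k : CPhase s => (k, x) := by fun_prop
      exact ((horb φ ψ).comp h1).aestronglyMeasurable
    · have h1 : Continuous fun x : CPhase s => (k, x) := by fun_prop
      have h2 := (horb φ ψ).comp h1
      simp only [Function.comp_def] at h2
      exact h2
  refine ⟨fun x => weylInt (hh x) hz, isVersion_of_setIntegral (fun φ ψ => ?_) (fun φ ψ => ?_)
    (fun φ ψ B hB hμ => ?_), hV⟩
  · simp only [hV]
    exact hcont φ ψ
  · refine ⟨∫ k, ‖𝓕 g k‖ * (‖ψ‖ * ‖φ‖), fun x => ?_⟩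
    rw [hV]
    exact norm_integral_le_of_norm_le ((𝓕 g).integrable.norm.mul_const _)
      (Eventually.of_forall (hbd φ ψ x))
  simp only [hV]
  -- The functional `P` tests a class against `B`, `φ` and `ψ`. Normality replaces `T_t` by a
  -- functional `P'`, for which the Fourier superposition is available; under the integral over `k`
  -- one returns to `P`, where the action of `T_t` on Weyl operators is known.
  obtain ⟨P, hdP⟩ : ∃ P : Predual n s, ∀ Y, duality P Y = ∫ x in B, inner ℂ ψ (rep Y x φ) :=
    ⟨Predual.single (indicatorConstLp 2 hB hμ.ne ψ) (indicatorConstLp 2 hB hμ.ne φ), fun Y => by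
      rw [duality_single, form_indicator]⟩
  obtain ⟨P', hP'⟩ := hT.normal t ht P
  have hfin : IsFiniteMeasure (volume.restrict B) := ⟨by simpa using hμ⟩
  have hI : Integrable (fun p : CPhase s × CPhase s =>
      𝓕 g p.1 * orbitElem S noise p.2 φ ψ t (freq ζ p.1))
      ((volume : Measure (CPhase s)).prod (volume.restrict B)) := by
    have h1 : Integrable (fun p : CPhase s × CPhase s => ‖𝓕 g p.1‖ * (‖ψ‖ * ‖φ‖))
        ((volume : Measure (CPhase s)).prod (volume.restrict B)) :=
      (𝓕 g).integrable.norm.mul_prod (integrable_const _)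
    exact h1.mono' (horb φ ψ).aestronglyMeasurable
      (Eventually.of_forall fun p => hbd φ ψ p.2 p.1)
  have h2 : ∀ k, 𝓕 g k * duality P' (hybridWeyl (freq ζ k))
      = ∫ x in B, 𝓕 g k * orbitElem S noise x φ ψ t (freq ζ k) := by
    intro k
    rw [← hP', hdP, setIntegral_rep_hybridWeyl hT ht, integral_const_mul]
  have h3 := duality_tensor_schwartz P' ζ g hc hb
  rw [← hP', hdP] at h3
  refine h3.trans ?_
  simp only [h2]
  exact integral_integral_swap hI

end

/-! ### The classical flow -/

/-- The generator of the flow as a continuous linear map. -/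
def flowGen (Z : PhaseMat n s) : Phase n s →L[ℝ] Phase n s := Matrix.toEuclideanCLM (𝕜 := ℝ) Z

theorem flowGen_apply (Z : PhaseMat n s) (ξ : Phase n s) (i) :
    flowGen Z ξ i = ∑ j, Z i j * ξ j := rfl

-- Passing from matrices to operators is a continuous algebra homomorphism, hence commutes with the
-- exponential series. The operator exponential is what the differentiation lemmas apply to.
open scoped Matrix.Norms.L2Operator in
theorem exp_mulVec (Z : PhaseMat n s) (t : ℝ) (ξ : Phase n s) :
    WithLp.toLp 2 (NormedSpace.exp (t • Z) *ᵥ ⇑ξ) = NormedSpace.exp (t • flowGen Z) ξ := by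
  have hc : Continuous (Matrix.toEuclideanCLM (n := (Fin n ⊕ Fin n) ⊕ Fin s) (𝕜 := ℝ)) :=
    LinearMap.continuous_of_finiteDimensional
      ({ toFun := Matrix.toEuclideanCLM (n := (Fin n ⊕ Fin n) ⊕ Fin s) (𝕜 := ℝ)
         map_add' := map_add _
         map_smul' := fun c x => map_smul _ c x } :
        PhaseMat n s →ₗ[ℝ] (Phase n s →L[ℝ] Phase n s))
  have h := NormedSpace.map_exp_of_mem_ball (𝕂 := ℝ)
    (Matrix.toEuclideanCLM (n := (Fin n ⊕ Fin n) ⊕ Fin s) (𝕜 := ℝ)) hc (t • Z) (by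
      rw [NormedSpace.expSeries_radius_eq_top]
      exact Metric.mem_eball.2 (edist_lt_top _ _))
  rw [map_smul] at h
  rw [flowGen, ← h]
  rfl

theorem hasDerivAt_flow (Z : PhaseMat n s) (ξ : Phase n s) (t : ℝ) :
    HasDerivAt (fun t : ℝ => NormedSpace.exp (t • flowGen Z) ξ)
      (NormedSpace.exp (t • flowGen Z) (flowGen Z ξ)) t := by
  have h := (hasDerivAt_exp_smul_const (𝕂 := ℝ) (flowGen Z) t)
  exact ((ContinuousLinearMap.apply ℝ (Phase n s) ξ).hasFDerivAt.comp_hasDerivAt t h)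

theorem exists_flow_bound (Z : PhaseMat n s) : ∃ C, 0 ≤ C ∧ ∀ t ∈ Icc (0 : ℝ) 1, ∀ ξ : Phase n s,
    ‖NormedSpace.exp (t • flowGen Z) ξ - ξ‖ ≤ C * ‖ξ‖ * t ∧
    ‖NormedSpace.exp (t • flowGen Z) ξ‖ ≤ (1 + C) * ‖ξ‖ := by
  have hcont : Continuous fun t : ℝ => NormedSpace.exp (t • flowGen Z) :=
    continuous_iff_continuousAt.2 fun t =>
      (hasDerivAt_exp_smul_const (𝕂 := ℝ) (flowGen Z) t).continuousAt
  obtain ⟨K, hK⟩ := (isCompact_Icc (a := (0 : ℝ)) (b := 1)).exists_bound_of_continuousOn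
    hcont.continuousOn
  have hK0 : 0 ≤ K := (norm_nonneg _).trans (hK 0 (by simp))
  have h1 : ∀ t ∈ Icc (0 : ℝ) 1, ∀ ξ : Phase n s,
      ‖NormedSpace.exp (t • flowGen Z) ξ - ξ‖ ≤ K * ‖flowGen Z‖ * ‖ξ‖ * t := by
    intro t ht ξ
    have h := (convex_Icc (0 : ℝ) 1).norm_image_sub_le_of_norm_hasDerivWithin_le
      (f := fun t : ℝ => NormedSpace.exp (t • flowGen Z) ξ)
      (fun y _ => (hasDerivAt_flow Z ξ y).hasDerivWithinAt) (C := K * ‖flowGen Z‖ * ‖ξ‖)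
      (fun y hy => ?_) (left_mem_Icc.2 zero_le_one) ht
    · have h0 : NormedSpace.exp ((0 : ℝ) • flowGen Z) ξ = ξ := by
        have h2 : (0 : ℝ) • flowGen Z = 0 := by
          ext v i
          simp
        rw [h2, NormedSpace.exp_zero]
        rfl
      simp only [sub_zero, Real.norm_of_nonneg ht.1] at h
      rw [h0] at h
      exact h
    · refine (ContinuousLinearMap.le_of_opNorm_le _ (hK y hy) _).trans ?_
      rw [mul_assoc]
      gcongr
      exact (flowGen Z).le_opNorm ξ
  refine ⟨K * ‖flowGen Z‖, by positivity, fun t ht ξ => ⟨h1 t ht ξ, ?_⟩⟩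
  have h2 := norm_le_norm_add_norm_sub ξ (NormedSpace.exp (t • flowGen Z) ξ)
  rw [norm_sub_rev] at h2
  have h3 : K * ‖flowGen Z‖ * ‖ξ‖ * t ≤ K * ‖flowGen Z‖ * ‖ξ‖ * 1 := by
    gcongr
    exact ht.2
  linarith [h1 t ht ξ]

/-! ### The Lévy-Khintchine exponent -/

/-- The integrand of the Lévy-Khintchine exponent. -/
def levyKer (ξ η : Phase n s) : ℂ :=
  cexp (I * ((∑ i, η i * ξ i : ℝ) : ℂ)) - 1 - I * (cut η : ℂ) * ((∑ i, η i * ξ i : ℝ) : ℂ)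

theorem abs_sum_mul_le {ι : Type*} [Fintype ι] (η ξ : EuclideanSpace ℝ ι) :
    |∑ i, η i * ξ i| ≤ ‖η‖ * ‖ξ‖ := by
  have h := abs_real_inner_le_norm ξ η
  rw [PiLp.inner_apply] at h
  simpa [mul_comm] using h

theorem norm_exp_I_sub_one_le (r : ℝ) : ‖cexp (I * (r : ℂ)) - 1‖ ≤ |r| :=
  Real.norm_exp_I_mul_ofReal_sub_one_le

theorem norm_exp_I_le (r : ℝ) : ‖cexp (I * (r : ℂ))‖ = 1 := by
  rw [mul_comm, Complex.norm_exp_ofReal_mul_I]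

theorem norm_exp_I_sub_one_le_two (r : ℝ) : ‖cexp (I * (r : ℂ)) - 1‖ ≤ 2 :=
  (norm_sub_le _ _).trans (by rw [norm_exp_I_le, norm_one]; norm_num)

theorem norm_exp_I_sub_one_sub_le (r : ℝ) : ‖cexp (I * (r : ℂ)) - 1 - I * (r : ℂ)‖ ≤ 2 * r ^ 2 := by
  have hn : ‖I * (r : ℂ)‖ = |r| := by simp
  rcases le_or_gt |r| 1 with h | h
  · have := Complex.norm_exp_sub_one_sub_id_le (x := I * (r : ℂ)) (by rwa [hn])
    rw [hn, sq_abs] at this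
    nlinarith [sq_nonneg r]
  · refine (norm_sub_le _ _).trans ?_
    rw [hn]
    have := norm_exp_I_sub_one_le r
    nlinarith [sq_abs r]

theorem cut_eq_one {η : Phase n s} (h : ‖η‖ < 1) : cut η = 1 :=
  indicator_of_mem (s := {η : Phase n s | ‖η‖ < 1}) h _

theorem cut_eq_zero {η : Phase n s} (h : ¬ ‖η‖ < 1) : cut η = 0 :=
  indicator_of_notMem (s := {η : Phase n s | ‖η‖ < 1}) h _

theorem measurable_cut : Measurable (cut (n := n) (s := s)) :=
  measurable_const.indicator (measurableSet_lt measurable_norm measurable_const)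

/-- The weight `min(1, |η|²)`. -/
def levyWeight (η : Phase n s) : ℝ := min 1 (‖η‖ ^ 2)

theorem levyWeight_nonneg (η : Phase n s) : 0 ≤ levyWeight η := le_min zero_le_one (sq_nonneg _)

theorem levyWeight_of_lt {η : Phase n s} (h : ‖η‖ < 1) : levyWeight η = ‖η‖ ^ 2 :=
  min_eq_right (pow_le_one₀ (norm_nonneg _) h.le)

theorem levyWeight_of_ge {η : Phase n s} (h : ¬ ‖η‖ < 1) : levyWeight η = 1 :=
  min_eq_left (one_le_pow₀ (not_lt.1 h))

theorem continuous_levyWeight : Continuous (levyWeight (n := n) (s := s)) := by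
  unfold levyWeight
  fun_prop

theorem integrable_levyWeight {ν : Measure (Phase n s)} (hν : IsLevyMeasure ν) :
    Integrable levyWeight ν := by
  refine ⟨continuous_levyWeight.aestronglyMeasurable, ?_⟩
  have hm : MeasurableSet {η : Phase n s | ‖η‖ < 1} :=
    measurableSet_lt measurable_norm measurable_const
  rw [hasFiniteIntegral_iff_norm, ← lintegral_add_compl _ hm]
  refine ENNReal.add_lt_top.2 ⟨?_, ?_⟩
  · refine lt_of_eq_of_lt ?_ hν.small
    refine setLIntegral_congr_fun hm fun η hη => ?_
    rw [levyWeight_of_lt hη, Real.norm_of_nonneg (by positivity)]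
  · have hc : {η : Phase n s | ‖η‖ < 1}ᶜ = {η | 1 ≤ ‖η‖} := by
      ext η
      simp
    rw [hc]
    refine lt_of_le_of_lt (setLIntegral_mono measurable_const (g := fun _ => 1) fun η _ => ?_) ?_
    · rw [Real.norm_of_nonneg (levyWeight_nonneg _)]
      exact ENNReal.ofReal_le_one.2 (min_le_left _ _)
    · rw [setLIntegral_const, one_mul]
      exact hν.large

/-- Inside the unit ball the compensated exponential is of second order in `η · ξ`; outside it is at
most `2`. The quadratic growth in `ξ` is what the Fourier transform of a Schwartz function has to
absorb. -/
theorem norm_levyKer_le (ξ η : Phase n s) :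
    ‖levyKer ξ η‖ ≤ 2 * (1 + ‖ξ‖) ^ 2 * levyWeight η := by
  have h0 := abs_sum_mul_le η ξ
  unfold levyKer
  by_cases h : ‖η‖ < 1
  · rw [cut_eq_one h, levyWeight_of_lt h]
    have h1 := norm_exp_I_sub_one_sub_le (∑ i, η i * ξ i)
    have h2 : (∑ i, η i * ξ i) ^ 2 ≤ (‖η‖ * ‖ξ‖) ^ 2 := by
      rw [← sq_abs]
      gcongr
    rw [ofReal_one, mul_one]
    refine h1.trans ?_
    have h3 : (‖η‖ * ‖ξ‖) ^ 2 ≤ (1 + ‖ξ‖) ^ 2 * ‖η‖ ^ 2 := by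
      rw [mul_pow, mul_comm]
      gcongr
      linarith
    linarith
  · rw [cut_eq_zero h, levyWeight_of_ge h, ofReal_zero, mul_zero, zero_mul, sub_zero, mul_one]
    refine (norm_exp_I_sub_one_le_two _).trans ?_
    have : 1 ≤ (1 + ‖ξ‖) ^ 2 := one_le_pow₀ (by linarith [norm_nonneg ξ])
    linarith

theorem measurable_levyKer : Measurable fun p : Phase n s × Phase n s => levyKer p.1 p.2 := by
  have h : Measurable fun p : Phase n s × Phase n s => (cut p.2 : ℂ) :=
    Complex.measurable_ofReal.comp (measurable_cut.comp measurable_snd)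
  have h1 : Measurable fun p : Phase n s × Phase n s => ((∑ i, p.2 i * p.1 i : ℝ) : ℂ) := by
    fun_prop
  unfold levyKer
  exact (((h1.const_mul I).cexp).sub_const 1).sub ((h.const_mul I).mul h1)

theorem integrable_levyKer {ν : Measure (Phase n s)} (hν : IsLevyMeasure ν) (ξ : Phase n s) :
    Integrable (levyKer ξ) ν :=
  ((integrable_levyWeight hν).const_mul _).mono'
    (measurable_levyKer.comp (measurable_const.prodMk measurable_id)).aestronglyMeasurable
    (Eventually.of_forall (norm_levyKer_le ξ))

theorem levyExponent_eq (α : Phase n s) (A : PhaseMat n s) (ν : Measure (Phase n s))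
    (ξ : Phase n s) : levyExponent α A ν ξ =
      I * ((∑ i, α i * ξ i : ℝ) : ℂ) - 1 / 2 * ((∑ i, ∑ j, ξ i * A i j * ξ j : ℝ) : ℂ)
        + ∫ η, levyKer ξ η ∂ν := rfl

theorem continuous_levyExponent (α : Phase n s) (A : PhaseMat n s) {ν : Measure (Phase n s)}
    (hν : IsLevyMeasure ν) : Continuous (levyExponent α A ν) := by
  have h : Continuous fun ξ => ∫ η, levyKer ξ η ∂ν := by
    refine continuous_iff_continuousAt.2 fun ξ => continuousAt_of_dominated
      (bound := fun η => 2 * (1 + (‖ξ‖ + 1)) ^ 2 * levyWeight η)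
      (Eventually.of_forall fun ξ => (integrable_levyKer hν ξ).aestronglyMeasurable) ?_
      ((integrable_levyWeight hν).const_mul _) (Eventually.of_forall fun η => ?_)
    · filter_upwards [Metric.ball_mem_nhds ξ zero_lt_one] with ξ' hξ'
      refine Eventually.of_forall fun η => (norm_levyKer_le ξ' η).trans ?_
      have h1 : ‖ξ'‖ ≤ ‖ξ‖ + 1 := by
        have := norm_le_norm_add_norm_sub ξ ξ'
        rw [mem_ball_iff_norm'] at hξ'
        linarith
      have := levyWeight_nonneg η
      gcongr
    · refine Continuous.continuousAt ?_
      unfold levyKer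
      fun_prop
  have h2 : Continuous fun ξ : Phase n s => I * ((∑ i, α i * ξ i : ℝ) : ℂ)
      - 1 / 2 * ((∑ i, ∑ j, ξ i * A i j * ξ j : ℝ) : ℂ) := by
    fun_prop
  exact h2.add h

theorem exists_levyExponent_bound (α : Phase n s) (A : PhaseMat n s) {ν : Measure (Phase n s)}
    (hν : IsLevyMeasure ν) :
    ∃ C, 0 ≤ C ∧ ∀ ξ, ‖levyExponent α A ν ξ‖ ≤ C * (1 + ‖ξ‖) ^ 2 := by
  refine ⟨‖α‖ + 1 / 2 * (∑ i, ∑ j, |A i j|) + 2 * ∫ η, levyWeight η ∂ν, ?_, fun ξ => ?_⟩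
  · have : 0 ≤ ∫ η, levyWeight η ∂ν := integral_nonneg levyWeight_nonneg
    positivity
  have h1 : ‖I * ((∑ i, α i * ξ i : ℝ) : ℂ)‖ ≤ ‖α‖ * (1 + ‖ξ‖) ^ 2 := by
    rw [norm_mul, norm_I, one_mul, Complex.norm_real]
    refine (abs_sum_mul_le α ξ).trans ?_
    gcongr
    nlinarith [norm_nonneg ξ]
  have h2 : ‖(1 / 2 * ((∑ i, ∑ j, ξ i * A i j * ξ j : ℝ) : ℂ) : ℂ)‖
      ≤ 1 / 2 * (∑ i, ∑ j, |A i j|) * (1 + ‖ξ‖) ^ 2 := by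
    rw [norm_mul, Complex.norm_real, show ‖(1 / 2 : ℂ)‖ = 1 / 2 by simp, mul_assoc]
    gcongr
    rw [Finset.sum_mul]
    refine (norm_sum_le _ _).trans (Finset.sum_le_sum fun i _ => ?_)
    rw [Finset.sum_mul]
    refine (norm_sum_le _ _).trans (Finset.sum_le_sum fun j _ => ?_)
    rw [norm_mul, norm_mul, Real.norm_eq_abs (A i j)]
    have e1 := PiLp.norm_apply_le ξ i
    have e2 := PiLp.norm_apply_le ξ j
    calc _ ≤ ‖ξ‖ * |A i j| * ‖ξ‖ := by gcongr
      _ = |A i j| * ‖ξ‖ ^ 2 := by ring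
      _ ≤ _ := by
        gcongr
        linarith
  have h3 : ‖∫ η, levyKer ξ η ∂ν‖ ≤ 2 * (∫ η, levyWeight η ∂ν) * (1 + ‖ξ‖) ^ 2 := by
    refine (norm_integral_le_of_norm_le ((integrable_levyWeight hν).const_mul _)
      (Eventually.of_forall (norm_levyKer_le ξ))).trans_eq ?_
    rw [integral_const_mul]
    ring
  rw [levyExponent_eq]
  refine (norm_add_le _ _).trans ?_
  have h4 := norm_sub_le (I * ((∑ i, α i * ξ i : ℝ) : ℂ))
    (1 / 2 * ((∑ i, ∑ j, ξ i * A i j * ξ j : ℝ) : ℂ))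
  linarith

theorem sum_mul_nonneg_of_posSemidef {A : PhaseMat n s} (hA : A.PosSemidef) (ξ : Phase n s) :
    0 ≤ ∑ i, ∑ j, ξ i * A i j * ξ j := by
  have h := hA.dotProduct_mulVec_nonneg (⇑ξ)
  refine h.trans_eq ?_
  simp only [dotProduct, Matrix.mulVec, Finset.mul_sum, star_trivial, mul_assoc]

/-- The drift and the compensator are purely imaginary, the Gaussian part is nonpositive because `A
≥ 0`, and `cos - 1 ≤ 0` under the integral. Consequently the noise functions have modulus at most
`1`. -/
theorem re_levyExponent_nonpos (α : Phase n s) {A : PhaseMat n s} (hA : A.PosSemidef)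
    {ν : Measure (Phase n s)} (hν : IsLevyMeasure ν) (ξ : Phase n s) :
    (levyExponent α A ν ξ).re ≤ 0 := by
  have h1 : (∫ η, levyKer ξ η ∂ν).re ≤ 0 := by
    have h2 := integral_re (integrable_levyKer hν ξ)
    simp only [RCLike.re_to_complex] at h2
    rw [← h2]
    refine integral_nonpos fun η => ?_
    simp only [levyKer, Pi.zero_apply]
    have h3 : (cexp (I * ((∑ i, η i * ξ i : ℝ) : ℂ))).re ≤ 1 :=
      (Complex.re_le_norm _).trans (norm_exp_I_le _).le
    have h4 : (I * (cut η : ℂ) * ((∑ i, η i * ξ i : ℝ) : ℂ)).re = 0 := by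
      rw [mul_assoc, ← ofReal_mul, Complex.re_mul_ofReal, I_re, zero_mul]
    rw [sub_re, sub_re, h4, one_re]
    linarith
  have h5 := sum_mul_nonneg_of_posSemidef hA ξ
  rw [levyExponent_eq, add_re, sub_re, Complex.re_mul_ofReal, Complex.re_mul_ofReal, I_re, zero_mul]
  have h6 : ((1 / 2 : ℂ)).re = 1 / 2 := by simp
  rw [h6]
  linarith

section

/-! ### Differentiation under the integral sign at the endpoint `0` -/

/-- Dominated convergence for difference quotients based at `0`. The orbits are controlled only
against their value at `t = 0`, so a bound on derivatives in a neighbourhood is not asked for. -/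
theorem hasDerivWithinAt_integral_of_slope_bound {X : Type*} [MeasurableSpace X] {μ : Measure X}
    {F : ℝ → X → ℂ} {F' : X → ℂ} {B : X → ℝ} (hB : Integrable B μ)
    (hF : ∀ t ∈ Icc (0 : ℝ) 1, Integrable (F t) μ)
    (hb : ∀ t ∈ Icc (0 : ℝ) 1, ∀ᵐ k ∂μ, ‖F t k - F 0 k‖ ≤ t * B k)
    (hd : ∀ᵐ k ∂μ, HasDerivWithinAt (fun t => F t k) (F' k) (Ici 0) 0) :
    Integrable F' μ ∧
      HasDerivWithinAt (fun t => ∫ k, F t k ∂μ) (∫ k, F' k ∂μ) (Ici 0) 0 := by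
  have hset : Ici (0 : ℝ) \ {0} = Ioi 0 := Ici_sdiff_left
  have h01 : Ioc (0 : ℝ) 1 ∈ 𝓝[>] (0 : ℝ) := Ioc_mem_nhdsGT zero_lt_one
  have hI : ∀ t ∈ Icc (0 : ℝ) 1, Integrable (slope F 0 t) μ := fun t ht => by
    rw [slope_def_module]
    exact ((hF t ht).sub (hF 0 (by simp))).smul _
  have hb' : ∀ t ∈ Ioc (0 : ℝ) 1, ∀ᵐ k ∂μ, ‖slope F 0 t k‖ ≤ B k := fun t ht => by
    filter_upwards [hb t (Ioc_subset_Icc_self ht)] with k hk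
    rw [slope_def_module, sub_zero, Pi.smul_apply, Pi.sub_apply, norm_smul, norm_inv,
      Real.norm_of_nonneg ht.1.le, inv_mul_le_iff₀ ht.1]
    exact hk
  have hlim : ∀ᵐ k ∂μ, Tendsto (fun t => slope F 0 t k) (𝓝[>] 0) (𝓝 (F' k)) := by
    filter_upwards [hd] with k hk
    rw [hasDerivWithinAt_iff_tendsto_slope, hset] at hk
    refine hk.congr fun t => ?_
    simp [slope_def_module]
  -- The pointwise derivative is measurable as the limit of the slopes along the sequence `1 / (m +
  -- 1)`.
  have hmeas : AEStronglyMeasurable F' μ := by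
    have hu : Tendsto (fun m : ℕ => 1 / ((m : ℝ) + 1)) atTop (𝓝[>] 0) :=
      tendsto_nhdsWithin_iff.2 ⟨tendsto_one_div_add_atTop_nhds_zero_nat,
        Eventually.of_forall fun m => by
          rw [mem_Ioi]
          positivity⟩
    refine aestronglyMeasurable_of_tendsto_ae atTop
      (f := fun m : ℕ => slope F 0 (1 / ((m : ℝ) + 1))) (fun m => (hI _ ⟨by positivity, ?_⟩).1) ?_
    · rw [div_le_one (by positivity)]
      linarith [(Nat.cast_nonneg m : (0 : ℝ) ≤ m)]
    · filter_upwards [hlim] with k hk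
      exact hk.comp hu
  refine ⟨?_, ?_⟩
  · have hu : Tendsto (fun m : ℕ => 1 / ((m : ℝ) + 1)) atTop (𝓝[>] 0) :=
      tendsto_nhdsWithin_iff.2 ⟨tendsto_one_div_add_atTop_nhds_zero_nat,
        Eventually.of_forall fun m => by
          rw [mem_Ioi]
          positivity⟩
    refine hB.mono' hmeas ?_
    have hall : ∀ᵐ k ∂μ, ∀ m : ℕ, ‖slope F 0 (1 / ((m : ℝ) + 1)) k‖ ≤ B k :=
      ae_all_iff.2 fun m => hb' _ ⟨by positivity, by
        rw [div_le_one (by positivity)]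
        linarith [(Nat.cast_nonneg m : (0 : ℝ) ≤ m)]⟩
    filter_upwards [hlim, hall] with k hk hkb
    exact le_of_tendsto (hk.comp hu).norm (Eventually.of_forall hkb)
  · rw [hasDerivWithinAt_iff_tendsto_slope, hset]
    have h := tendsto_integral_filter_of_dominated_convergence (μ := μ) (l := 𝓝[>] (0 : ℝ))
      (F := fun t k => slope F 0 t k) (f := F') B ?_ ?_ hB hlim
    · refine h.congr' ?_
      filter_upwards [h01] with t ht
      have ht' := Ioc_subset_Icc_self ht
      simp only [slope_def_module, Pi.smul_apply, Pi.sub_apply]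
      rw [integral_smul, integral_sub (hF t ht') (hF 0 (by simp))]
    · filter_upwards [h01] with t ht using (hI t (Ioc_subset_Icc_self ht)).1
    · filter_upwards [h01] with t ht using hb' t ht

/-! ### The quasi-free orbit of a Weyl operator -/

/-- The quantum component as a continuous linear map. -/
def qPartL : Phase n s →L[ℝ] QPhase n :=
  LinearMap.toContinuousLinearMap
    { toFun := qPart, map_add' := fun _ _ => rfl, map_smul' := fun _ _ => rfl }

/-- The classical component as a continuous linear map. -/
def cPartL : Phase n s →L[ℝ] CPhase s :=
  LinearMap.toContinuousLinearMap
    { toFun := cPart, map_add' := fun _ _ => rfl, map_smul' := fun _ _ => rfl }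

theorem norm_sq_eq_qPart_cPart (ξ : Phase n s) : ‖ξ‖ ^ 2 = ‖qPart ξ‖ ^ 2 + ‖cPart ξ‖ ^ 2 := by
  simp only [EuclideanSpace.norm_sq_eq, qPart_apply, cPart_apply, Fintype.sum_sum_type]

theorem norm_qPart_le (ξ : Phase n s) : ‖qPart ξ‖ ≤ ‖ξ‖ := by
  refine abs_le_of_sq_le_sq' ?_ (norm_nonneg _) |>.2
  rw [norm_sq_eq_qPart_cPart ξ]
  linarith [sq_nonneg ‖cPart ξ‖]

theorem norm_cPart_le (ξ : Phase n s) : ‖cPart ξ‖ ≤ ‖ξ‖ := by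
  refine abs_le_of_sq_le_sq' ?_ (norm_nonneg _) |>.2
  rw [norm_sq_eq_qPart_cPart ξ]
  linarith [sq_nonneg ‖qPart ξ‖]

theorem norm_char_sub_le (k k' x : CPhase s) : ‖char k x - char k' x‖ ≤ ‖k - k'‖ * ‖x‖ := by
  have h : char k x - char k' x
      = char k' x * (cexp (I * ((∑ j, (k - k') j * x j : ℝ) : ℂ)) - 1) := by
    rw [mul_sub, mul_one, char, char, ← Complex.exp_add]
    congr 2
    simp only [PiLp.sub_apply, sub_mul, Finset.sum_sub_distrib]
    push_cast
    ring
  rw [h, norm_mul, norm_char, one_mul]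
  exact (norm_exp_I_sub_one_le _).trans (abs_sum_mul_le _ _)

/-- The exponent grows quadratically in `ξ`; its nonpositive real part keeps the estimate linear in
the exponent for arguments of any size. -/
theorem norm_exp_sub_one_le_of_re_nonpos {z : ℂ} (hz : z.re ≤ 0) : ‖cexp z - 1‖ ≤ 2 * ‖z‖ := by
  rcases le_or_gt ‖z‖ 1 with h | h
  · exact Complex.norm_exp_sub_one_le h
  · refine (norm_sub_le _ _).trans ?_
    rw [Complex.norm_exp, norm_one]
    have := Real.exp_le_one_iff.2 hz
    linarith

section Data

variable {S : ℝ → (Phase n s →ₗ[ℝ] Phase n s)} {noise : ℝ → Phase n s → ℂ} {Z : PhaseMat n s}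
  {α : Phase n s} {A : PhaseMat n s} {ν : Measure (Phase n s)}

theorem HasData.flow_eq (h : HasData S noise Z α A ν) {t : ℝ} (ht : 0 ≤ t) (ξ : Phase n s) :
    S t ξ = NormedSpace.exp (t • flowGen Z) ξ := by
  rw [h.flow t ht, exp_mulVec]

theorem exp_zero_flowGen (Z : PhaseMat n s) (ξ : Phase n s) :
    NormedSpace.exp ((0 : ℝ) • flowGen Z) ξ = ξ := by
  have h2 : (0 : ℝ) • flowGen Z = 0 := by
    ext v i
    simp
  rw [h2, NormedSpace.exp_zero]
  rfl

theorem HasData.flow_zero (h : HasData S noise Z α A ν) (ξ : Phase n s) : S 0 ξ = ξ := by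
  rw [h.flow_eq le_rfl, exp_zero_flowGen]

theorem HasData.hasDerivWithinAt_flow (h : HasData S noise Z α A ν) (ξ : Phase n s) :
    HasDerivWithinAt (fun t => S t ξ) (flowGen Z ξ) (Ici 0) 0 := by
  have h1 := (hasDerivAt_flow Z ξ 0).hasDerivWithinAt (s := Ici 0)
  rw [exp_zero_flowGen] at h1
  exact h1.congr (fun t ht => h.flow_eq ht ξ) (h.flow_eq le_rfl ξ)

theorem HasData.exists_flow_bound (h : HasData S noise Z α A ν) :
    ∃ C, 0 ≤ C ∧ ∀ t ∈ Icc (0 : ℝ) 1, ∀ ξ : Phase n s,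
      ‖S t ξ - ξ‖ ≤ C * ‖ξ‖ * t ∧ ‖S t ξ‖ ≤ (1 + C) * ‖ξ‖ := by
  obtain ⟨C, hC0, hC⟩ := HybridQF.exists_flow_bound Z
  refine ⟨C, hC0, fun t ht ξ => ?_⟩
  rw [h.flow_eq ht.1]
  exact hC t ht ξ

/-- The exponent of the noise function along the flow. -/
def flowExponent (Z : PhaseMat n s) (α : Phase n s) (A : PhaseMat n s) (ν : Measure (Phase n s))
    (ξ : Phase n s) (τ : ℝ) : ℂ :=
  levyExponent α A ν (NormedSpace.exp (τ • flowGen Z) ξ)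

theorem HasData.continuous_flowExponent (h : HasData S noise Z α A ν) (ξ : Phase n s) :
    Continuous (flowExponent Z α A ν ξ) :=
  (continuous_levyExponent α A h.levy).comp
    (continuous_iff_continuousAt.2 fun t => (hasDerivAt_flow Z ξ t).continuousAt)

/-- The maps `S t` are specified for `t ≥ 0` only. The exponential is defined and smooth for all
times, so the integrand becomes continuous on the whole line and the fundamental theorem of calculus
applies at `0`. -/
theorem HasData.noise_eq_exp (h : HasData S noise Z α A ν) {t : ℝ} (ht : 0 ≤ t) (ξ : Phase n s) :
    noise t ξ = cexp (∫ τ in (0 : ℝ)..t, flowExponent Z α A ν ξ τ) := by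
  rw [h.noise_eq t ht]
  congr 1
  refine intervalIntegral.integral_congr fun τ hτ => ?_
  rw [uIcc_of_le ht] at hτ
  simp only [flowExponent]
  rw [h.flow_eq hτ.1]

theorem HasData.re_integral_nonpos (h : HasData S noise Z α A ν) {t : ℝ} (ht : 0 ≤ t)
    (ξ : Phase n s) : (∫ τ in (0 : ℝ)..t, flowExponent Z α A ν ξ τ).re ≤ 0 := by
  have hi := (h.continuous_flowExponent ξ).intervalIntegrable (μ := volume) 0 t
  have h1 := intervalIntegral.intervalIntegral_eq_integral_uIoc (flowExponent Z α A ν ξ) 0 t volume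
  rw [if_pos ht, one_smul] at h1
  have h2 := integral_re hi.def'
  simp only [RCLike.re_to_complex] at h2
  rw [h1, ← h2]
  exact integral_nonpos fun τ => re_levyExponent_nonpos α h.posSemidef h.levy _

theorem HasData.norm_noise_le (h : HasData S noise Z α A ν) {t : ℝ} (ht : 0 ≤ t)
    (ξ : Phase n s) : ‖noise t ξ‖ ≤ 1 := by
  rw [h.noise_eq_exp ht, Complex.norm_exp]
  exact Real.exp_le_one_iff.2 (h.re_integral_nonpos ht ξ)

theorem HasData.exists_noise_bound (h : HasData S noise Z α A ν) :
    ∃ C, 0 ≤ C ∧ ∀ t ∈ Icc (0 : ℝ) 1, ∀ ξ, ‖noise t ξ - 1‖ ≤ t * (C * (1 + ‖ξ‖) ^ 2) := by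
  obtain ⟨C, hC0, hC⟩ := exists_levyExponent_bound α A h.levy
  obtain ⟨K, hK0, hK⟩ := HybridQF.exists_flow_bound Z
  refine ⟨2 * (C * (1 + K) ^ 2), by positivity, fun t ht ξ => ?_⟩
  rw [h.noise_eq_exp ht.1]
  refine (norm_exp_sub_one_le_of_re_nonpos (h.re_integral_nonpos ht.1 ξ)).trans ?_
  have h1 : ‖∫ τ in (0 : ℝ)..t, flowExponent Z α A ν ξ τ‖
      ≤ C * (1 + K) ^ 2 * (1 + ‖ξ‖) ^ 2 * |t - 0| := by
    refine intervalIntegral.norm_integral_le_of_norm_le_const fun τ hτ => ?_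
    rw [uIoc_of_le ht.1] at hτ
    refine (hC _).trans ?_
    have h2 := (hK τ ⟨hτ.1.le, hτ.2.trans ht.2⟩ ξ).2
    rw [mul_assoc, ← mul_pow]
    gcongr
    nlinarith [norm_nonneg ξ]
  rw [sub_zero, abs_of_nonneg ht.1] at h1
  linarith

theorem HasData.hasDerivWithinAt_noise (h : HasData S noise Z α A ν) (ξ : Phase n s) :
    HasDerivWithinAt (fun t => noise t ξ) (levyExponent α A ν ξ) (Ici 0) 0 := by
  have hc := h.continuous_flowExponent ξ
  have h1 : HasDerivAt (fun t : ℝ => ∫ τ in (0 : ℝ)..t, flowExponent Z α A ν ξ τ)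
      (flowExponent Z α A ν ξ 0) 0 :=
    intervalIntegral.integral_hasDerivAt_right (hc.intervalIntegrable 0 0)
      (hc.stronglyMeasurableAtFilter _ _) hc.continuousAt
  have h2 := h1.cexp
  rw [intervalIntegral.integral_same, Complex.exp_zero, one_mul, flowExponent,
    exp_zero_flowGen] at h2
  exact h2.hasDerivWithinAt.congr (fun t ht => h.noise_eq_exp ht ξ) (h.noise_eq_exp le_rfl ξ)

theorem HasData.noise_zero (h : HasData S noise Z α A ν) (ξ : Phase n s) : noise 0 ξ = 1 := by
  rw [h.noise_eq 0 le_rfl, intervalIntegral.integral_same, Complex.exp_zero]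

theorem HasData.orbitElem_zero (h : HasData S noise Z α A ν) (x : CPhase s) (φ ψ : Hilb n)
    (ξ : Phase n s) :
    orbitElem S noise x φ ψ 0 ξ = char (cPart ξ) x * inner ℂ ψ (weyl (qPart ξ) φ) := by
  rw [orbitElem, h.noise_zero, h.flow_zero, one_mul]

/-- The derivative at `0` of the quasi-free orbit of a Weyl operator. -/
def orbitDeriv (Z : PhaseMat n s) (α : Phase n s) (A : PhaseMat n s) (ν : Measure (Phase n s))
    (x : CPhase s) (φ ψ : 𝓢(Config n, ℂ)) (ξ : Phase n s) : ℂ :=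
  char (cPart ξ) x *
    ((levyExponent α A ν ξ + I * ((∑ j, cPart (flowGen Z ξ) j * x j : ℝ) : ℂ))
        * inner ℂ (toH ψ) (weyl (qPart ξ) (toH φ))
      + (I / 2) * ∑ i, (qPart (flowGen Z ξ) i : ℂ) *
        inner ℂ (toH ψ) (toH (acomm (R i) (weylS (qPart ξ)) φ)))

theorem HasData.hasDerivWithinAt_orbitElem (h : HasData S noise Z α A ν) (x : CPhase s)
    (φ ψ : 𝓢(Config n, ℂ)) (ξ : Phase n s) :
    HasDerivWithinAt (fun t => orbitElem S noise x (toH φ) (toH ψ) t ξ)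
      (orbitDeriv Z α A ν x φ ψ ξ) (Ici 0) 0 := by
  obtain ⟨K, G, -, -, hG, hG'⟩ := hasFDerivAt_inner_weyl φ ψ
  have hS := h.hasDerivWithinAt_flow ξ
  have hq : HasDerivWithinAt (fun t => qPart (S t ξ)) (qPart (flowGen Z ξ)) (Ici 0) 0 :=
    qPartL.hasFDerivAt.comp_hasDerivWithinAt 0 hS
  have hc : HasDerivWithinAt (fun t => cPart (S t ξ)) (cPart (flowGen Z ξ)) (Ici 0) 0 :=
    cPartL.hasFDerivAt.comp_hasDerivWithinAt 0 hS
  have h1 : HasDerivWithinAt (fun t => (inner ℂ (toH ψ) (weyl (qPart (S t ξ)) (toH φ)) : ℂ))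
      (G (qPart (S 0 ξ)) (qPart (flowGen Z ξ))) (Ici 0) 0 := by
    have h0 := HasFDerivAt.comp_hasDerivWithinAt (f := fun t => qPart (S t ξ)) 0
      (hG (qPart (S 0 ξ))) hq
    simp only [Function.comp_def] at h0
    exact h0
  have h2 : HasDerivWithinAt (fun t => ((∑ j, cPart (S t ξ) j * x j : ℝ) : ℂ) * I)
      (((∑ j, cPart (flowGen Z ξ) j * x j : ℝ) : ℂ) * I) (Ici 0) 0 := by
    refine HasDerivWithinAt.mul_const ?_ I
    refine HasDerivWithinAt.ofReal_comp ?_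
    refine HasDerivWithinAt.fun_sum fun j _ => HasDerivWithinAt.mul_const ?_ _
    exact (EuclideanSpace.proj (𝕜 := ℝ) j).hasFDerivAt.comp_hasDerivWithinAt 0 hc
  have h3 : HasDerivWithinAt (fun t => char (cPart (S t ξ)) x) _ (Ici 0) 0 := h2.cexp
  have h4 := ((h.hasDerivWithinAt_noise ξ).mul h3).mul h1
  refine h4.congr_deriv ?_
  simp only [h.noise_zero, h.flow_zero, hG', Pi.mul_apply, orbitDeriv, char]
  ring

/-- Three factors move with `t`. The noise costs `(1 + ‖ξ‖)²`, the character `‖x‖ ‖ξ‖`, and the Weyl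
matrix element a Lipschitz constant of linear growth times a displacement `O(t ‖ξ‖)`. This fixes the
powers on the right. -/
theorem HasData.exists_orbitElem_lipschitz (h : HasData S noise Z α A ν)
    (φ ψ : 𝓢(Config n, ℂ)) :
    ∃ C, 0 ≤ C ∧ ∀ t ∈ Icc (0 : ℝ) 1, ∀ (x : CPhase s) (ξ : Phase n s),
      ‖orbitElem S noise x (toH φ) (toH ψ) t ξ - orbitElem S noise x (toH φ) (toH ψ) 0 ξ‖
        ≤ t * (C * (1 + ‖x‖) * (1 + ‖ξ‖) ^ 2) := by
  obtain ⟨N, hN0, hN⟩ := h.exists_noise_bound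
  obtain ⟨K, hK0, hK⟩ := h.exists_flow_bound
  obtain ⟨L, hL0, hL⟩ := inner_weyl_lipschitz φ ψ
  obtain ⟨M, hM⟩ : ∃ M, M = ‖toH ψ‖ * ‖toH φ‖ := ⟨_, rfl⟩
  have hM0 : 0 ≤ M := hM ▸ by positivity
  refine ⟨N * M + K * M + L * (1 + K) * K, by positivity, fun t ht x ξ => ?_⟩
  obtain ⟨g, hg⟩ : ∃ g : QPhase n → ℂ, ∀ z, g z = inner ℂ (toH ψ) (weyl z (toH φ)) :=
    ⟨_, fun _ => rfl⟩
  have hgM : ∀ z, ‖g z‖ ≤ M := fun z => by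
    rw [hg, hM, ← norm_weyl_apply z (toH φ)]
    exact norm_inner_le_norm _ _
  have hx := norm_nonneg x
  have hξ := norm_nonneg ξ
  obtain ⟨hS1, hS2⟩ := hK t ht ξ
  have e1 : ‖(noise t ξ - 1) * char (cPart (S t ξ)) x * g (qPart (S t ξ))‖
      ≤ t * (N * (1 + ‖ξ‖) ^ 2) * M := by
    rw [norm_mul, norm_mul, norm_char, mul_one]
    exact mul_le_mul (hN t ht ξ) (hgM _) (norm_nonneg _) (by have := ht.1; positivity)
  have e2 : ‖(char (cPart (S t ξ)) x - char (cPart ξ) x) * g (qPart (S t ξ))‖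
      ≤ K * ‖ξ‖ * t * ‖x‖ * M := by
    rw [norm_mul]
    refine mul_le_mul ((norm_char_sub_le _ _ _).trans ?_) (hgM _) (norm_nonneg _)
      (by have := ht.1; positivity)
    gcongr
    exact (norm_cPart_le (S t ξ - ξ)).trans hS1
  have e3 : ‖char (cPart ξ) x * (g (qPart (S t ξ)) - g (qPart ξ))‖
      ≤ L * (1 + (1 + K) * ‖ξ‖) * (K * ‖ξ‖ * t) := by
    rw [norm_mul, norm_char, one_mul, hg, hg]
    refine (hL ((1 + K) * ‖ξ‖) _ _ ((norm_qPart_le _).trans hS2)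
      ((norm_qPart_le _).trans (by nlinarith))).trans ?_
    gcongr
    exact (norm_qPart_le (S t ξ - ξ)).trans hS1
  have heq : orbitElem S noise x (toH φ) (toH ψ) t ξ - orbitElem S noise x (toH φ) (toH ψ) 0 ξ
      = (noise t ξ - 1) * char (cPart (S t ξ)) x * g (qPart (S t ξ))
        + (char (cPart (S t ξ)) x - char (cPart ξ) x) * g (qPart (S t ξ))
        + char (cPart ξ) x * (g (qPart (S t ξ)) - g (qPart ξ)) := by
    rw [h.orbitElem_zero, orbitElem, hg, hg]
    ring
  rw [heq]
  refine (norm_add₃_le.trans (add_le_add_three e1 e2 e3)).trans ?_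
  have f1 : t * (N * (1 + ‖ξ‖) ^ 2) * M ≤ t * (N * M * (1 + ‖x‖) * (1 + ‖ξ‖) ^ 2) := by
    have : t * (N * (1 + ‖ξ‖) ^ 2) * M * 1 ≤ t * (N * (1 + ‖ξ‖) ^ 2) * M * (1 + ‖x‖) := by
      have := ht.1
      gcongr
      linarith
    linarith
  have f2 : K * ‖ξ‖ * t * ‖x‖ * M ≤ t * (K * M * (1 + ‖x‖) * (1 + ‖ξ‖) ^ 2) := by
    have h5 : ‖ξ‖ * ‖x‖ ≤ (1 + ‖ξ‖) ^ 2 * (1 + ‖x‖) := by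
      gcongr
      · nlinarith
      · linarith
    have h6 : K * t * M * (‖ξ‖ * ‖x‖) ≤ K * t * M * ((1 + ‖ξ‖) ^ 2 * (1 + ‖x‖)) := by
      have := ht.1
      gcongr
    linarith
  have f3 : L * (1 + (1 + K) * ‖ξ‖) * (K * ‖ξ‖ * t)
      ≤ t * (L * (1 + K) * K * (1 + ‖x‖) * (1 + ‖ξ‖) ^ 2) := by
    have h5 : (1 + (1 + K) * ‖ξ‖) * ‖ξ‖ ≤ (1 + K) * (1 + ‖ξ‖) ^ 2 * (1 + ‖x‖) := by
      have h7 : (1 + (1 + K) * ‖ξ‖) * ‖ξ‖ ≤ (1 + K) * (1 + ‖ξ‖) ^ 2 := by nlinarith [mul_nonneg hK0 hξ]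
      refine h7.trans (le_mul_of_one_le_right (by positivity) (by linarith))
    have h6 : L * K * t * ((1 + (1 + K) * ‖ξ‖) * ‖ξ‖)
        ≤ L * K * t * ((1 + K) * (1 + ‖ξ‖) ^ 2 * (1 + ‖x‖)) := by
      have := ht.1
      gcongr
    linarith
  linarith

end Data

end

section

/-! ### Action of the generator on Weyl operators -/

theorem sigma_mul_sigma : sigma n * sigma n = -1 := by
  rw [sigma, Matrix.fromBlocks_multiply, ← Matrix.fromBlocks_one, Matrix.fromBlocks_neg]
  simp

theorem sigmaVec_ofLp (ζ : QPhase n) : ⇑(sigmaVec ζ) = sigma n *ᵥ ⇑ζ := rfl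

theorem sigma_mulVec_sigmaVec (ζ : QPhase n) : sigma n *ᵥ ⇑(sigmaVec ζ) = -⇑ζ := by
  rw [sigmaVec_ofLp, Matrix.mulVec_mulVec, sigma_mul_sigma, Matrix.neg_mulVec, Matrix.one_mulVec]

theorem sum_vecMul_sigma_mul (u : Fin n ⊕ Fin n → ℝ) (ζ : QPhase n) :
    ∑ i, (u ᵥ* sigma n) i * sigmaVec ζ i = -∑ i, u i * ζ i := by
  have h : (u ᵥ* sigma n) ⬝ᵥ ⇑(sigmaVec ζ) = -(u ⬝ᵥ ⇑ζ) := by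
    rw [← Matrix.dotProduct_mulVec, sigma_mulVec_sigmaVec, dotProduct_neg]
  exact h

section Algebra

variable {𝓐 ι : Type*} [Ring 𝓐] [Algebra ℂ 𝓐] {r : ι → 𝓐} {W : 𝓐} {c : ι → ℂ}

theorem mul_mul_of_comm_rel (h : ∀ i, r i * W = W * r i - c i • W) (i j : ι) :
    r i * r j * W = W * (r i * r j) - c i • (W * r j) - c j • (W * r i) + (c i * c j) • W := by
  rw [mul_assoc, h j, mul_sub, mul_smul_comm, ← mul_assoc, h i, sub_mul, smul_mul_assoc, mul_assoc,
    smul_sub, smul_smul, mul_comm (c j)]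
  abel

variable [Fintype ι]

/-- Moving `W` to the left cancels all terms with two factors `r`. Only the antisymmetric part of
`G` survives in the terms `W r_i`, and the scalar term is the quadratic form of `G` at `c`. -/
theorem sum_dissipator_of_comm_rel (h : ∀ i, r i * W = W * r i - c i • W) (G : ι → ι → ℂ) :
    ∑ i, ∑ j, G i j • (r i * W * r j - (1 / 2 : ℂ) • (r i * r j * W + W * (r i * r j)))
      = ∑ i, (1 / 2 * ∑ j, (G i j - G j i) * c j) • (W * r i)
        - (1 / 2 * ∑ i, ∑ j, G i j * c i * c j) • W := by
  have h1 : ∀ i j, G i j • (r i * W * r j - (1 / 2 : ℂ) • (r i * r j * W + W * (r i * r j)))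
      = (1 / 2 * (G i j * c j)) • (W * r i) - (1 / 2 * (G i j * c i)) • (W * r j)
        - (1 / 2 * (G i j * c i * c j)) • W := by
    intro i j
    rw [mul_mul_of_comm_rel h, h i, sub_mul, smul_mul_assoc, mul_assoc W]
    module
  simp only [h1, Finset.sum_sub_distrib]
  congr 1
  · rw [Finset.sum_comm (f := fun i j => (1 / 2 * (G i j * c i)) • (W * r j)),
      ← Finset.sum_sub_distrib]
    refine Finset.sum_congr rfl fun i _ => ?_
    rw [← Finset.sum_smul, ← Finset.sum_smul, ← sub_smul, ← Finset.sum_sub_distrib, Finset.mul_sum]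
    congr 1
    refine Finset.sum_congr rfl fun j _ => ?_
    ring
  · simp only [Finset.mul_sum, Finset.sum_smul]

/-- Here the symmetric part of `D` survives in the terms `W r_i`, complementing the dissipator. -/
theorem sum_quadratic_comm_of_comm_rel (h : ∀ i, r i * W = W * r i - c i • W) (D : ι → ι → ℂ) :
    (∑ i, ∑ j, D i j • (r i * r j)) * W - W * ∑ i, ∑ j, D i j • (r i * r j)
      = -∑ i, (∑ j, (D i j + D j i) * c j) • (W * r i) + (∑ i, ∑ j, D i j * c i * c j) • W := by
  have h1 : ∀ i j, D i j • (r i * r j) * W - W * D i j • (r i * r j)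
      = (D i j * c i * c j) • W - ((D i j * c j) • (W * r i) + (D i j * c i) • (W * r j)) := by
    intro i j
    rw [smul_mul_assoc, mul_smul_comm, mul_mul_of_comm_rel h]
    module
  simp only [Finset.sum_mul, Finset.mul_sum, ← Finset.sum_sub_distrib]
  simp only [h1, Finset.sum_sub_distrib, Finset.sum_add_distrib, Finset.sum_smul]
  rw [Finset.sum_comm (f := fun i j => (D i j * c i) • (W * r j))]
  simp only [add_mul, add_smul, Finset.sum_add_distrib]
  abel

end Algebra

theorem comm_linR_weylS (u : Fin n ⊕ Fin n → ℝ) (ζ : QPhase n) :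
    comm (linR (u ᵥ* sigma n)) (weylS ζ) = ((∑ i, u i * ζ i : ℝ) : ℂ) • weylS ζ := by
  have h := sum_vecMul_sigma_mul u ζ
  have h1 : ∑ i, u i * ζ i = -∑ i, (u ᵥ* sigma n) i * sigmaVec ζ i := by rw [h, neg_neg]
  rw [comm, linR, Finset.sum_mul, Finset.mul_sum, ← Finset.sum_sub_distrib, h1]
  push_cast
  rw [neg_smul, Finset.sum_smul, ← Finset.sum_neg_distrib]
  refine Finset.sum_congr rfl fun i _ => ?_
  rw [smul_mul_assoc, mul_smul_comm, R_mul_weylS]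
  module

theorem comm_Hx_weylS (Z : PhaseMat n s) (x : CPhase s) (ζ : QPhase n) :
    comm (Hx Z x) (weylS ζ)
      = ((∑ j, x j * ∑ i, Z (Sum.inr j) (Sum.inl i) * ζ i : ℝ) : ℂ) • weylS ζ := by
  rw [Hx, ← Matrix.vecMul_vecMul, comm_linR_weylS]
  congr 2
  have h : (⇑x ᵥ* Z.toBlocks₂₁) ⬝ᵥ ⇑ζ = ⇑x ⬝ᵥ (Z.toBlocks₂₁ *ᵥ ⇑ζ) :=
    (Matrix.dotProduct_mulVec _ _ _).symm
  exact h

theorem acomm_R_weylS (ζ : QPhase n) (i) :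
    acomm (R i) (weylS ζ) = (2 : ℂ) • (weylS ζ * R i) - (sigmaVec ζ i : ℂ) • weylS ζ := by
  rw [acomm, R_mul_weylS]
  module

theorem comm_R_weylS (ζ : QPhase n) (i) :
    comm (R i) (weylS ζ) = -(sigmaVec ζ i : ℂ) • weylS ζ := by
  rw [comm, R_mul_weylS]
  module

/-- `L_q¹` on a Weyl operator. -/
theorem Lq1_weylS (Z : PhaseMat n s) (α : Phase n s) {A : PhaseMat n s} (hA : Aᵀ = A)
    (ζ : QPhase n) :
    Lq1 Z α A (weylS ζ)
      = (I * ((∑ i, α (Sum.inl i) * ζ i : ℝ) : ℂ)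
          - 1 / 2 * ((∑ i, ∑ j, ζ i * A (Sum.inl i) (Sum.inl j) * ζ j : ℝ) : ℂ)) • weylS ζ
        + (I / 2) • ∑ i, ((∑ j, Z (Sum.inl i) (Sum.inl j) * ζ j : ℝ) : ℂ)
            • acomm (R i) (weylS ζ) := by
  -- In terms of `X = Z¹¹ σ`, the antisymmetric part of `G` is `(i/2)(Xᵀ - X)` and `D = (X + Xᵀ)/2`.
  -- Since `σ² = -1`, one has `X (σζ) = -Z¹¹ ζ`.
  obtain ⟨X, hX⟩ : ∃ X, X = Z.toBlocks₁₁ * sigma n := ⟨_, rfl⟩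
  obtain ⟨A', hA'⟩ : ∃ A', A' = (sigma n)ᵀ * A.toBlocks₁₁ * sigma n := ⟨_, rfl⟩
  have hX' : (sigma n)ᵀ * (Z.toBlocks₁₁)ᵀ = Xᵀ := by rw [hX, Matrix.transpose_mul]
  have hAs : (A.toBlocks₁₁)ᵀ = A.toBlocks₁₁ := by
    ext i j
    exact congrFun (congrFun hA (Sum.inl i)) (Sum.inl j)
  have hA's : A'ᵀ = A' := by
    rw [hA', Matrix.transpose_mul, Matrix.transpose_mul, Matrix.transpose_transpose, hAs,
      Matrix.mul_assoc]
  have hG : ∀ i j, matG Z A i j = (A' i j : ℂ) + I / 2 * ((X j i : ℂ) - (X i j : ℂ)) := by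
    intro i j
    rw [matG, hX', ← hX, ← hA']
    simp [cplx]
  have hD : ∀ i j, (matD Z i j : ℂ) = 1 / 2 * ((X i j : ℂ) + (X j i : ℂ)) := by
    intro i j
    rw [matD, hX', ← hX]
    simp
  have hXc : ∀ i, ∑ j, X i j * sigmaVec ζ j = -∑ j, Z (Sum.inl i) (Sum.inl j) * ζ j := by
    intro i
    have h : X *ᵥ ⇑(sigmaVec ζ) = -(Z.toBlocks₁₁ *ᵥ ⇑ζ) := by
      rw [hX, ← Matrix.mulVec_mulVec, sigma_mulVec_sigmaVec, Matrix.mulVec_neg]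
    exact congrFun h i
  have hXcC : ∀ i, ∑ j, (X i j : ℂ) * (sigmaVec ζ j : ℂ)
      = -((∑ j, Z (Sum.inl i) (Sum.inl j) * ζ j : ℝ) : ℂ) := by
    intro i
    rw [← ofReal_neg, ← hXc]
    push_cast
    rfl
  have hAc : ∑ i, ∑ j, A' i j * sigmaVec ζ i * sigmaVec ζ j
      = ∑ i, ∑ j, ζ i * A (Sum.inl i) (Sum.inl j) * ζ j := by
    have h : ⇑(sigmaVec ζ) ⬝ᵥ (A' *ᵥ ⇑(sigmaVec ζ)) = ⇑ζ ⬝ᵥ (A.toBlocks₁₁ *ᵥ ⇑ζ) := by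
      rw [hA', ← Matrix.mulVec_mulVec, sigma_mulVec_sigmaVec, ← Matrix.mulVec_mulVec,
        Matrix.dotProduct_mulVec, Matrix.vecMul_transpose, sigma_mulVec_sigmaVec,
        Matrix.mulVec_neg, neg_dotProduct_neg]
    simp only [dotProduct, Matrix.mulVec, Finset.mul_sum] at h
    refine Eq.trans ?_ (h.trans ?_)
    · refine Finset.sum_congr rfl fun i _ => Finset.sum_congr rfl fun j _ => ?_
      ring
    · refine Finset.sum_congr rfl fun i _ => Finset.sum_congr rfl fun j _ => ?_
      rw [mul_assoc]
      rfl
  have h1 := sum_dissipator_of_comm_rel (R_mul_weylS ζ) (matG Z A)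
  have h2 := sum_quadratic_comm_of_comm_rel (R_mul_weylS ζ) (fun i j => (matD Z i j : ℂ))
  have e1 : ∀ i, ∑ j, (matG Z A i j - matG Z A j i) * (sigmaVec ζ j : ℂ)
      = I * ∑ j, ((X j i : ℂ) - (X i j : ℂ)) * (sigmaVec ζ j : ℂ) := by
    intro i
    rw [Finset.mul_sum]
    refine Finset.sum_congr rfl fun j _ => ?_
    have : A' j i = A' i j := congrFun (congrFun hA's i) j
    rw [hG, hG, this]
    ring
  have e2 : ∀ i, ∑ j, ((matD Z i j : ℂ) + (matD Z j i : ℂ)) * (sigmaVec ζ j : ℂ)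
      = ∑ j, ((X j i : ℂ) + (X i j : ℂ)) * (sigmaVec ζ j : ℂ) := by
    intro i
    refine Finset.sum_congr rfl fun j _ => ?_
    rw [hD, hD]
    ring
  have e3 : ∑ i, ∑ j, matG Z A i j * (sigmaVec ζ i : ℂ) * (sigmaVec ζ j : ℂ)
      = ((∑ i, ∑ j, ζ i * A (Sum.inl i) (Sum.inl j) * ζ j : ℝ) : ℂ) := by
    have h0 : ∑ i, ∑ j, (X j i : ℂ) * (sigmaVec ζ i : ℂ) * (sigmaVec ζ j : ℂ)
        = ∑ i, ∑ j, (X i j : ℂ) * (sigmaVec ζ i : ℂ) * (sigmaVec ζ j : ℂ) := by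
      rw [Finset.sum_comm]
      refine Finset.sum_congr rfl fun i _ => Finset.sum_congr rfl fun j _ => ?_
      ring
    rw [← hAc]
    push_cast
    simp only [hG, add_mul, mul_sub, sub_mul, Finset.sum_add_distrib, Finset.sum_sub_distrib,
      mul_assoc, ← Finset.mul_sum] at h0 ⊢
    rw [h0, sub_self, add_zero]
  have e4 : ∑ i, ∑ j, (matD Z i j : ℂ) * (sigmaVec ζ i : ℂ) * (sigmaVec ζ j : ℂ)
      = -∑ i, (sigmaVec ζ i : ℂ) * ((∑ j, Z (Sum.inl i) (Sum.inl j) * ζ j : ℝ) : ℂ) := by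
    have h0 : ∑ i, ∑ j, (X j i : ℂ) * (sigmaVec ζ i : ℂ) * (sigmaVec ζ j : ℂ)
        = ∑ i, ∑ j, (X i j : ℂ) * (sigmaVec ζ i : ℂ) * (sigmaVec ζ j : ℂ) := by
      rw [Finset.sum_comm]
      refine Finset.sum_congr rfl fun i _ => Finset.sum_congr rfl fun j _ => ?_
      ring
    have h3 : ∑ i, ∑ j, (X i j : ℂ) * (sigmaVec ζ i : ℂ) * (sigmaVec ζ j : ℂ)
        = -∑ i, (sigmaVec ζ i : ℂ) * ((∑ j, Z (Sum.inl i) (Sum.inl j) * ζ j : ℝ) : ℂ) := by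
      rw [← Finset.sum_neg_distrib]
      refine Finset.sum_congr rfl fun i _ => ?_
      rw [← mul_neg, ← hXcC, Finset.mul_sum]
      refine Finset.sum_congr rfl fun j _ => ?_
      ring
    have h4 : ∑ i, ∑ j, (matD Z i j : ℂ) * (sigmaVec ζ i : ℂ) * (sigmaVec ζ j : ℂ)
        = 1 / 2 * (∑ i, ∑ j, (X i j : ℂ) * (sigmaVec ζ i : ℂ) * (sigmaVec ζ j : ℂ)
          + ∑ i, ∑ j, (X j i : ℂ) * (sigmaVec ζ i : ℂ) * (sigmaVec ζ j : ℂ)) := by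
      rw [← Finset.sum_add_distrib, Finset.mul_sum]
      refine Finset.sum_congr rfl fun i _ => ?_
      rw [← Finset.sum_add_distrib, Finset.mul_sum]
      refine Finset.sum_congr rfl fun j _ => ?_
      rw [hD]
      ring
    rw [h4, h0, h3]
    ring
  have h3 : comm (Hq Z α) (weylS ζ) = comm (linR (⇑(qPart α) ᵥ* sigma n)) (weylS ζ)
      + (1 / 2 : ℂ) • ((∑ i, ∑ j, (matD Z i j : ℂ) • (R i * R j)) * weylS ζ
        - weylS ζ * ∑ i, ∑ j, (matD Z i j : ℂ) • (R i * R j)) := by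
    simp only [comm, Hq, add_mul, mul_add, smul_mul_assoc, mul_smul_comm, smul_sub]
    abel
  rw [Lq1, h3, comm_linR_weylS, h2]
  simp only [acomm] at h1 ⊢
  rw [h1, e3, e4]
  -- The dissipator contributes `(i/2)(Xᵀ - X)`, rewritten as `(i/2)(Xᵀ + X) - iX`. The first part
  -- cancels against the Hamiltonian term and the second gives `i Z¹¹ ζ`, so no transpose of `Z¹¹`
  -- remains.
  have e5 : ∀ i, (1 / 2 * ∑ j, (matG Z A i j - matG Z A j i) * (sigmaVec ζ j : ℂ))
      = I / 2 * ∑ j, ((X j i : ℂ) + (X i j : ℂ)) * (sigmaVec ζ j : ℂ)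
        + I * ((∑ j, Z (Sum.inl i) (Sum.inl j) * ζ j : ℝ) : ℂ) := by
    intro i
    have := hXcC i
    rw [e1]
    simp only [sub_mul, add_mul, Finset.sum_sub_distrib, Finset.sum_add_distrib]
    rw [this]
    ring
  have e6 : ∀ i, R i * weylS ζ + weylS ζ * R i
      = (2 : ℂ) • (weylS ζ * R i) - (sigmaVec ζ i : ℂ) • weylS ζ := acomm_R_weylS ζ
  simp only [e5, e2, e6, add_smul, Finset.sum_add_distrib, smul_sub, Finset.sum_sub_distrib]
  have e7 : (I / 2) • ∑ i, ((∑ j, Z (Sum.inl i) (Sum.inl j) * ζ j : ℝ) : ℂ)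
      • (2 : ℂ) • (weylS ζ * R i)
      = ∑ i, (I * ((∑ j, Z (Sum.inl i) (Sum.inl j) * ζ j : ℝ) : ℂ)) • (weylS ζ * R i) := by
    rw [Finset.smul_sum]
    refine Finset.sum_congr rfl fun i _ => ?_
    module
  have e8 : (I / 2) • ∑ i, ((∑ j, Z (Sum.inl i) (Sum.inl j) * ζ j : ℝ) : ℂ)
      • (sigmaVec ζ i : ℂ) • weylS ζ
      = (I / 2 * ∑ i, (sigmaVec ζ i : ℂ) * ((∑ j, Z (Sum.inl i) (Sum.inl j) * ζ j : ℝ) : ℂ))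
        • weylS ζ := by
    rw [mul_smul, Finset.sum_smul]
    congr 1
    refine Finset.sum_congr rfl fun i _ => ?_
    module
  have e9 : ∑ i, (I / 2 * ∑ j, ((X j i : ℂ) + (X i j : ℂ)) * (sigmaVec ζ j : ℂ)) • (weylS ζ * R i)
      = (I / 2) • ∑ i, (∑ j, ((X j i : ℂ) + (X i j : ℂ)) * (sigmaVec ζ j : ℂ))
        • (weylS ζ * R i) := by
    rw [Finset.smul_sum]
    refine Finset.sum_congr rfl fun i _ => ?_
    rw [smul_smul]
  rw [e7, e8, e9]
  simp only [qPart_apply]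
  module

end

/-! ### Second order Taylor estimates -/

/-- The mean value inequality on the closed ball of radius `‖y - x‖`: a derivative of first order at
`x` gives an increment of second order. -/
theorem norm_sub_le_of_fderiv_le {E : Type*} [NormedAddCommGroup E] [NormedSpace ℝ E] {h : E → ℂ}
    (hd : Differentiable ℝ h) {x : E} {C δ : ℝ}
    (hb : ∀ y, ‖y - x‖ < δ → ‖fderiv ℝ h y‖ ≤ C * ‖y - x‖) {y : E} (hy : ‖y - x‖ < δ)
    (hC : 0 ≤ C) : ‖h y - h x‖ ≤ C * ‖y - x‖ ^ 2 := by
  have h1 := (convex_closedBall x ‖y - x‖).norm_image_sub_le_of_norm_fderiv_le (𝕜 := ℝ) (f := h)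
    (C := C * ‖y - x‖) (x := x) (y := y) (fun z _ => hd z) (fun z hz => ?_)
    (Metric.mem_closedBall_self (norm_nonneg _)) (by simp [dist_eq_norm])
  · rwa [mul_assoc, ← pow_two] at h1
  · rw [Metric.mem_closedBall, dist_eq_norm] at hz
    exact (hb z (hz.trans_lt hy)).trans (mul_le_mul_of_nonneg_left hz hC)

/-- Differentiability of the derivative at the single point `x` suffices, at the price of constants
`C` and `δ` that depend on `x`. -/
theorem exists_taylor_bound {E : Type*} [NormedAddCommGroup E] [NormedSpace ℝ E] {f : E → ℂ}
    (hf1 : Differentiable ℝ f) (hf2 : Differentiable ℝ (fderiv ℝ f)) (x : E) :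
    ∃ C δ : ℝ, 0 ≤ C ∧ 0 < δ ∧ δ ≤ 1 ∧
      ∀ y, ‖y‖ < δ → ‖f (x + y) - f x - fderiv ℝ f x y‖ ≤ C * ‖y‖ ^ 2 := by
  obtain ⟨C, hC0, hC⟩ := (hf2 x).hasFDerivAt.isBigO_sub.exists_pos
  obtain ⟨δ, hδ0, hδ⟩ := Metric.eventually_nhds_iff.1 hC.bound
  refine ⟨C, min δ 1, hC0.le, lt_min hδ0 one_pos, min_le_right _ _, fun y hy => ?_⟩
  have hd : ∀ z, HasFDerivAt (fun z => f z - fderiv ℝ f x z) (fderiv ℝ f z - fderiv ℝ f x) z :=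
    fun z => (hf1 z).hasFDerivAt.sub (fderiv ℝ f x).hasFDerivAt
  have h1 := norm_sub_le_of_fderiv_le (h := fun z => f z - fderiv ℝ f x z) (x := x) (C := C) (δ := δ)
    (fun z => (hd z).differentiableAt) (fun z hz => ?_) (y := x + y)
    (by rw [add_sub_cancel_left]; exact hy.trans_le (min_le_left _ _)) hC0.le
  · rw [add_sub_cancel_left, map_add] at h1
    convert h1 using 2
    ring
  · rw [(hd z).fderiv]
    exact hδ (by rwa [dist_eq_norm])

theorem sum_mul_pd (f : CPhase s → ℂ) (x y : CPhase s) :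
    ∑ j, (y j : ℂ) * pd j f x = fderiv ℝ f x y := by
  have h : y = ∑ j, y j • EuclideanSpace.single j (1 : ℝ) := by
    ext i
    simp [Finset.sum_apply, Pi.single_apply]
  conv_rhs => rw [h, map_sum]
  simp [pd]

/-! ### Integrability of the jump terms -/

theorem continuous_qPhase (ζ : QPhase n) :
    Continuous fun η : Phase n s => cexp (I * ((∑ i, qPart η i * ζ i : ℝ) : ℂ)) := by
  simp only [qPart_apply]
  fun_prop

/-- A quadratic bound near the origin and a global bound together give integrability against a Lévy
measure: for `‖η‖ ≥ δ` the weight is at least `δ²`, so the global bound costs a factor `B / δ²`. -/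
theorem norm_le_of_lt_of_ge {w δ B C : ℝ} {η : Phase n s} (hδ : 0 < δ) (hδ1 : δ ≤ 1) (hB : 0 ≤ B)
    (hC : 0 ≤ C) (h1 : ‖η‖ < δ → w ≤ C * ‖η‖ ^ 2) (h2 : w ≤ B) :
    w ≤ (C + B / δ ^ 2) * levyWeight η := by
  rcases lt_or_ge ‖η‖ δ with h | h
  · rw [levyWeight_of_lt (h.trans_le hδ1)]
    refine (h1 h).trans ?_
    gcongr
    have : 0 ≤ B / δ ^ 2 := by positivity
    linarith
  · have h3 : δ ^ 2 ≤ levyWeight η := le_min (pow_le_one₀ hδ.le hδ1) (by gcongr)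
    calc w ≤ B / δ ^ 2 * δ ^ 2 := by
          rw [div_mul_cancel₀ _ (by positivity)]
          exact h2
      _ ≤ B / δ ^ 2 * levyWeight η := by gcongr
      _ ≤ _ := by
        have := levyWeight_nonneg η
        gcongr
        linarith

theorem integrable_Kcl2Integrand {ν : Measure (Phase n s)} (hν : IsLevyMeasure ν)
    {f : CPhase s → ℂ} {M : ℝ} (hM : ∀ x, ‖f x‖ ≤ M) (hf1 : Differentiable ℝ f)
    (hf2 : Differentiable ℝ (fderiv ℝ f)) (x : CPhase s) :
    Integrable (Kcl2Integrand (n := n) f x) ν := by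
  obtain ⟨C, δ, hC, hδ, hδ1, hb⟩ := exists_taylor_bound hf1 hf2 x
  have hM0 : 0 ≤ M := (norm_nonneg _).trans (hM 0)
  refine ((integrable_levyWeight hν).const_mul
    (C + (2 * M + ‖fderiv ℝ f x‖) / δ ^ 2)).mono' ?_ (Eventually.of_forall fun η => ?_)
  · have h1 : Continuous fun η : Phase n s => f (x + cPart η) - f x :=
      (hf1.continuous.comp (continuous_const.add continuous_cPart)).sub continuous_const
    have h2 : Measurable fun η : Phase n s => (cut η : ℂ) :=
      Complex.measurable_ofReal.comp measurable_cut
    have h3 : Continuous fun η : Phase n s => ∑ j, (cPart η j : ℂ) * pd j f x := by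
      simp only [cPart_apply]
      fun_prop
    exact (h1.measurable.sub (h2.mul h3.measurable)).aestronglyMeasurable
  · rw [Kcl2Integrand, sum_mul_pd]
    refine norm_le_of_lt_of_ge hδ hδ1 (by positivity) hC (fun h => ?_) ?_
    · rw [cut_eq_one (h.trans_le hδ1), ofReal_one, one_mul]
      have h1 := norm_cPart_le η
      refine (hb _ (h1.trans_lt h)).trans ?_
      gcongr
    · have h1 : ‖(cut η : ℂ) * fderiv ℝ f x (cPart η)‖ ≤ ‖fderiv ℝ f x‖ := by
        by_cases h : ‖η‖ < 1
        · rw [cut_eq_one h, ofReal_one, one_mul]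
          refine ((fderiv ℝ f x).le_opNorm _).trans ?_
          exact mul_le_of_le_one_right (norm_nonneg _) ((norm_cPart_le η).trans h.le)
        · rw [cut_eq_zero h, ofReal_zero, zero_mul, norm_zero]
          positivity
      have h2 := norm_sub_le (f (x + cPart η) - f x) ((cut η : ℂ) * fderiv ℝ f x (cPart η))
      have h3 := norm_sub_le (f (x + cPart η)) (f x)
      linarith [hM x, hM (x + cPart η)]

theorem sum_qPart_mul_eq (η : Phase n s) (ζ : QPhase n) :
    ∑ i, qPart η i * ζ i = ∑ i, η i * freq (s := s) ζ 0 i := by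
  simp [Fintype.sum_sum_type, qPart_apply]

/-- Both factors are of first order at the origin, so their product is of second order and needs no
compensator. -/
theorem integrable_jumpProduct {ν : Measure (Phase n s)} (hν : IsLevyMeasure ν)
    {f : CPhase s → ℂ} {M : ℝ} (hM : ∀ x, ‖f x‖ ≤ M) (hf1 : Differentiable ℝ f)
    (hf2 : Differentiable ℝ (fderiv ℝ f)) (x : CPhase s) (ζ : QPhase n) :
    Integrable (fun η => (f (x + cPart η) - f x)
      * (cexp (I * ((∑ i, qPart η i * ζ i : ℝ) : ℂ)) - 1)) ν := by
  obtain ⟨C, δ, hC, hδ, hδ1, hb⟩ := exists_taylor_bound hf1 hf2 x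
  have hM0 : 0 ≤ M := (norm_nonneg _).trans (hM 0)
  refine ((integrable_levyWeight hν).const_mul
    ((C + ‖fderiv ℝ f x‖) * ‖ζ‖ + (2 * M * 2) / δ ^ 2)).mono' ?_ (Eventually.of_forall fun η => ?_)
  · have h1 : Continuous fun η : Phase n s => f (x + cPart η) - f x :=
      (hf1.continuous.comp (continuous_const.add continuous_cPart)).sub continuous_const
    exact (h1.mul ((continuous_qPhase ζ).sub continuous_const)).aestronglyMeasurable
  · have h3 := norm_sub_le (f (x + cPart η)) (f x)
    rw [norm_mul]
    refine norm_le_of_lt_of_ge hδ hδ1 (by positivity) (by positivity) (fun h => ?_) ?_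
    · have h1 := norm_cPart_le η
      have h2 := norm_exp_I_sub_one_le (∑ i, qPart η i * ζ i)
      have h4 := (h2.trans (abs_sum_mul_le _ _)).trans
        (mul_le_mul_of_nonneg_right (norm_qPart_le η) (norm_nonneg ζ))
      have h5 : ‖f (x + cPart η) - f x‖ ≤ (C + ‖fderiv ℝ f x‖) * ‖η‖ := by
        have h6 := hb _ (h1.trans_lt h)
        have h7 := (fderiv ℝ f x).le_opNorm (cPart η)
        have h8 := norm_le_norm_add_norm_sub' (f (x + cPart η) - f x) (fderiv ℝ f x (cPart η))
        have h9 : ‖cPart η‖ ^ 2 ≤ ‖η‖ := by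
          nlinarith [norm_nonneg (cPart η)]
        have h10 : C * ‖cPart η‖ ^ 2 ≤ C * ‖η‖ := by gcongr
        have h11 : ‖fderiv ℝ f x‖ * ‖cPart η‖ ≤ ‖fderiv ℝ f x‖ * ‖η‖ := by gcongr
        linarith
      calc _ ≤ (C + ‖fderiv ℝ f x‖) * ‖η‖ * (‖η‖ * ‖ζ‖) :=
            mul_le_mul h5 h4 (norm_nonneg _) (by positivity)
        _ = _ := by ring
    · have h2 := norm_exp_I_sub_one_le_two (∑ i, qPart η i * ζ i)
      refine mul_le_mul (h3.trans ?_) h2 (norm_nonneg _) (by positivity)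
      linarith [hM x, hM (x + cPart η)]

theorem conj_weyl_sub_apply (ζ : QPhase n) (η : QPhase n) (φ : Hilb n) :
    conj η (weyl ζ) φ - weyl ζ φ = (cexp (I * ((∑ i, η i * ζ i : ℝ) : ℂ)) - 1) • weyl ζ φ := by
  rw [conj_weyl, smul_apply, sub_smul, one_smul]

theorem Lq2Integrand_weyl (ζ : QPhase n) (φ : 𝓢(Config n, ℂ)) (η : Phase n s) :
    Lq2Integrand (weyl ζ) (weylS ζ) φ η = levyKer (freq ζ 0) η • weyl ζ (toH φ) := by
  rw [Lq2Integrand, conj_weyl_sub_apply, comm_linR_weylS, LinearMap.smul_apply, toH_smul,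
    weylS_restricts, levyKer, sum_qPart_mul_eq]
  module

theorem integrable_Lq2Integrand_weyl {ν : Measure (Phase n s)} (hν : IsLevyMeasure ν)
    (ζ : QPhase n) (φ : 𝓢(Config n, ℂ)) :
    Integrable (Lq2Integrand (weyl ζ) (weylS ζ) φ) ν :=
  ((integrable_levyKer hν (freq ζ 0)).smul_const (weyl ζ (toH φ))).congr
    (Eventually.of_forall fun η => (Lq2Integrand_weyl ζ φ η).symm)

theorem Kint4Integrand_weyl (ζ : QPhase n) (f : CPhase s → ℂ) (x : CPhase s) (φ : 𝓢(Config n, ℂ))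
    (η : Phase n s) :
    Kint4Integrand (weyl ζ) f x φ η = ((f (x + cPart η) - f x)
      * (cexp (I * ((∑ i, qPart η i * ζ i : ℝ) : ℂ)) - 1)) • weyl ζ (toH φ) := by
  rw [Kint4Integrand, conj_weyl_sub_apply, smul_smul]

theorem integrable_Kint4Integrand_weyl {ν : Measure (Phase n s)} (hν : IsLevyMeasure ν)
    {f : CPhase s → ℂ} {M : ℝ} (hM : ∀ x, ‖f x‖ ≤ M) (hf1 : Differentiable ℝ f)
    (hf2 : Differentiable ℝ (fderiv ℝ f)) (x : CPhase s) (ζ : QPhase n) (φ : 𝓢(Config n, ℂ)) :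
    Integrable (Kint4Integrand (weyl ζ) f x φ) ν :=
  ((integrable_jumpProduct hν hM hf1 hf2 x ζ).smul_const (weyl ζ (toH φ))).congr
    (Eventually.of_forall fun η => (Kint4Integrand_weyl ζ f x φ η).symm)

/-! ### The generator on a Weyl operator tensored with a function -/

/-- The integrand of the total jump term of the generator on `weyl ζ ⊗ f`. -/
def jumpKer (f : CPhase s → ℂ) (x : CPhase s) (ζ : QPhase n) (η : Phase n s) : ℂ :=
  f (x + cPart η) * cexp (I * ((∑ i, qPart η i * ζ i : ℝ) : ℂ)) - f x
    - (cut η : ℂ) * (I * ((∑ i, qPart η i * ζ i : ℝ) : ℂ) * f x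
      + ∑ j, (cPart η j : ℂ) * pd j f x)

/-- The quantum, classical and interaction jumps are the three pieces of one compensated increment
of `(y, ζ') ↦ f(x + y) exp(i ζ'·ζ)`. -/
theorem jumpKer_eq (f : CPhase s → ℂ) (x : CPhase s) (ζ : QPhase n) :
    jumpKer f x ζ = fun η => f x * levyKer (freq ζ 0) η + Kcl2Integrand f x η
      + (f (x + cPart η) - f x) * (cexp (I * ((∑ i, qPart η i * ζ i : ℝ) : ℂ)) - 1) := by
  funext η
  rw [jumpKer, Kcl2Integrand, levyKer, sum_qPart_mul_eq]
  ring

theorem integrable_jumpKer {ν : Measure (Phase n s)} (hν : IsLevyMeasure ν)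
    {f : CPhase s → ℂ} {M : ℝ} (hM : ∀ x, ‖f x‖ ≤ M) (hf1 : Differentiable ℝ f)
    (hf2 : Differentiable ℝ (fderiv ℝ f)) (x : CPhase s) (ζ : QPhase n) :
    Integrable (jumpKer f x ζ) ν := by
  rw [jumpKer_eq]
  exact (((integrable_levyKer hν (freq ζ 0)).const_mul _).add
    (integrable_Kcl2Integrand hν hM hf1 hf2 x)).add (integrable_jumpProduct hν hM hf1 hf2 x ζ)

theorem integral_jumpKer {ν : Measure (Phase n s)} (hν : IsLevyMeasure ν)
    {f : CPhase s → ℂ} {M : ℝ} (hM : ∀ x, ‖f x‖ ≤ M) (hf1 : Differentiable ℝ f)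
    (hf2 : Differentiable ℝ (fderiv ℝ f)) (x : CPhase s) (ζ : QPhase n) :
    ∫ η, jumpKer f x ζ η ∂ν = f x * ∫ η, levyKer (freq ζ 0) η ∂ν + Kcl2 ν f x
      + ∫ η, (f (x + cPart η) - f x)
        * (cexp (I * ((∑ i, qPart η i * ζ i : ℝ) : ℂ)) - 1) ∂ν := by
  rw [jumpKer_eq, integral_add, integral_add, integral_const_mul, Kcl2]
  · exact (integrable_levyKer hν (freq ζ 0)).const_mul _
  · exact integrable_Kcl2Integrand hν hM hf1 hf2 x
  · exact ((integrable_levyKer hν (freq ζ 0)).const_mul _).add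
      (integrable_Kcl2Integrand hν hM hf1 hf2 x)
  · exact integrable_jumpProduct hν hM hf1 hf2 x ζ

/-- The matrix element of the generator on `weyl ζ ⊗ f` in terms of the second order jet
`(u, p, q)` of `f` at `x` and the jump term `J`. -/
def jetForm (Z : PhaseMat n s) (α : Phase n s) (A : PhaseMat n s) (x : CPhase s) (ζ : QPhase n)
    (φ ψ : 𝓢(Config n, ℂ)) (u : ℂ) (p : Fin s → ℂ) (q : Fin s → Fin s → ℂ) (J : ℂ) : ℂ :=
  ((I * ((∑ i, α (Sum.inl i) * ζ i : ℝ) : ℂ)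
        - 1 / 2 * ((∑ i, ∑ j, ζ i * A (Sum.inl i) (Sum.inl j) * ζ j : ℝ) : ℂ)
        + I * ((∑ j, x j * ∑ i, Z (Sum.inr j) (Sum.inl i) * ζ i : ℝ) : ℂ)) * u
      + ∑ j, (α (Sum.inr j) : ℂ) * p j
      + ∑ i, ∑ j, (x i : ℂ) * (Z (Sum.inr i) (Sum.inr j) : ℂ) * p j
      + 1 / 2 * ∑ i, ∑ j, (A (Sum.inr i) (Sum.inr j) : ℂ) * q i j
      + I * ∑ i, ∑ j, (ζ i : ℂ) * (A (Sum.inl i) (Sum.inr j) : ℂ) * p j + J)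
      * inner ℂ (toH ψ) (weyl ζ (toH φ))
    + ∑ i, ((I / 2) * ((∑ j, Z (Sum.inl i) (Sum.inl j) * ζ j : ℝ) : ℂ) * u
        + 1 / 2 * ∑ j, (Z (Sum.inl i) (Sum.inr j) : ℂ) * p j)
      * inner ℂ (toH ψ) (toH (acomm (R i) (weylS ζ) φ))

theorem matE_im (Z A : PhaseMat n s) (i j) :
    (matE Z A i j).im = -(1 / 2) * Z (Sum.inl i) (Sum.inr j) := by
  have h : (matE Z A i j).im = -(2⁻¹ * Z (Sum.inl i) (Sum.inr j)) := by
    simp [matE, cplx, Matrix.toBlocks₁₂]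
  rw [h]
  ring

theorem matE_re (Z A : PhaseMat n s) (i j) :
    (matE Z A i j).re = ((sigma n)ᵀ * A.toBlocks₁₂) i j := by
  simp [matE, cplx]

theorem toH_Lq1_weyl (Z : PhaseMat n s) (α : Phase n s) {A : PhaseMat n s} (hA : Aᵀ = A)
    (ζ : QPhase n) (φ : 𝓢(Config n, ℂ)) :
    toH (Lq1 Z α A (weylS ζ) φ)
      = (I * ((∑ i, α (Sum.inl i) * ζ i : ℝ) : ℂ)
          - 1 / 2 * ((∑ i, ∑ j, ζ i * A (Sum.inl i) (Sum.inl j) * ζ j : ℝ) : ℂ))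
          • weyl ζ (toH φ)
        + (I / 2) • ∑ i, ((∑ j, Z (Sum.inl i) (Sum.inl j) * ζ j : ℝ) : ℂ)
            • toH (acomm (R i) (weylS ζ) φ) := by
  rw [Lq1_weylS Z α hA]
  simp only [LinearMap.add_apply, LinearMap.smul_apply, LinearMap.sum_apply, toH_add, toH_smul,
    toH_sum, weylS_restricts ζ φ]

theorem toH_Kint1_weyl (Z : PhaseMat n s) (ζ : QPhase n) (f : CPhase s → ℂ) (x : CPhase s)
    (φ : 𝓢(Config n, ℂ)) :
    toH (Kint1 Z (weylS ζ) f x φ)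
      = (f x * I * ((∑ j, x j * ∑ i, Z (Sum.inr j) (Sum.inl i) * ζ i : ℝ) : ℂ))
        • weyl ζ (toH φ) := by
  rw [Kint1, comm_Hx_weylS]
  simp only [LinearMap.smul_apply, toH_smul, weylS_restricts ζ φ, smul_smul, mul_assoc]

theorem toH_Kint2_weyl (Z A : PhaseMat n s) (ζ : QPhase n) (f : CPhase s → ℂ) (x : CPhase s)
    (φ : 𝓢(Config n, ℂ)) :
    toH (Kint2 Z A (weylS ζ) f x φ)
      = ∑ i, (1 / 2 * ∑ j, (Z (Sum.inl i) (Sum.inr j) : ℂ) * pd j f x)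
        • toH (acomm (R i) (weylS ζ) φ) := by
  rw [Kint2]
  simp only [LinearMap.neg_apply, LinearMap.smul_apply, LinearMap.sum_apply, toH_smul, toH_sum,
    toH_neg, ← Finset.sum_neg_distrib]
  refine Finset.sum_congr rfl fun i _ => ?_
  rw [Finset.mul_sum, Finset.sum_smul]
  refine Finset.sum_congr rfl fun j _ => ?_
  rw [matE_im]
  push_cast
  module

theorem sum_sigma_transpose_mul (A : PhaseMat n s) (ζ : QPhase n) (j : Fin s) :
    ∑ i, ((sigma n)ᵀ * A.toBlocks₁₂) i j * sigmaVec ζ i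
      = -∑ i, ζ i * A (Sum.inl i) (Sum.inr j) := by
  have h : ((sigma n)ᵀ * A.toBlocks₁₂)ᵀ *ᵥ ⇑(sigmaVec ζ) = -((A.toBlocks₁₂)ᵀ *ᵥ ⇑ζ) := by
    rw [Matrix.transpose_mul, Matrix.transpose_transpose, ← Matrix.mulVec_mulVec,
      sigma_mulVec_sigmaVec, Matrix.mulVec_neg]
  refine (congrFun h j).trans ?_
  simp only [Pi.neg_apply, Matrix.mulVec, dotProduct, mul_comm (ζ _)]
  rfl

theorem toH_Kint3_weyl (Z A : PhaseMat n s) (ζ : QPhase n) (f : CPhase s → ℂ) (x : CPhase s)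
    (φ : 𝓢(Config n, ℂ)) :
    toH (Kint3 Z A (weylS ζ) f x φ)
      = (I * ∑ i, ∑ j, (ζ i : ℂ) * (A (Sum.inl i) (Sum.inr j) : ℂ) * pd j f x)
        • weyl ζ (toH φ) := by
  have h0 : ∀ j, ∑ i, (ζ i : ℂ) * (A (Sum.inl i) (Sum.inr j) : ℂ) * pd j f x
      = ∑ i, -((((sigma n)ᵀ * A.toBlocks₁₂) i j : ℂ) * (sigmaVec ζ i : ℂ) * pd j f x) := by
    intro j
    rw [Finset.sum_neg_distrib, ← Finset.sum_mul, ← Finset.sum_mul, ← neg_mul]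
    congr 1
    have := congrArg (fun r : ℝ => -(r : ℂ)) (sum_sigma_transpose_mul A ζ j)
    push_cast at this
    rw [this, neg_neg]
  rw [Kint3, Finset.sum_comm (f := fun i j => (ζ i : ℂ) * (A (Sum.inl i) (Sum.inr j) : ℂ)
    * pd j f x)]
  simp only [h0]
  rw [Finset.sum_comm]
  simp only [LinearMap.smul_apply, LinearMap.sum_apply, toH_smul, toH_sum, comm_R_weylS,
    weylS_restricts ζ φ, matE_re, smul_smul, mul_smul I, Finset.sum_smul]
  congr 1
  refine Finset.sum_congr rfl fun i _ => Finset.sum_congr rfl fun j _ => ?_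
  module

/-- After this reduction the generator sees `f` only through its second order jet at `x` and one
scalar jump integral, linearly. Both the Fourier representation and the comparison with Schwartz
approximants rely on that. -/
theorem inner_genK_weyl (Z : PhaseMat n s) (α : Phase n s) {A : PhaseMat n s} (hA : Aᵀ = A)
    {ν : Measure (Phase n s)} (hν : IsLevyMeasure ν) (ζ : QPhase n)
    {f : CPhase s → ℂ} {M : ℝ} (hM : ∀ x, ‖f x‖ ≤ M) (hf1 : Differentiable ℝ f)
    (hf2 : Differentiable ℝ (fderiv ℝ f)) (x : CPhase s) (φ ψ : 𝓢(Config n, ℂ)) :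
    (inner ℂ (toH ψ) (genK Z α A ν (weyl ζ) (weylS ζ) f x φ) : ℂ)
      = jetForm Z α A x ζ φ ψ (f x) (fun j => pd j f x) (fun i j => pd i (pd j f) x)
        (∫ η, jumpKer f x ζ η ∂ν) := by
  have h2 : Lq2 ν (weyl ζ) (weylS ζ) φ = (∫ η, levyKer (freq ζ 0) η ∂ν) • weyl ζ (toH φ) := by
    rw [Lq2, ← integral_smul_const]
    exact integral_congr_ae (Eventually.of_forall fun η => Lq2Integrand_weyl ζ φ η)
  have h4 : Kint4 ν (weyl ζ) f x φ = (∫ η, (f (x + cPart η) - f x)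
      * (cexp (I * ((∑ i, qPart η i * ζ i : ℝ) : ℂ)) - 1) ∂ν) • weyl ζ (toH φ) := by
    rw [Kint4, ← integral_smul_const]
    exact integral_congr_ae (Eventually.of_forall fun η => Kint4Integrand_weyl ζ f x φ η)
  rw [genK, h2, h4, toH_Lq1_weyl Z α hA, toH_Kint1_weyl, toH_Kint2_weyl, toH_Kint3_weyl,
    integral_jumpKer hν hM hf1 hf2]
  simp only [inner_add_right, inner_smul_right, inner_sum]
  rw [jetForm, Kcl1]
  simp only [add_mul _ _ (inner ℂ (toH ψ) (toH (acomm (R _) (weylS ζ) φ))), Finset.sum_add_distrib]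
  have h5 : ∑ i, I / 2 * ((∑ j, Z (Sum.inl i) (Sum.inl j) * ζ j : ℝ) : ℂ) * f x
      * inner ℂ (toH ψ) (toH (acomm (R i) (weylS ζ) φ))
      = f x * (I / 2 * ∑ i, ((∑ j, Z (Sum.inl i) (Sum.inl j) * ζ j : ℝ) : ℂ)
        * inner ℂ (toH ψ) (toH (acomm (R i) (weylS ζ) φ))) := by
    rw [Finset.mul_sum, Finset.mul_sum]
    refine Finset.sum_congr rfl fun i _ => ?_
    ring
  rw [h5]
  simp only [cPart_apply, matC, Matrix.toBlocks₂₂, Matrix.of_apply]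
  ring

/-! ### Fourier representation of the generator -/

/-- The jet form as a continuous linear functional. -/
def jetFormL (Z : PhaseMat n s) (α : Phase n s) (A : PhaseMat n s) (x : CPhase s) (ζ : QPhase n)
    (φ ψ : 𝓢(Config n, ℂ)) : (ℂ × (Fin s → ℂ) × (Fin s → Fin s → ℂ) × ℂ) →L[ℂ] ℂ :=
  LinearMap.toContinuousLinearMap
    { toFun := fun v => jetForm Z α A x ζ φ ψ v.1 v.2.1 v.2.2.1 v.2.2.2
      map_add' := fun v w => by
        simp only [jetForm, Prod.fst_add, Prod.snd_add, Pi.add_apply, mul_add,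
          Finset.sum_add_distrib, add_mul]
        ring
      map_smul' := fun c v => by
        simp only [jetForm, Prod.smul_fst, Prod.smul_snd, Pi.smul_apply, smul_eq_mul,
          RingHom.id_apply, mul_left_comm _ c, ← Finset.mul_sum, ← mul_add, mul_assoc] }

theorem jetFormL_apply (Z : PhaseMat n s) (α : Phase n s) (A : PhaseMat n s) (x : CPhase s)
    (ζ : QPhase n) (φ ψ : 𝓢(Config n, ℂ)) (v : ℂ × (Fin s → ℂ) × (Fin s → Fin s → ℂ) × ℂ) :
    jetFormL Z α A x ζ φ ψ v = jetForm Z α A x ζ φ ψ v.1 v.2.1 v.2.2.1 v.2.2.2 := rfl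

/-- A linear functional on a finite dimensional space commutes with integration, so superpositions
may be inserted into all coefficients simultaneously. -/
theorem jetForm_integral (Z : PhaseMat n s) (α : Phase n s) (A : PhaseMat n s) (x : CPhase s)
    (ζ : QPhase n) (φ ψ : 𝓢(Config n, ℂ)) {X : Type*} [MeasurableSpace X] {μ : Measure X}
    {u : X → ℂ} {p : X → Fin s → ℂ} {q : X → Fin s → Fin s → ℂ} {J : X → ℂ} (hu : Integrable u μ)
    (hp : ∀ j, Integrable (fun k => p k j) μ) (hq : ∀ i j, Integrable (fun k => q k i j) μ)
    (hJ : Integrable J μ) :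
    ∫ k, jetForm Z α A x ζ φ ψ (u k) (p k) (q k) (J k) ∂μ
      = jetForm Z α A x ζ φ ψ (∫ k, u k ∂μ) (fun j => ∫ k, p k j ∂μ)
        (fun i j => ∫ k, q k i j ∂μ) (∫ k, J k ∂μ) := by
  have hp' : Integrable p μ := Integrable.of_eval hp
  have hq' : Integrable q μ := Integrable.of_eval fun i => Integrable.of_eval (hq i)
  have hF := hu.prodMk (hp'.prodMk (hq'.prodMk hJ))
  have h1 := (jetFormL Z α A x ζ φ ψ).integral_comp_comm hF
  rw [integral_pair hu (hp'.prodMk (hq'.prodMk hJ)), integral_pair hp' (hq'.prodMk hJ),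
    integral_pair hq' hJ] at h1
  simp only [jetFormL_apply] at h1
  rw [h1]
  congr 1
  · funext j
    exact eval_integral hp j
  · funext i j
    rw [eval_integral (fun i => Integrable.of_eval (hq i)) i, eval_integral (hq i) j]

theorem norm_freq_le (ζ : QPhase n) (k : CPhase s) :
    ‖freq ζ k‖ ≤ ‖ζ‖ + 2 * Real.pi * ‖k‖ := by
  have hc : cPart (freq ζ k) = (2 * Real.pi) • k := by
    ext j
    simp [cPart_apply]
  have h := norm_sq_eq_qPart_cPart (freq ζ k)
  rw [qPart_freq, hc, norm_smul, Real.norm_of_nonneg (by positivity)] at h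
  have h2 : 0 ≤ 2 * Real.pi * ‖k‖ := by positivity
  refine abs_le_of_sq_le_sq' ?_ (by positivity) |>.2
  nlinarith [mul_nonneg (norm_nonneg ζ) h2]

theorem integrable_fourier_mul_pow (g : 𝓢(CPhase s, ℂ)) (ζ : QPhase n) :
    Integrable fun k => ‖𝓕 g k‖ * (1 + ‖freq ζ k‖) ^ 2 := by
  have h1 : Integrable fun k => (‖k‖ ^ 0 * ‖𝓕 g k‖ + ‖k‖ ^ 2 * ‖𝓕 g k‖) :=
    ((𝓕 g).integrable_pow_mul volume 0).add ((𝓕 g).integrable_pow_mul volume 2)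
  refine (h1.const_mul (2 * (1 + ‖ζ‖ + 2 * Real.pi) ^ 2)).mono' ?_ (Eventually.of_forall fun k => ?_)
  · exact ((𝓕 g).continuous.norm.mul ((continuous_const.add
      (continuous_freq ζ).norm).pow 2)).aestronglyMeasurable
  · rw [norm_mul, norm_norm, Real.norm_of_nonneg (by positivity)]
    have h2 : 1 + ‖freq ζ k‖ ≤ (1 + ‖ζ‖ + 2 * Real.pi) * (1 + ‖k‖) := by
      have := norm_freq_le ζ k
      have h3 := mul_nonneg (norm_nonneg ζ) (norm_nonneg k)
      nlinarith [norm_nonneg k, Real.pi_pos]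
    have h4 : (1 + ‖freq ζ k‖) ^ 2 ≤ ((1 + ‖ζ‖ + 2 * Real.pi) * (1 + ‖k‖)) ^ 2 := by gcongr
    have h5 : (1 + ‖k‖) ^ 2 ≤ 2 * (1 + ‖k‖ ^ 2) := by nlinarith [sq_nonneg (1 - ‖k‖)]
    have h6 : (1 + ‖freq ζ k‖) ^ 2 ≤ (1 + ‖ζ‖ + 2 * Real.pi) ^ 2 * (2 * (1 + ‖k‖ ^ 2)) := by
      rw [mul_pow] at h4
      exact h4.trans (by gcongr)
    calc _ ≤ ‖𝓕 g k‖ * ((1 + ‖ζ‖ + 2 * Real.pi) ^ 2 * (2 * (1 + ‖k‖ ^ 2))) := by gcongr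
      _ = _ := by ring

theorem integrable_fourier_mul (g : 𝓢(CPhase s, ℂ)) (ζ : QPhase n) {F : CPhase s → ℂ}
    (hF : Continuous F) {C : ℝ} (hC : ∀ k, ‖F k‖ ≤ C * (1 + ‖freq ζ k‖) ^ 2) :
    Integrable fun k => 𝓕 g k * F k := by
  refine ((integrable_fourier_mul_pow g ζ).const_mul C).mono'
    ((𝓕 g).continuous.mul hF).aestronglyMeasurable (Eventually.of_forall fun k => ?_)
  rw [norm_mul]
  calc _ ≤ ‖𝓕 g k‖ * (C * (1 + ‖freq ζ k‖) ^ 2) := by gcongr; exact hC k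
    _ = _ := by ring

/-- The partial derivative of a Schwartz function, as a Schwartz function. -/
def pdS (j : Fin s) (g : 𝓢(CPhase s, ℂ)) : 𝓢(CPhase s, ℂ) :=
  LineDeriv.lineDerivOp (EuclideanSpace.single j (1 : ℝ)) g

theorem pdS_apply (j : Fin s) (g : 𝓢(CPhase s, ℂ)) (x : CPhase s) : pdS j g x = pd j g x := rfl

theorem fourier_pdS (j : Fin s) (g : 𝓢(CPhase s, ℂ)) (ζ : QPhase n) (k : CPhase s) :
    𝓕 (pdS j g) k = 𝓕 g k * (I * (cPart (freq ζ k) j : ℂ)) := by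
  have h : (fun k : CPhase s => (inner ℝ k (EuclideanSpace.single j (1 : ℝ)) : ℝ)).HasTemperateGrowth :=
    ((innerSL ℝ).flip (EuclideanSpace.single j (1 : ℝ))).hasTemperateGrowth
  rw [pdS, SchwartzMap.fourier_lineDerivOp_eq, smul_apply,
    SchwartzMap.smulLeftCLM_apply_apply h, EuclideanSpace.inner_single_right, cPart_apply, freq_inr]
  simp
  ring

theorem pd_eq_integral (j : Fin s) (g : 𝓢(CPhase s, ℂ)) (ζ : QPhase n) (x : CPhase s) :
    pd j g x
      = ∫ k, 𝓕 g k * (I * (cPart (freq ζ k) j : ℂ) * char (cPart (freq ζ k)) x) := by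
  rw [← pdS_apply, schwartz_eq_integral (pdS j g) ζ x]
  refine integral_congr_ae (Eventually.of_forall fun k => ?_)
  simp only
  rw [fourier_pdS j g ζ, mul_assoc]

theorem pd_pd_eq_integral (i j : Fin s) (g : 𝓢(CPhase s, ℂ)) (ζ : QPhase n) (x : CPhase s) :
    pd i (pd j g) x
      = ∫ k, 𝓕 g k * (-((cPart (freq ζ k) i : ℂ) * (cPart (freq ζ k) j : ℂ))
        * char (cPart (freq ζ k)) x) := by
  have h : pd j g = pdS j g := funext fun x => (pdS_apply j g x).symm
  rw [h, pd_eq_integral i (pdS j g) ζ x]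
  refine integral_congr_ae (Eventually.of_forall fun k => ?_)
  simp only
  rw [fourier_pdS j g ζ]
  linear_combination (𝓕 g k * (cPart (freq ζ k) i : ℂ) * (cPart (freq ζ k) j : ℂ)
    * char (cPart (freq ζ k)) x) * I_sq

theorem char_add (k x y : CPhase s) : char k (x + y) = char k x * char k y := by
  rw [char, char, char, ← Complex.exp_add]
  congr 1
  simp only [PiLp.add_apply, mul_add, Finset.sum_add_distrib]
  push_cast
  ring

theorem integrable_fourier_mul_char (g : 𝓢(CPhase s, ℂ)) (ζ : QPhase n) (x : CPhase s) :
    Integrable fun k => 𝓕 g k * char (cPart (freq ζ k)) x := by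
  have h1 : Continuous fun k : CPhase s => char (cPart (freq ζ k)) x :=
    continuous_char.comp ((continuous_cPart.comp (continuous_freq ζ)).prodMk continuous_const)
  refine integrable_fourier_mul g ζ h1 (C := 1) fun k => ?_
  rw [norm_char, one_mul]
  exact one_le_pow₀ (by linarith [norm_nonneg (freq ζ k)])

theorem norm_cPart_apply_le (ξ : Phase n s) (j) : ‖(cPart ξ j : ℂ)‖ ≤ 1 + ‖ξ‖ := by
  have h := PiLp.norm_apply_le ξ (Sum.inr j)
  rw [Complex.norm_real, cPart_apply]
  linarith

theorem continuous_cPart_freq (ζ : QPhase n) (j : Fin s) :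
    Continuous fun k : CPhase s => (cPart (freq ζ k) j : ℂ) := by
  simp only [cPart_apply, freq_inr]
  fun_prop

theorem continuous_char_freq (ζ : QPhase n) (x : CPhase s) :
    Continuous fun k : CPhase s => char (cPart (freq ζ k)) x :=
  continuous_char.comp ((continuous_cPart.comp (continuous_freq ζ)).prodMk continuous_const)

theorem integrable_fourier_mul_pd (j : Fin s) (g : 𝓢(CPhase s, ℂ)) (ζ : QPhase n)
    (x : CPhase s) : Integrable fun k =>
      𝓕 g k * (I * (cPart (freq ζ k) j : ℂ) * char (cPart (freq ζ k)) x) := by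
  refine integrable_fourier_mul g ζ ((continuous_const.mul (continuous_cPart_freq ζ j)).mul
    (continuous_char_freq ζ x)) (C := 1) fun k => ?_
  rw [norm_mul, norm_char, norm_mul, norm_I, one_mul, one_mul, mul_one]
  have := norm_cPart_apply_le (freq ζ k) j
  nlinarith [norm_nonneg (freq ζ k)]

theorem integrable_fourier_mul_pd_pd (i j : Fin s) (g : 𝓢(CPhase s, ℂ)) (ζ : QPhase n)
    (x : CPhase s) : Integrable fun k =>
      𝓕 g k * (-((cPart (freq ζ k) i : ℂ) * (cPart (freq ζ k) j : ℂ))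
        * char (cPart (freq ζ k)) x) := by
  refine integrable_fourier_mul g ζ (((continuous_cPart_freq ζ i).mul
    (continuous_cPart_freq ζ j)).neg.mul (continuous_char_freq ζ x)) (C := 1) fun k => ?_
  rw [norm_mul, norm_char, norm_neg, norm_mul, one_mul, mul_one, pow_two]
  gcongr <;> exact norm_cPart_apply_le _ _

theorem sum_mul_freq (ζ : QPhase n) (k : CPhase s) (η : Phase n s) :
    ((∑ i, η i * freq ζ k i : ℝ) : ℂ) = ((∑ i, qPart η i * ζ i : ℝ) : ℂ)
      + ((∑ j, cPart η j * cPart (freq ζ k) j : ℝ) : ℂ) := by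
  rw [Fintype.sum_sum_type, ofReal_add]
  rfl

theorem exp_mul_char (ζ : QPhase n) (k : CPhase s) (η : Phase n s) :
    char (cPart (freq ζ k)) (cPart η) * cexp (I * ((∑ i, qPart η i * ζ i : ℝ) : ℂ))
      = cexp (I * ((∑ i, η i * freq ζ k i : ℝ) : ℂ)) := by
  rw [char, ← Complex.exp_add, sum_mul_freq]
  simp only [mul_comm (cPart η _)]
  congr 1
  ring

/-- On a character the jump kernel equals the character at `x` times the Lévy-Khintchine integrand
at the joint frequency `(ζ, 2πk)`: the quantum and classical phases multiply to a single
exponential. A Schwartz function is a superposition of such cases. -/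
theorem jumpKer_eq_integral (g : 𝓢(CPhase s, ℂ)) (x : CPhase s) (ζ : QPhase n) (η : Phase n s) :
    jumpKer g x ζ η
      = ∫ k, 𝓕 g k * (char (cPart (freq ζ k)) x * levyKer (freq ζ k) η) := by
  obtain ⟨e, he⟩ : ∃ e, e = cexp (I * ((∑ i, qPart η i * ζ i : ℝ) : ℂ)) := ⟨_, rfl⟩
  obtain ⟨b, hb⟩ : ∃ b, b = I * ((∑ i, qPart η i * ζ i : ℝ) : ℂ) := ⟨_, rfl⟩
  have hpd := fun j => integrable_fourier_mul_pd j g ζ x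
  have h1 := (integrable_fourier_mul_char g ζ (x + cPart η)).mul_const e
  have h2 := integrable_fourier_mul_char g ζ x
  have h3 : Integrable fun k => ∑ j, (cPart η j : ℂ) *
      (𝓕 g k * (I * (cPart (freq ζ k) j : ℂ) * char (cPart (freq ζ k)) x)) :=
    integrable_finsetSum _ fun j _ => (hpd j).const_mul _
  have h12 : Integrable fun k => 𝓕 g k * char (cPart (freq ζ k)) (x + cPart η) * e
      - 𝓕 g k * char (cPart (freq ζ k)) x := h1.sub h2
  have h23 : Integrable fun k => (cut η : ℂ) * (b * (𝓕 g k * char (cPart (freq ζ k)) x)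
      + ∑ j, (cPart η j : ℂ) *
        (𝓕 g k * (I * (cPart (freq ζ k) j : ℂ) * char (cPart (freq ζ k)) x))) :=
    ((h2.const_mul b).add h3).const_mul _
  rw [jumpKer, ← he, ← hb, schwartz_eq_integral g ζ x, schwartz_eq_integral g ζ (x + cPart η)]
  simp only [pd_eq_integral _ g ζ, ← integral_const_mul]
  rw [← integral_finsetSum _ fun j _ => (hpd j).const_mul _, ← integral_add (h2.const_mul b) h3,
    ← integral_mul_const, ← integral_const_mul, ← integral_sub h1 h2, ← integral_sub h12 h23]
  refine integral_congr_ae (Eventually.of_forall fun k => ?_)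
  have h4 := exp_mul_char ζ k η
  have h5 : ∑ j, (cPart η j : ℂ) *
      (𝓕 g k * (I * (cPart (freq ζ k) j : ℂ) * char (cPart (freq ζ k)) x))
      = 𝓕 g k * char (cPart (freq ζ k)) x * I
        * ((∑ j, cPart η j * cPart (freq ζ k) j : ℝ) : ℂ) := by
    push_cast
    rw [Finset.mul_sum]
    refine Finset.sum_congr rfl fun j _ => ?_
    ring
  simp only
  rw [levyKer, ← h4, h5, sum_mul_freq, char_add, ← he, hb]
  ring

theorem continuous_integral_levyKer {ν : Measure (Phase n s)} (hν : IsLevyMeasure ν) :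
    Continuous fun ξ => ∫ η, levyKer ξ η ∂ν := by
  have h := continuous_levyExponent 0 0 hν
  simp only [funext (levyExponent_eq _ _ _)] at h
  simpa using h

theorem norm_integral_levyKer_le {ν : Measure (Phase n s)} (hν : IsLevyMeasure ν)
    (ξ : Phase n s) :
    ‖∫ η, levyKer ξ η ∂ν‖ ≤ 2 * (∫ η, levyWeight η ∂ν) * (1 + ‖ξ‖) ^ 2 := by
  refine (norm_integral_le_of_norm_le ((integrable_levyWeight hν).const_mul _)
    (Eventually.of_forall (norm_levyKer_le ξ))).trans_eq ?_
  rw [integral_const_mul]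
  ring

theorem integrable_fourier_mul_levy {ν : Measure (Phase n s)} (hν : IsLevyMeasure ν)
    (g : 𝓢(CPhase s, ℂ)) (x : CPhase s) (ζ : QPhase n) :
    Integrable fun k => 𝓕 g k * (char (cPart (freq ζ k)) x * ∫ η, levyKer (freq ζ k) η ∂ν) := by
  refine integrable_fourier_mul g ζ ((continuous_char_freq ζ x).mul
    ((continuous_integral_levyKer hν).comp (continuous_freq ζ)))
    (C := 2 * (∫ η, levyWeight η ∂ν)) fun k => ?_
  rw [norm_mul, norm_char, one_mul]
  exact norm_integral_levyKer_le hν _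

theorem measurable_levyKer_freq (ζ : QPhase n) :
    Measurable fun p : Phase n s × CPhase s => levyKer (freq ζ p.2) p.1 := by
  have h0 : Measurable (freq (s := s) ζ) := (continuous_freq ζ).measurable
  have h1 : Measurable fun p : Phase n s × CPhase s => (freq ζ p.2, p.1) :=
    (h0.comp measurable_snd).prodMk measurable_fst
  have h := measurable_levyKer.comp h1
  simp only [Function.comp_def] at h
  exact h

theorem aestronglyMeasurable_fourier_mul_levyKer (ν : Measure (Phase n s))
    (g : 𝓢(CPhase s, ℂ)) (x : CPhase s) (ζ : QPhase n) :
    AEStronglyMeasurable (fun p : Phase n s × CPhase s =>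
      𝓕 g p.2 * (char (cPart (freq ζ p.2)) x * levyKer (freq ζ p.2) p.1))
      (ν.prod (volume : Measure (CPhase s))) := by
  have h1 : Measurable fun k => 𝓕 g k := (𝓕 g).continuous.measurable
  have h2 : Measurable fun k : CPhase s => char (cPart (freq ζ k)) x :=
    (continuous_char_freq ζ x).measurable
  exact ((h1.comp measurable_snd).mul
    ((h2.comp measurable_snd).mul (measurable_levyKer_freq ζ))).aestronglyMeasurable

theorem integrable_fourier_mul_levyKer {ν : Measure (Phase n s)} (hν : IsLevyMeasure ν)
    (g : 𝓢(CPhase s, ℂ)) (x : CPhase s) (ζ : QPhase n) :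
    Integrable (fun p : Phase n s × CPhase s =>
      𝓕 g p.2 * (char (cPart (freq ζ p.2)) x * levyKer (freq ζ p.2) p.1))
      (ν.prod (volume : Measure (CPhase s))) := by
  have := hν.sigmaFinite
  have h0 : Integrable (fun p : Phase n s × CPhase s =>
      2 * levyWeight p.1 * (‖𝓕 g p.2‖ * (1 + ‖freq ζ p.2‖) ^ 2))
      (ν.prod (volume : Measure (CPhase s))) :=
    ((integrable_levyWeight hν).const_mul 2).mul_prod (integrable_fourier_mul_pow g ζ)
  refine h0.mono' (aestronglyMeasurable_fourier_mul_levyKer ν g x ζ) (Eventually.of_forall ?_)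
  intro p
  rw [norm_mul, norm_mul, norm_char, one_mul]
  refine (mul_le_mul_of_nonneg_left (norm_levyKer_le (freq ζ p.2) p.1)
    (norm_nonneg _)).trans_eq ?_
  ring

/-- Fubini between `ν` and the frequency `k`, which uses that `ν` is σ-finite. -/
theorem integral_jumpKer_eq {ν : Measure (Phase n s)} (hν : IsLevyMeasure ν)
    (g : 𝓢(CPhase s, ℂ)) (x : CPhase s) (ζ : QPhase n) :
    ∫ η, jumpKer g x ζ η ∂ν
      = ∫ k, 𝓕 g k * (char (cPart (freq ζ k)) x * ∫ η, levyKer (freq ζ k) η ∂ν) := by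
  have := hν.sigmaFinite
  simp only [jumpKer_eq_integral]
  refine (integral_integral_swap (integrable_fourier_mul_levyKer hν g x ζ)).trans ?_
  simp only [integral_const_mul]

theorem flowGen_freq_inl (Z : PhaseMat n s) (ζ : QPhase n) (k : CPhase s) (i) :
    qPart (flowGen Z (freq ζ k)) i = ∑ j, Z (Sum.inl i) (Sum.inl j) * ζ j
      + ∑ j, Z (Sum.inl i) (Sum.inr j) * cPart (freq ζ k) j := by
  rw [qPart_apply, flowGen_apply, Fintype.sum_sum_type]
  rfl

theorem flowGen_freq_inr (Z : PhaseMat n s) (ζ : QPhase n) (k : CPhase s) (j) :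
    cPart (flowGen Z (freq ζ k)) j = ∑ i, Z (Sum.inr j) (Sum.inl i) * ζ i
      + ∑ i, Z (Sum.inr j) (Sum.inr i) * cPart (freq ζ k) i := by
  rw [cPart_apply, flowGen_apply, Fintype.sum_sum_type]
  rfl

theorem levyExponent_freq (α : Phase n s) {A : PhaseMat n s} (hA : Aᵀ = A)
    (ν : Measure (Phase n s)) (ζ : QPhase n) (k : CPhase s) :
    levyExponent α A ν (freq ζ k) =
      I * (((∑ i, α (Sum.inl i) * ζ i : ℝ) : ℂ)
          + ((∑ j, α (Sum.inr j) * cPart (freq ζ k) j : ℝ) : ℂ))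
        - 1 / 2 * (((∑ i, ∑ j, ζ i * A (Sum.inl i) (Sum.inl j) * ζ j : ℝ) : ℂ)
          + 2 * ((∑ i, ∑ j, ζ i * A (Sum.inl i) (Sum.inr j) * cPart (freq ζ k) j : ℝ) : ℂ)
          + ((∑ i, ∑ j, cPart (freq ζ k) i * A (Sum.inr i) (Sum.inr j)
            * cPart (freq ζ k) j : ℝ) : ℂ))
        + ∫ η, levyKer (freq ζ k) η ∂ν := by
  have h1 : ∑ i, α i * freq ζ k i
      = ∑ i, α (Sum.inl i) * ζ i + ∑ j, α (Sum.inr j) * cPart (freq ζ k) j := by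
    rw [Fintype.sum_sum_type]
    rfl
  have h3 : ∑ j, ∑ i, cPart (freq ζ k) j * A (Sum.inr j) (Sum.inl i) * ζ i
      = ∑ i, ∑ j, ζ i * A (Sum.inl i) (Sum.inr j) * cPart (freq ζ k) j := by
    rw [Finset.sum_comm]
    refine Finset.sum_congr rfl fun i _ => Finset.sum_congr rfl fun j _ => ?_
    have : A (Sum.inr j) (Sum.inl i) = A (Sum.inl i) (Sum.inr j) :=
      congrFun (congrFun hA (Sum.inl i)) (Sum.inr j)
    rw [this]
    ring
  have h2 : ∑ i, ∑ j, freq ζ k i * A i j * freq ζ k j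
      = ∑ i, ∑ j, ζ i * A (Sum.inl i) (Sum.inl j) * ζ j
        + 2 * ∑ i, ∑ j, ζ i * A (Sum.inl i) (Sum.inr j) * cPart (freq ζ k) j
        + ∑ i, ∑ j, cPart (freq ζ k) i * A (Sum.inr i) (Sum.inr j) * cPart (freq ζ k) j := by
    have h4 : ∀ i, ∑ j, freq ζ k i * A i j * freq ζ k j
        = ∑ j, freq ζ k i * A i (Sum.inl j) * ζ j
          + ∑ j, freq ζ k i * A i (Sum.inr j) * cPart (freq ζ k) j := fun i => by
      rw [Fintype.sum_sum_type]
      rfl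
    simp only [h4, Finset.sum_add_distrib]
    rw [Fintype.sum_sum_type, Fintype.sum_sum_type (f := fun i =>
      ∑ j, freq ζ k i * A i (Sum.inr j) * cPart (freq ζ k) j)]
    have h5 : ∑ j, ∑ i, freq ζ k (Sum.inr j) * A (Sum.inr j) (Sum.inl i) * ζ i
        = ∑ i, ∑ j, ζ i * A (Sum.inl i) (Sum.inr j) * cPart (freq ζ k) j := h3
    rw [h5]
    simp only [freq_inl]
    simp only [cPart_apply]
    ring
  rw [levyExponent_eq, h1, h2]
  push_cast
  ring

/-- The algebraic core, one frequency at a time: on a character `∂_j` is multiplication by `i κ_j`,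
and the terms of the generator reassemble the blocks of `α`, `A` and `Z` in the derivative of the
orbit. The scalar `c` stands for the Fourier coefficient. -/
theorem orbitDeriv_freq (Z : PhaseMat n s) (α : Phase n s) {A : PhaseMat n s} (hA : Aᵀ = A)
    (ν : Measure (Phase n s)) (x : CPhase s) (φ ψ : 𝓢(Config n, ℂ)) (ζ : QPhase n)
    (k : CPhase s) (c : ℂ) :
    jetForm Z α A x ζ φ ψ (c * char (cPart (freq ζ k)) x)
        (fun j => c * (I * (cPart (freq ζ k) j : ℂ) * char (cPart (freq ζ k)) x))
        (fun i j => c * (-((cPart (freq ζ k) i : ℂ) * (cPart (freq ζ k) j : ℂ))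
          * char (cPart (freq ζ k)) x))
        (c * (char (cPart (freq ζ k)) x * ∫ η, levyKer (freq ζ k) η ∂ν))
      = c * orbitDeriv Z α A ν x φ ψ (freq ζ k) := by
  obtain ⟨e, he⟩ : ∃ e, e = char (cPart (freq ζ k)) x := ⟨_, rfl⟩
  obtain ⟨κ, hκ⟩ : ∃ κ, κ = cPart (freq ζ k) := ⟨_, rfl⟩
  have h1 : ∑ j, (α (Sum.inr j) : ℂ) * (c * (I * (κ j : ℂ) * e))
      = c * e * I * ((∑ j, α (Sum.inr j) * κ j : ℝ) : ℂ) := by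
    push_cast
    rw [Finset.mul_sum]
    refine Finset.sum_congr rfl fun j _ => ?_
    ring
  have h2 : ∑ i, ∑ j, (x i : ℂ) * (Z (Sum.inr i) (Sum.inr j) : ℂ) * (c * (I * (κ j : ℂ) * e))
      = c * e * I * ((∑ i, x i * ∑ j, Z (Sum.inr i) (Sum.inr j) * κ j : ℝ) : ℂ) := by
    push_cast
    rw [Finset.mul_sum]
    refine Finset.sum_congr rfl fun i _ => ?_
    rw [Finset.mul_sum, Finset.mul_sum]
    refine Finset.sum_congr rfl fun j _ => ?_
    ring
  have h3 : ∑ i, ∑ j, (A (Sum.inr i) (Sum.inr j) : ℂ) * (c * (-((κ i : ℂ) * (κ j : ℂ)) * e))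
      = -(c * e * ((∑ i, ∑ j, κ i * A (Sum.inr i) (Sum.inr j) * κ j : ℝ) : ℂ)) := by
    push_cast
    rw [Finset.mul_sum, ← Finset.sum_neg_distrib]
    refine Finset.sum_congr rfl fun i _ => ?_
    rw [Finset.mul_sum, ← Finset.sum_neg_distrib]
    refine Finset.sum_congr rfl fun j _ => ?_
    ring
  have h4 : ∑ i, ∑ j, (ζ i : ℂ) * (A (Sum.inl i) (Sum.inr j) : ℂ) * (c * (I * (κ j : ℂ) * e))
      = c * e * I * ((∑ i, ∑ j, ζ i * A (Sum.inl i) (Sum.inr j) * κ j : ℝ) : ℂ) := by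
    push_cast
    rw [Finset.mul_sum]
    refine Finset.sum_congr rfl fun i _ => ?_
    rw [Finset.mul_sum]
    refine Finset.sum_congr rfl fun j _ => ?_
    ring
  have h5 : ∀ i, ∑ j, (Z (Sum.inl i) (Sum.inr j) : ℂ) * (c * (I * (κ j : ℂ) * e))
      = c * e * I * ((∑ j, Z (Sum.inl i) (Sum.inr j) * κ j : ℝ) : ℂ) := by
    intro i
    push_cast
    rw [Finset.mul_sum]
    refine Finset.sum_congr rfl fun j _ => ?_
    ring
  have h6 : ((∑ j, cPart (flowGen Z (freq ζ k)) j * x j : ℝ) : ℂ)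
      = ((∑ j, x j * ∑ i, Z (Sum.inr j) (Sum.inl i) * ζ i : ℝ) : ℂ)
        + ((∑ i, x i * ∑ j, Z (Sum.inr i) (Sum.inr j) * κ j : ℝ) : ℂ) := by
    rw [← ofReal_add, ← Finset.sum_add_distrib]
    congr 1
    refine Finset.sum_congr rfl fun j _ => ?_
    rw [flowGen_freq_inr, hκ]
    ring
  have h7 : c * e * ((I / 2) * ∑ i, (qPart (flowGen Z (freq ζ k)) i : ℂ) *
        inner ℂ (toH ψ) (toH (acomm (R i) (weylS ζ) φ)))
      = ∑ i, ((I / 2) * ((∑ j, Z (Sum.inl i) (Sum.inl j) * ζ j : ℝ) : ℂ) * (c * e)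
        + 1 / 2 * (c * e * I * ((∑ j, Z (Sum.inl i) (Sum.inr j) * κ j : ℝ) : ℂ)))
      * inner ℂ (toH ψ) (toH (acomm (R i) (weylS ζ) φ)) := by
    rw [Finset.mul_sum, Finset.mul_sum]
    refine Finset.sum_congr rfl fun i _ => ?_
    rw [flowGen_freq_inl, hκ, ofReal_add]
    ring
  have h8 := levyExponent_freq α hA ν ζ k
  rw [orbitDeriv, h6, mul_add, mul_add, qPart_freq]
  rw [← hκ] at h8 he ⊢
  rw [← he]
  rw [← mul_assoc c e ((I / 2) * _), h7, h8, jetForm, h1, h2, h3, h4]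
  simp only [h5]
  -- The only product `I * I` left arises in the cross block of `A`, from the explicit `I` in the
  -- commutator term and the one produced by `∂_j`.
  linear_combination (c * e
    * ((∑ i, ∑ j, ζ i * A (Sum.inl i) (Sum.inr j) * κ j : ℝ) : ℂ)
    * inner ℂ (toH ψ) (weyl ζ (toH φ))) * I_sq

/-- On a Schwartz function the generator is the superposition of the derivatives of the orbits. -/
theorem inner_genK_schwartz (Z : PhaseMat n s) (α : Phase n s) {A : PhaseMat n s} (hA : Aᵀ = A)
    {ν : Measure (Phase n s)} (hν : IsLevyMeasure ν) (ζ : QPhase n) (g : 𝓢(CPhase s, ℂ))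
    (x : CPhase s) (φ ψ : 𝓢(Config n, ℂ)) :
    (inner ℂ (toH ψ) (genK Z α A ν (weyl ζ) (weylS ζ) g x φ) : ℂ)
      = ∫ k, 𝓕 g k * orbitDeriv Z α A ν x φ ψ (freq ζ k) := by
  obtain ⟨M, -, hM⟩ := schwartz_bounded g
  have hd1 : Differentiable ℝ g := g.differentiable
  have hd2 : Differentiable ℝ (fderiv ℝ g) :=
    ((g.smooth 2).fderiv_right (m := 1) (by norm_num)).differentiable (by norm_num)
  rw [inner_genK_weyl Z α hA hν ζ hM hd1 hd2, integral_jumpKer_eq hν,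
    schwartz_eq_integral g ζ x]
  simp only [pd_pd_eq_integral _ _ g ζ, pd_eq_integral _ g ζ]
  rw [← jetForm_integral Z α A x ζ φ ψ (integrable_fourier_mul_char g ζ x)
    (fun j => integrable_fourier_mul_pd j g ζ x)
    (fun i j => integrable_fourier_mul_pd_pd i j g ζ x) (integrable_fourier_mul_levy hν g x ζ)]
  refine integral_congr_ae (Eventually.of_forall fun k => ?_)
  exact orbitDeriv_freq Z α hA ν x φ ψ ζ k (𝓕 g k)

section

/-! ### The semigroup on Schwartz functions near time `0` -/

/-- The weighted Fourier norm controlling the orbits of Schwartz functions. -/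
def orbitNorm (ζ : QPhase n) (g : 𝓢(CPhase s, ℂ)) : ℝ :=
  ∫ k, ‖𝓕 g k‖ * (1 + ‖freq ζ k‖) ^ 2

theorem orbitNorm_nonneg (ζ : QPhase n) (g : 𝓢(CPhase s, ℂ)) : 0 ≤ orbitNorm ζ g :=
  integral_nonneg fun k => by positivity

theorem orbitNorm_add_le (ζ : QPhase n) (g h : 𝓢(CPhase s, ℂ)) :
    orbitNorm ζ (g + h) ≤ orbitNorm ζ g + orbitNorm ζ h := by
  rw [orbitNorm, orbitNorm, orbitNorm,
    ← integral_add (integrable_fourier_mul_pow g ζ) (integrable_fourier_mul_pow h ζ)]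
  refine integral_mono (integrable_fourier_mul_pow _ ζ)
    ((integrable_fourier_mul_pow g ζ).add (integrable_fourier_mul_pow h ζ)) fun k => ?_
  simp only
  rw [FourierTransform.fourier_add, ← add_mul]
  gcongr
  exact norm_add_le _ _

theorem orbitNorm_smul (ζ : QPhase n) (c : ℂ) (g : 𝓢(CPhase s, ℂ)) :
    orbitNorm ζ (c • g) = ‖c‖ * orbitNorm ζ g := by
  rw [orbitNorm, orbitNorm, ← integral_const_mul]
  refine integral_congr_ae (Eventually.of_forall fun k => ?_)
  simp only
  rw [FourierTransform.fourier_smul, smul_apply, norm_smul, mul_assoc]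

theorem orbitNorm_sum_le {ι : Type*} (t : Finset ι) (ζ : QPhase n) (g : ι → 𝓢(CPhase s, ℂ)) :
    orbitNorm ζ (∑ i ∈ t, g i) ≤ ∑ i ∈ t, orbitNorm ζ (g i) := by
  classical
  induction t using Finset.induction_on with
  | empty =>
    have h := orbitNorm_smul ζ 0 (0 : 𝓢(CPhase s, ℂ))
    rw [zero_smul, norm_zero, zero_mul] at h
    simp [h]
  | insert i t hi ih =>
    rw [Finset.sum_insert hi, Finset.sum_insert hi]
    exact (orbitNorm_add_le _ _ _).trans (by gcongr)

theorem norm_fourier_translate (g : 𝓢(CPhase s, ℂ)) (a k : CPhase s) :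
    ‖𝓕 (g.compSubConstCLM ℂ a) k‖ = ‖𝓕 g k‖ := by
  have h := VectorFourier.fourierIntegral_comp_add_right Real.fourierChar
    (volume : Measure (CPhase s)) (innerₗ (CPhase s)) g (-a)
  have h1 : (g ∘ fun v => v + -a) = g.compSubConstCLM ℂ a := by
    funext v
    rw [SchwartzMap.compSubConstCLM_apply, Function.comp_apply, sub_eq_add_neg]
  rw [h1] at h
  have h2 := congrFun h k
  rw [SchwartzMap.fourier_coe, SchwartzMap.fourier_coe]
  exact (congrArg norm h2).trans (Circle.norm_smul _ _)

/-- Translations change the Fourier transform by a phase. Profiles translated to different points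
`x` therefore share one Lipschitz constant, up to the factor `1 + ‖x‖`. -/
theorem orbitNorm_translate (ζ : QPhase n) (g : 𝓢(CPhase s, ℂ)) (a : CPhase s) :
    orbitNorm ζ (g.compSubConstCLM ℂ a) = orbitNorm ζ g := by
  simp only [orbitNorm, norm_fourier_translate]

section Semigroup

variable {T : ℝ → (HybridAlg n s →ₗ[ℂ] HybridAlg n s)}
  {S : ℝ → (Phase n s →ₗ[ℝ] Phase n s)} {noise : ℝ → Phase n s → ℂ} {Z : PhaseMat n s}
  {α : Phase n s} {A : PhaseMat n s} {ν : Measure (Phase n s)}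

theorem integrable_fourier_mul_orbitElem (hT : IsQuasiFreeSemigroup T S noise)
    (hdata : HasData S noise Z α A ν) {t : ℝ} (ht : 0 ≤ t) (ζ : QPhase n) (g : 𝓢(CPhase s, ℂ))
    (x : CPhase s) (φ ψ : Hilb n) :
    Integrable fun k => 𝓕 g k * orbitElem S noise x φ ψ t (freq ζ k) := by
  have hS : Continuous (S t) := LinearMap.continuous_of_finiteDimensional _
  have hSf : Continuous fun k : CPhase s => S t (freq ζ k) := hS.comp (continuous_freq ζ)
  have h1 : Continuous fun k : CPhase s => weyl (qPart (S t (freq ζ k))) φ :=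
    (continuous_weyl_apply φ).comp (continuous_qPart.comp hSf)
  have h2 : Continuous fun k : CPhase s => char (cPart (S t (freq ζ k))) x :=
    continuous_char.comp ((continuous_cPart.comp hSf).prodMk continuous_const)
  have h3 : Continuous fun k : CPhase s => noise t (freq ζ k) :=
    (hT.noise_continuous t ht).comp (continuous_freq ζ)
  refine integrable_fourier_mul g ζ (C := ‖ψ‖ * ‖φ‖) ((h3.mul h2).mul (continuous_const.inner h1))
    fun k => ?_
  rw [orbitElem, norm_mul, norm_mul, norm_char, mul_one]
  have h4 : ‖(inner ℂ ψ (weyl (qPart (S t (freq ζ k))) φ) : ℂ)‖ ≤ ‖ψ‖ * ‖φ‖ := by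
    rw [← norm_weyl_apply (qPart (S t (freq ζ k))) φ]
    exact norm_inner_le_norm _ _
  refine (mul_le_mul (hdata.norm_noise_le ht _) h4 (norm_nonneg _) zero_le_one).trans ?_
  rw [one_mul]
  exact le_mul_of_one_le_right (by positivity)
    (one_le_pow₀ (by linarith [norm_nonneg (freq ζ k)]))

theorem exists_version_weyl_schwartz (hT : IsQuasiFreeSemigroup T S noise)
    (hdata : HasData S noise Z α A ν) {t : ℝ} (ht : 0 ≤ t) (ζ : QPhase n) (g : 𝓢(CPhase s, ℂ))
    (hc hb) : ∃ V, IsVersion (T t (tensor (weyl ζ) g hc hb)) V ∧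
      ∀ x φ ψ, inner ℂ ψ (V x φ) = ∫ k, 𝓕 g k * orbitElem S noise x φ ψ t (freq ζ k) :=
  exists_version_schwartz hT ht (hdata.norm_noise_le ht) ζ g hc hb

/-- Differentiation under the Fourier integral: the Lipschitz bound on orbits of characters is
integrable against the Fourier transform of `g`, and the integrated derivative is the generator by
`inner_genK_schwartz`. -/
theorem hasDerivWithinAt_schwartz (hT : IsQuasiFreeSemigroup T S noise)
    (hdata : HasData S noise Z α A ν) (ζ : QPhase n) (g : 𝓢(CPhase s, ℂ)) (x : CPhase s)
    (φ ψ : 𝓢(Config n, ℂ)) :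
    HasDerivWithinAt (fun t => ∫ k, 𝓕 g k * orbitElem S noise x (toH φ) (toH ψ) t (freq ζ k))
      (inner ℂ (toH ψ) (genK Z α A ν (weyl ζ) (weylS ζ) g x φ)) (Ici 0) 0 := by
  obtain ⟨C, hC0, hC⟩ := hdata.exists_orbitElem_lipschitz φ ψ
  have hA : Aᵀ = A := hdata.posSemidef.isHermitian
  rw [inner_genK_schwartz Z α hA hdata.levy]
  refine (hasDerivWithinAt_integral_of_slope_bound
    (F := fun t k => 𝓕 g k * orbitElem S noise x (toH φ) (toH ψ) t (freq ζ k))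
    ((integrable_fourier_mul_pow g ζ).const_mul (C * (1 + ‖x‖)))
    (fun t ht => integrable_fourier_mul_orbitElem hT hdata ht.1 ζ g x _ _)
    (fun t ht => Eventually.of_forall fun k => ?_) (Eventually.of_forall fun k => ?_)).2
  · rw [← mul_sub, norm_mul]
    refine (mul_le_mul_of_nonneg_left (hC t ht x (freq ζ k)) (norm_nonneg _)).trans_eq ?_
    ring
  · exact (hdata.hasDerivWithinAt_orbitElem x φ ψ (freq ζ k)).const_mul _

/-- The orbits of Schwartz functions are Lipschitz at time `0`, uniformly in translations. -/
theorem exists_schwartz_lipschitz (hT : IsQuasiFreeSemigroup T S noise)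
    (hdata : HasData S noise Z α A ν) (φ ψ : 𝓢(Config n, ℂ)) :
    ∃ C, 0 ≤ C ∧ ∀ t ∈ Icc (0 : ℝ) 1, ∀ (ζ : QPhase n) (g : 𝓢(CPhase s, ℂ)) (x : CPhase s),
      ‖(∫ k, 𝓕 g k * orbitElem S noise x (toH φ) (toH ψ) t (freq ζ k))
        - g x * inner ℂ (toH ψ) (weyl ζ (toH φ))‖ ≤ t * (C * (1 + ‖x‖) * orbitNorm ζ g) := by
  obtain ⟨C, hC0, hC⟩ := hdata.exists_orbitElem_lipschitz φ ψ
  refine ⟨C, hC0, fun t ht ζ g x => ?_⟩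
  have h0 : g x * inner ℂ (toH ψ) (weyl ζ (toH φ))
      = ∫ k, 𝓕 g k * orbitElem S noise x (toH φ) (toH ψ) 0 (freq ζ k) := by
    rw [schwartz_eq_integral g ζ, ← integral_mul_const]
    refine integral_congr_ae (Eventually.of_forall fun k => ?_)
    simp only [hdata.orbitElem_zero, qPart_freq]
    ring
  rw [h0, ← integral_sub (integrable_fourier_mul_orbitElem hT hdata ht.1 ζ g x _ _)
    (integrable_fourier_mul_orbitElem hT hdata le_rfl ζ g x _ _)]
  refine (norm_integral_le_of_norm_le
    ((integrable_fourier_mul_pow g ζ).const_mul (t * (C * (1 + ‖x‖))))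
    (Eventually.of_forall fun k => ?_)).trans_eq ?_
  · rw [← mul_sub, norm_mul]
    refine (mul_le_mul_of_nonneg_left (hC t ht x (freq ζ k)) (norm_nonneg _)).trans_eq ?_
    ring
  · rw [integral_const_mul, orbitNorm]
    ring

end Semigroup

end

section

/-! ### Remainder estimates -/

/-- A smooth cutoff function equal to `1` on the unit ball. -/
def unitBump (s : ℕ) : ContDiffBump (0 : CPhase s) := ⟨1, 2, one_pos, one_lt_two⟩

/-- A Schwartz function `v ↦ p(v) χ(v)` for a smooth function `p` and the cutoff `χ`. -/
def bumpMul (p : CPhase s → ℂ) (hp : ContDiff ℝ ((⊤ : ℕ∞) : WithTop ℕ∞) p) : 𝓢(CPhase s, ℂ) :=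
  HasCompactSupport.toSchwartzMap (f := fun v => ((unitBump s v : ℝ) : ℂ) * p v)
    (((unitBump s).hasCompactSupport.comp_left ofReal_zero).mul_right)
    ((ofRealCLM.contDiff.comp (unitBump s).contDiff).mul hp)

theorem bumpMul_apply (p : CPhase s → ℂ) (hp : ContDiff ℝ ((⊤ : ℕ∞) : WithTop ℕ∞) p) (v) :
    bumpMul p hp v = ((unitBump s v : ℝ) : ℂ) * p v := rfl

/-- The Schwartz function `v ↦ (1 - |v|²) χ(v)`. -/
def capS (s : ℕ) : 𝓢(CPhase s, ℂ) :=
  bumpMul (fun v => ((1 - ‖v‖ ^ 2 : ℝ) : ℂ))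
    (ofRealCLM.contDiff.comp (contDiff_const.sub (contDiff_norm_sq ℝ)))

theorem unitBump_zero : unitBump s 0 = 1 :=
  (unitBump s).one_of_mem_closedBall (Metric.mem_closedBall_self zero_le_one)

theorem unitBump_of_norm_le {v : CPhase s} (hv : ‖v‖ ≤ 1) : unitBump s v = 1 :=
  (unitBump s).one_of_mem_closedBall (mem_closedBall_zero_iff.2 hv)

theorem capS_apply (v : CPhase s) :
    capS s v = ((unitBump s v : ℝ) : ℂ) * ((1 - ‖v‖ ^ 2 : ℝ) : ℂ) := rfl

theorem capS_zero : capS s 0 = 1 := by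
  rw [capS_apply, unitBump_zero]
  simp

/-- A smooth weight dominating `min(1, |y - x|²)` and vanishing at `x`. -/
def weight (x y : CPhase s) : ℝ := 1 - unitBump s (y - x) * (1 - ‖y - x‖ ^ 2)

theorem ofReal_weight (x y : CPhase s) :
    (weight x y : ℂ) = 1 - (capS s).compSubConstCLM ℂ x y := by
  rw [SchwartzMap.compSubConstCLM_apply, capS_apply, weight]
  push_cast
  rfl

theorem min_le_weight (x y : CPhase s) : min 1 (‖y - x‖ ^ 2) ≤ weight x y := by
  have h0 : 0 ≤ unitBump s (y - x) := (unitBump s).nonneg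
  have h1 : unitBump s (y - x) ≤ 1 := (unitBump s).le_one
  rw [weight]
  rcases le_total (‖y - x‖ ^ 2) 1 with h | h
  · rw [min_eq_right h]
    nlinarith
  · rw [min_eq_left h]
    nlinarith

theorem continuous_ofReal_weight (x : CPhase s) : Continuous fun y => (weight x y : ℂ) := by
  simp only [ofReal_weight]
  exact continuous_const.sub (SchwartzMap.continuous _)

theorem exists_weight_bound (x : CPhase s) : ∃ C : ℝ, ∀ y, ‖(weight x y : ℂ)‖ ≤ C := by
  obtain ⟨C, -, hC⟩ := schwartz_bounded ((capS s).compSubConstCLM ℂ x)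
  refine ⟨1 + C, fun y => ?_⟩
  rw [ofReal_weight]
  refine (norm_sub_le _ _).trans ?_
  rw [norm_one]
  gcongr
  exact hC y

theorem isVersion_unit : IsVersion (unit n s) fun _ => 1 := by
  have h : IsVersion (unit n s) fun _ => (1 : ℂ) • ContinuousLinearMap.id ℂ (Hilb n) :=
    isVersion_tensor _ _ _ _
  simp only [one_smul] at h
  exact h

/-- The weight does not decay and has no Fourier integral of its own. It is the unit, which `T_t`
fixes, minus a translated Schwartz function. -/
theorem tensor_weight (x : CPhase s) (g : 𝓢(CPhase s, ℂ)) (hg : g = (capS s).compSubConstCLM ℂ x)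
    (hc hb) :
    tensor (1 : Op n) (fun y => (weight x y : ℂ)) (continuous_ofReal_weight x)
      (exists_weight_bound x) = unit n s - tensor (weyl 0) g hc hb := by
  refine (isVersion_tensor _ _ _ _).ext (isVersion_unit.sub (isVersion_tensor _ _ hc hb))
    fun y => ?_
  rw [ofReal_weight, weyl_zero, sub_smul, one_smul, hg]

section Semigroup

variable {T : ℝ → (HybridAlg n s →ₗ[ℂ] HybridAlg n s)}
  {S : ℝ → (Phase n s →ₗ[ℝ] Phase n s)} {noise : ℝ → Phase n s → ℂ} {Z : PhaseMat n s}
  {α : Phase n s} {A : PhaseMat n s} {ν : Measure (Phase n s)}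

theorem isVersion_weight (hT : IsQuasiFreeSemigroup T S noise) {t : ℝ} (ht : 0 ≤ t)
    (x : CPhase s) (g : 𝓢(CPhase s, ℂ)) (hg : g = (capS s).compSubConstCLM ℂ x)
    (hb : ∃ M : ℝ, ∀ x, ‖g x‖ ≤ M) {V : CPhase s → Op n}
    (hV : IsVersion (T t (tensor (weyl 0) g g.continuous hb)) V) :
    IsVersion (T t (tensor 1 (fun y => (weight x y : ℂ)) (continuous_ofReal_weight x)
      (exists_weight_bound x))) fun y => 1 - V y := by
  rw [tensor_weight x g hg g.continuous hb, (T t).map_sub, hT.unital t ht]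
  exact isVersion_unit.sub hV

/-- At time `0` the weight vanishes at `x`, because the cap equals `1` there. The Lipschitz bound
for the cap therefore bounds the evolved weight at `x` itself by a multiple of `t`, uniformly over
all `x` up to `1 + ‖x‖`. -/
theorem exists_weight_version (hT : IsQuasiFreeSemigroup T S noise)
    (hdata : HasData S noise Z α A ν) (φ ψ : 𝓢(Config n, ℂ)) :
    ∃ C, 0 ≤ C ∧ ∀ t ∈ Icc (0 : ℝ) 1, ∀ x : CPhase s, ∃ Vw,
      IsVersion (T t (tensor 1 (fun y => (weight x y : ℂ)) (continuous_ofReal_weight x)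
        (exists_weight_bound x))) Vw ∧
      (inner ℂ (toH φ) (Vw x (toH φ)) : ℂ).re + (inner ℂ (toH ψ) (Vw x (toH ψ)) : ℂ).re
        ≤ t * (C * (1 + ‖x‖)) := by
  obtain ⟨C, hC0, hC⟩ := exists_schwartz_lipschitz hT hdata φ φ
  obtain ⟨D, hD0, hD⟩ := exists_schwartz_lipschitz hT hdata ψ ψ
  have hN := orbitNorm_nonneg (0 : QPhase n) (capS s)
  refine ⟨(C + D) * orbitNorm (0 : QPhase n) (capS s), by positivity, fun t ht x => ?_⟩
  obtain ⟨g, hg⟩ : ∃ g, g = (capS s).compSubConstCLM ℂ x := ⟨_, rfl⟩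
  have hgx : g x = 1 := by rw [hg, SchwartzMap.compSubConstCLM_apply, sub_self, capS_zero]
  have hgN : orbitNorm (0 : QPhase n) g = orbitNorm (0 : QPhase n) (capS s) := by
    rw [hg, orbitNorm_translate]
  obtain ⟨M, -, hM⟩ := schwartz_bounded g
  have hb : ∃ M : ℝ, ∀ x, ‖g x‖ ≤ M := ⟨M, hM⟩
  obtain ⟨V, hV, hVi⟩ := exists_version_weyl_schwartz hT hdata ht.1 0 g g.continuous hb
  refine ⟨fun y => 1 - V y, isVersion_weight hT ht.1 x g hg hb hV, ?_⟩
  have key : ∀ (K : ℝ) (χ : 𝓢(Config n, ℂ)),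
      ‖(∫ k, 𝓕 g k * orbitElem S noise x (toH χ) (toH χ) t (freq 0 k))
        - g x * inner ℂ (toH χ) (weyl 0 (toH χ))‖ ≤ t * (K * (1 + ‖x‖) * orbitNorm (0 : QPhase n) g) →
      (inner ℂ (toH χ) ((1 - V x) (toH χ)) : ℂ).re
        ≤ t * (K * (1 + ‖x‖) * orbitNorm (0 : QPhase n) (capS s)) := by
    intro K χ h
    rw [hgx, one_mul, weyl_zero, ← hVi, hgN, norm_sub_rev] at h
    refine le_trans ?_ ((Complex.re_le_norm _).trans h)
    rw [sub_apply, inner_sub_right]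
  have h2 := key C φ (hC t ht 0 g x)
  have h3 := key D ψ (hD t ht 0 g x)
  linarith

/-- Functions of quadratic order at `x` contribute at most linearly in time at `x`. -/
theorem exists_remainder_bound (hT : IsQuasiFreeSemigroup T S noise)
    (hdata : HasData S noise Z α A ν) (φ ψ : 𝓢(Config n, ℂ)) :
    ∃ C, 0 ≤ C ∧ ∀ t ∈ Icc (0 : ℝ) 1, ∀ (ζ : QPhase n) (x : CPhase s) (M : ℝ), 0 ≤ M →
      ∀ (r : CPhase s → ℂ) (hr hb), (∀ y, ‖r y‖ ≤ M * min 1 (‖y - x‖ ^ 2)) →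
      ∀ V, IsVersion (T t (tensor (weyl ζ) r hr hb)) V →
      ‖(inner ℂ (toH ψ) (V x (toH φ)) : ℂ)‖ ≤ t * (C * (1 + ‖x‖) * M) := by
  obtain ⟨C, hC0, hC⟩ := exists_weight_version hT hdata φ ψ
  refine ⟨C, hC0, fun t ht ζ x M hM r hr hb hrM V hV => ?_⟩
  obtain ⟨Vw, hVw, hVw'⟩ := hC t ht x
  have h := version_inner_le hT.toIsHybridSemigroup ht.1 (adjoint_weyl_comp ζ) r hr hb (weight x)
    (continuous_ofReal_weight x) (exists_weight_bound x) (M := M)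
    (fun y => (hrM y).trans (mul_le_mul_of_nonneg_left (min_le_weight x y) hM)) hV hVw x (toH φ)
    (toH ψ)
  have h2 := mul_le_mul_of_nonneg_left hVw' hM
  have h3 := norm_nonneg (inner ℂ (toH ψ) (V x (toH φ)) : ℂ)
  linarith

end Semigroup

end

/-! ### Approximation by Schwartz functions with a prescribed second order jet -/

/-- The second order Taylor polynomial with value `u`, gradient `D` and Hessian `B` at `0`. -/
def taylorPoly (u : ℂ) (D : CPhase s →L[ℝ] ℂ) (B : CPhase s →L[ℝ] CPhase s →L[ℝ] ℂ)
    (v : CPhase s) : ℂ :=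
  u + D v + (1 / 2 : ℝ) • B v v

theorem contDiff_taylorPoly (u : ℂ) (D : CPhase s →L[ℝ] ℂ)
    (B : CPhase s →L[ℝ] CPhase s →L[ℝ] ℂ) {m : WithTop ℕ∞} : ContDiff ℝ m (taylorPoly u D B) :=
  (contDiff_const.add D.contDiff).add ((B.contDiff.clm_apply contDiff_id).const_smul (1 / 2 : ℝ))

theorem hasFDerivAt_taylorPoly (u : ℂ) (D : CPhase s →L[ℝ] ℂ)
    {B : CPhase s →L[ℝ] CPhase s →L[ℝ] ℂ} (hB : ∀ v w, B v w = B w v) (x y : CPhase s) :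
    HasFDerivAt (fun y => taylorPoly u D B (y - x)) (D + B (y - x)) y := by
  have hs : HasFDerivAt (fun y : CPhase s => y - x) (ContinuousLinearMap.id ℝ _) y :=
    (hasFDerivAt_id y).sub_const x
  have h1 := (D.hasFDerivAt (x := y - x)).comp y hs
  have h2 := (B.hasFDerivAt (x := y - x)).comp y hs
  have h3 := (h2.clm_apply hs).const_smul (1 / 2 : ℝ)
  have h4 := (h1.const_add u).add h3
  refine HasFDerivAt.congr_fderiv h4 ?_
  ext v
  simp only [ContinuousLinearMap.comp_apply, add_apply, smul_apply,
    ContinuousLinearMap.flip_apply, ContinuousLinearMap.id_apply, Function.comp_apply, hB v (y - x)]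
  rw [← two_smul ℝ, smul_smul]
  norm_num

theorem pd_pd_eq {f : CPhase s → ℂ} {x : CPhase s} (hf2 : DifferentiableAt ℝ (fderiv ℝ f) x)
    (i j : Fin s) : pd i (pd j f) x
      = fderiv ℝ (fderiv ℝ f) x (EuclideanSpace.single i 1) (EuclideanSpace.single j 1) := by
  have h := hf2.hasFDerivAt.clm_apply
    (hasFDerivAt_const (EuclideanSpace.single j (1 : ℝ) : CPhase s) x)
  have h2 : HasFDerivAt (pd j f) _ x := h
  rw [pd, h2.fderiv]
  simp

theorem pd_eq_of_eventuallyEq {f g : CPhase s → ℂ} {x : CPhase s} (h : f =ᶠ[𝓝 x] g)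
    (j : Fin s) : pd j f x = pd j g x := by
  rw [pd, pd, h.fderiv_eq]

theorem pd_pd_eq_of_eventuallyEq {f g : CPhase s → ℂ} {x : CPhase s} (h : f =ᶠ[𝓝 x] g)
    (i j : Fin s) : pd i (pd j f) x = pd i (pd j g) x := by
  have h1 : pd j f =ᶠ[𝓝 x] pd j g := by
    filter_upwards [h.fderiv (𝕜 := ℝ)] with y hy
    rw [pd, pd, hy]
  rw [pd, pd, h1.fderiv_eq]

/-- The quadratic Taylor formula for a twice differentiable function, with Peano remainder. -/
theorem exists_peano_bound {f : CPhase s → ℂ} (hf1 : Differentiable ℝ f)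
    (hf2 : Differentiable ℝ (fderiv ℝ f)) (x : CPhase s) {ε : ℝ} (hε : 0 < ε) :
    ∃ δ : ℝ, 0 < δ ∧ δ ≤ 1 ∧ ∀ y, ‖y - x‖ < δ →
      ‖f y - taylorPoly (f x) (fderiv ℝ f x) (fderiv ℝ (fderiv ℝ f) x) (y - x)‖
        ≤ ε * ‖y - x‖ ^ 2 := by
  have hB := second_derivative_symmetric (fun y => (hf1 y).hasFDerivAt) (hf2 x).hasFDerivAt
  have hlo := ((hf2 x).hasFDerivAt.isLittleO.def hε)
  obtain ⟨δ, hδ0, hδ⟩ := Metric.eventually_nhds_iff.1 hlo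
  refine ⟨min δ 1, lt_min hδ0 one_pos, min_le_right _ _, fun y hy => ?_⟩
  have hd : ∀ z, HasFDerivAt (fun z => f z - taylorPoly (f x) (fderiv ℝ f x)
      (fderiv ℝ (fderiv ℝ f) x) (z - x))
      (fderiv ℝ f z - (fderiv ℝ f x + fderiv ℝ (fderiv ℝ f) x (z - x))) z := fun z =>
    (hf1 z).hasFDerivAt.sub (hasFDerivAt_taylorPoly _ _ hB x z)
  have h := norm_sub_le_of_fderiv_le (C := ε) (δ := δ) (x := x) (fun z => (hd z).differentiableAt)
    (fun z hz => ?_) (hy.trans_le (min_le_left _ _)) hε.le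
  · simpa [taylorPoly] using h
  · rw [(hd z).fderiv, ← sub_sub]
    exact hδ (by rwa [dist_eq_norm])

/-- The cut-off second order Taylor polynomial at `x` fixes the jet. The remainder is small relative
to `|y - x|²` near `x` and tends to `0` at infinity, so only its part on an intermediate shell has
to be approximated, and uniform smoothing away from `x` does that without touching the jet. -/
theorem exists_schwartz_approx {f : CPhase s → ℂ} (hf1 : Differentiable ℝ f)
    (hf2 : Differentiable ℝ (fderiv ℝ f)) (h0 : Tendsto f (cocompact _) (𝓝 0)) (x : CPhase s)
    {ε : ℝ} (hε : 0 < ε) :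
    ∃ g : 𝓢(CPhase s, ℂ), g x = f x ∧ (∀ j, pd j g x = pd j f x) ∧
      (∀ i j, pd i (pd j g) x = pd i (pd j f) x) ∧
      ∀ y, ‖f y - g y‖ ≤ ε * min 1 (‖y - x‖ ^ 2) := by
  obtain ⟨δ, hδ0, hδ1, hδ⟩ := exists_peano_bound hf1 hf2 x (half_pos hε)
  have hB := second_derivative_symmetric (fun y => (hf1 y).hasFDerivAt) (hf2 x).hasFDerivAt
  obtain ⟨p, hp⟩ : ∃ p, p = taylorPoly (f x) (fderiv ℝ f x) (fderiv ℝ (fderiv ℝ f) x) := ⟨_, rfl⟩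
  have hpc : ContDiff ℝ ((⊤ : ℕ∞) : WithTop ℕ∞) p := hp ▸ contDiff_taylorPoly _ _ _
  obtain ⟨J, hJ⟩ : ∃ J, J = (bumpMul p hpc).compSubConstCLM ℂ x := ⟨_, rfl⟩
  have hJp : ∀ y, ‖y - x‖ ≤ 1 → J y = p (y - x) := fun y hy => by
    rw [hJ, SchwartzMap.compSubConstCLM_apply, bumpMul_apply, unitBump_of_norm_le hy, ofReal_one,
      one_mul]
  -- The remainder `r` beyond the Taylor part `J`. Half of `ε` is reserved for `r` near `x` and near
  -- infinity, the other half for the smoothing error.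
  obtain ⟨r, hr⟩ : ∃ r : CPhase s → ℂ, ∀ y, r y = f y - J y := ⟨_, fun _ => rfl⟩
  have hrc : Continuous r := by
    rw [funext hr]
    exact hf1.continuous.sub J.continuous
  have hr0 : Tendsto r (cocompact _) (𝓝 0) := by
    rw [funext hr, ← sub_zero (0 : ℂ)]
    exact h0.sub (zero_at_infty J)
  have hrδ : ∀ y, ‖y - x‖ < δ → ‖r y‖ ≤ ε / 2 * ‖y - x‖ ^ 2 := fun y hy => by
    rw [hr, hJp y (hy.le.trans hδ1), hp]
    exact hδ y hy
  -- Decay of `f` and of `J` makes `r` small outside a ball. The threshold `ε / 2 * δ ^ 2` is the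
  -- least value of the admissible bound at distance at least `δ` from `x`.
  obtain ⟨R, hR0, hR⟩ : ∃ R : ℝ, δ ≤ R ∧ ∀ y, R ≤ ‖y - x‖ → ‖r y‖ ≤ ε / 2 * δ ^ 2 := by
    have h1 : ∀ᶠ y in cocompact (CPhase s), ‖r y‖ < ε / 2 * δ ^ 2 := by
      have := hr0.norm
      rw [norm_zero] at this
      exact this.eventually (gt_mem_nhds (by positivity))
    obtain ⟨K, hK, hK'⟩ := mem_cocompact.1 h1
    obtain ⟨R, hR⟩ := hK.isBounded.subset_ball x
    refine ⟨max R δ, le_max_right _ _, fun y hy => le_of_lt (hK' fun hyK => ?_)⟩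
    have := hR hyK
    rw [Metric.mem_ball, dist_eq_norm] at this
    exact absurd ((le_max_left R δ).trans hy) (not_le.2 this)
  -- The bump `χ` will remove the ball of radius `δ / 2` about `x`, and the bump `c` chosen next
  -- removes the outside of the ball of radius `R + 1`. What is left of `r` is continuous with
  -- compact support and vanishes near `x`.
  obtain ⟨χ, hχ⟩ : ∃ χ : ContDiffBump x, χ.rIn = δ / 2 ∧ χ.rOut = δ :=
    ⟨⟨δ / 2, δ, half_pos hδ0, half_lt_self hδ0⟩, rfl, rfl⟩
  obtain ⟨c, hc⟩ : ∃ c : ContDiffBump x, c.rIn = R ∧ c.rOut = R + 1 :=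
    ⟨⟨R, R + 1, hδ0.trans_le hR0, lt_add_one R⟩, rfl, rfl⟩
  obtain ⟨h, hh⟩ : ∃ h : CPhase s → ℂ, ∀ y, h y = (((1 - χ y) * c y : ℝ) : ℂ) * r y :=
    ⟨_, fun _ => rfl⟩
  have hhc : Continuous h := by
    rw [funext hh]
    exact (continuous_ofReal.comp ((continuous_const.sub χ.continuous).mul c.continuous)).mul hrc
  have hhδ : ∀ y, ‖y - x‖ ≤ δ / 2 → h y = 0 := fun y hy => by
    rw [hh, χ.one_of_mem_closedBall (by rw [hχ.1, Metric.mem_closedBall, dist_eq_norm]; exact hy)]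
    simp
  have hhR : ∀ y, R + 1 ≤ ‖y - x‖ → h y = 0 := fun y hy => by
    rw [hh, c.zero_of_le_dist (by rw [hc.2, dist_eq_norm]; exact hy)]
    simp
  -- The smooth approximant is supported where `h` is nonzero, so it vanishes near `x` too. The
  -- tolerance is `ε / 2` times the smallest value of `min(1, |y - x|²)` outside the removed ball.
  obtain ⟨g, hg1, hg2, hg3⟩ := hhc.exists_contDiff_approx ⊤ (ε := fun _ => ε / 2 * (δ / 2) ^ 2)
    continuous_const (fun _ => by positivity)
  have hgz : ∀ y, h y = 0 → g y = 0 := fun y hy => by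
    by_contra hne
    exact hg3 hne hy
  have hgs : HasCompactSupport g := by
    refine HasCompactSupport.intro (isCompact_closedBall x (R + 1)) fun y hy => hgz y (hhR y ?_)
    rw [Metric.mem_closedBall, dist_eq_norm, not_le] at hy
    exact hy.le
  obtain ⟨G, hG⟩ : ∃ G : 𝓢(CPhase s, ℂ), ∀ y, G y = g y := ⟨hgs.toSchwartzMap hg1, fun _ => rfl⟩
  have hev : ⇑(J + G) =ᶠ[𝓝 x] fun y => p (y - x) := by
    filter_upwards [Metric.ball_mem_nhds x (half_pos hδ0)] with y hy
    rw [Metric.mem_ball, dist_eq_norm] at hy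
    rw [add_apply, hG, hgz y (hhδ y hy.le), add_zero, hJp y (by linarith)]
  have hpd : ∀ y, HasFDerivAt (fun y => p (y - x))
      (fderiv ℝ f x + fderiv ℝ (fderiv ℝ f) x (y - x)) y := fun y => by
    rw [hp]
    exact hasFDerivAt_taylorPoly _ _ hB x y
  refine ⟨J + G, ?_, fun j => ?_, fun i j => ?_, fun y => ?_⟩
  · rw [hev.eq_of_nhds, hp]
    simp [taylorPoly]
  · rw [pd_eq_of_eventuallyEq hev, pd, (hpd x).fderiv, sub_self, map_zero, add_zero, pd]
  · have h2 : fderiv ℝ (fun y => p (y - x))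
        = fun y => fderiv ℝ f x + fderiv ℝ (fderiv ℝ f) x (y - x) := funext fun y => (hpd y).fderiv
    have h3 : HasFDerivAt (fderiv ℝ fun y => p (y - x)) (fderiv ℝ (fderiv ℝ f) x) x := by
      rw [h2]
      have h4 : HasFDerivAt (fun y : CPhase s => y - x) (ContinuousLinearMap.id ℝ _) x :=
        (hasFDerivAt_id x).sub_const x
      have h5 := HasFDerivAt.comp (f := fun y : CPhase s => y - x) x
        (fderiv ℝ (fderiv ℝ f) x).hasFDerivAt h4
      exact h5.const_add _
    rw [pd_pd_eq_of_eventuallyEq hev, pd_pd_eq h3.differentiableAt, h3.fderiv,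
      pd_pd_eq (hf2 x)]
  · have hχ0 : 0 ≤ χ y := χ.nonneg
    have hχ1 : χ y ≤ 1 := χ.le_one
    have hc0 : 0 ≤ c y := c.nonneg
    have hc1 : c y ≤ 1 := c.le_one
    have hgh : ‖g y - h y‖ ≤ ε / 2 * (δ / 2) ^ 2 := by
      rw [← dist_eq_norm]
      exact (hg2 y).le
    have heq : f y - (J + G) y = (((1 - (1 - χ y) * c y : ℝ) : ℂ)) * r y - (g y - h y) := by
      rw [add_apply, hG, hh, hr]
      push_cast
      ring
    have hn : ‖(((1 - (1 - χ y) * c y : ℝ) : ℂ)) * r y‖ ≤ (1 - (1 - χ y) * c y) * ‖r y‖ := by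
      rw [norm_mul, Complex.norm_real, Real.norm_of_nonneg (by nlinarith)]
    rcases le_or_gt ‖y - x‖ (δ / 2) with h1 | h1
    · have hmin : min 1 (‖y - x‖ ^ 2) = ‖y - x‖ ^ 2 :=
        min_eq_right (pow_le_one₀ (norm_nonneg _) (by linarith))
      rw [heq, hgz y (hhδ y h1), hhδ y h1, sub_zero, sub_zero, hmin]
      have h2 := hrδ y (by linarith)
      have h3 : (1 - (1 - χ y) * c y) * ‖r y‖ ≤ 1 * ‖r y‖ := by
        gcongr
        nlinarith
      nlinarith [sq_nonneg ‖y - x‖]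
    · have h2 : ‖(((1 - (1 - χ y) * c y : ℝ) : ℂ)) * r y‖ ≤ ε / 2 * min 1 (‖y - x‖ ^ 2) := by
        refine hn.trans ?_
        rcases lt_or_ge ‖y - x‖ δ with h3 | h3
        · rw [min_eq_right (pow_le_one₀ (norm_nonneg _) (by linarith))]
          refine le_trans ?_ (hrδ y h3)
          exact mul_le_of_le_one_left (norm_nonneg _) (by nlinarith)
        · rw [χ.zero_of_le_dist (by rw [hχ.2, dist_eq_norm]; exact h3), sub_zero, one_mul]
          rcases le_or_gt ‖y - x‖ R with h4 | h4
          · rw [c.one_of_mem_closedBall (by rw [hc.1, Metric.mem_closedBall, dist_eq_norm]; exact h4),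
              sub_self, zero_mul]
            positivity
          · refine (mul_le_of_le_one_left (norm_nonneg _) (by linarith)).trans
              ((hR y h4.le).trans ?_)
            gcongr
            refine le_min (pow_le_one₀ hδ0.le hδ1) ?_
            gcongr
      have h3 : ε / 2 * (δ / 2) ^ 2 ≤ ε / 2 * min 1 (‖y - x‖ ^ 2) := by
        gcongr
        refine le_min (pow_le_one₀ (by positivity) (by linarith)) ?_
        gcongr
      rw [heq]
      refine (norm_sub_le _ _).trans ?_
      linarith

section

/-! ### The pointwise generator on Weyl operators -/

/-- A three-term estimate: the slopes of `v` and `u` differ by at most `ε`, the slope of `u`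
converges to `e`, and `e` is within `ε` of `d`. -/
theorem hasDerivWithinAt_of_approx {v : ℝ → ℂ} {d : ℂ}
    (h : ∀ ε > 0, ∃ (u : ℝ → ℂ) (e : ℂ), HasDerivWithinAt u e (Ici 0) 0 ∧ ‖d - e‖ ≤ ε ∧
      ∀ t ∈ Icc (0 : ℝ) 1, ‖(v t - v 0) - (u t - u 0)‖ ≤ t * ε) :
    HasDerivWithinAt v d (Ici 0) 0 := by
  rw [hasDerivWithinAt_iff_isLittleO, Asymptotics.isLittleO_iff]
  intro c hc
  obtain ⟨u, e, hu, hde, hvu⟩ := h (c / 3) (by positivity)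
  rw [hasDerivWithinAt_iff_isLittleO, Asymptotics.isLittleO_iff] at hu
  have h01 : Icc (0 : ℝ) 1 ∈ 𝓝[≥] (0 : ℝ) := Icc_mem_nhdsGE zero_lt_one
  filter_upwards [hu (c := c / 3) (by positivity), h01] with t ht ht1
  have h1 := hvu t ht1
  rw [sub_zero, Real.norm_of_nonneg ht1.1] at ht ⊢
  have h2 : ‖t • (d - e)‖ ≤ t * (c / 3) := by
    rw [norm_smul, Real.norm_of_nonneg ht1.1]
    exact mul_le_mul_of_nonneg_left hde ht1.1
  have h3 : v t - v 0 - t • d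
      = ((v t - v 0) - (u t - u 0)) + (u t - u 0 - t • e) - t • (d - e) := by
    rw [smul_sub]
    ring
  rw [h3]
  refine (norm_sub_le _ _).trans ?_
  have h4 := norm_add_le ((v t - v 0) - (u t - u 0)) (u t - u 0 - t • e)
  linarith

theorem tensor_sub_right (a : Op n) (f g : CPhase s → ℂ) (hf hfb hg hgb hr hrb) :
    tensor a f hf hfb - tensor a g hg hgb = tensor a (fun y => f y - g y) hr hrb :=
  ((isVersion_tensor a f hf hfb).sub (isVersion_tensor a g hg hgb)).ext
    (isVersion_tensor a _ hr hrb) fun _ => (sub_smul _ _ _).symm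

theorem essBound_tensor_weyl (ζ : QPhase n) (f : CPhase s → ℂ) (hf hfb) {c : ℝ}
    (hc : ∀ y, ‖f y‖ ≤ c) : EssBound (tensor (weyl ζ) f hf hfb) c := by
  refine (isVersion_tensor _ f hf hfb).essBound fun y => ?_
  rw [norm_smul]
  exact (mul_le_of_le_one_right (norm_nonneg _) (norm_weyl_le ζ)).trans (hc y)

theorem exists_bound_sub {f g : CPhase s → ℂ} (hf : ∃ M : ℝ, ∀ x, ‖f x‖ ≤ M)
    (hg : ∃ M : ℝ, ∀ x, ‖g x‖ ≤ M) : ∃ M : ℝ, ∀ x, ‖f x - g x‖ ≤ M := by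
  obtain ⟨M, hM⟩ := hf
  obtain ⟨N, hN⟩ := hg
  exact ⟨M + N, fun x => (norm_sub_le _ _).trans (add_le_add (hM x) (hN x))⟩

theorem schwartz_bounded' (g : 𝓢(CPhase s, ℂ)) : ∃ M : ℝ, ∀ x, ‖g x‖ ≤ M := by
  obtain ⟨M, -, hM⟩ := schwartz_bounded g
  exact ⟨M, hM⟩

section Semigroup

variable {T : ℝ → (HybridAlg n s →ₗ[ℂ] HybridAlg n s)}
  {S : ℝ → (Phase n s →ₗ[ℝ] Phase n s)} {noise : ℝ → Phase n s → ℂ} {Z : PhaseMat n s}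
  {α : Phase n s} {A : PhaseMat n s} {ν : Measure (Phase n s)}

theorem isVersion_sub_schwartz {t : ℝ} (ζ : QPhase n) {f : CPhase s → ℂ} (hf hfb)
    (g : 𝓢(CPhase s, ℂ)) {V V' : CPhase s → Op n} (hV : IsVersion (T t (tensor (weyl ζ) f hf hfb)) V)
    (hV' : IsVersion (T t (tensor (weyl ζ) g g.continuous (schwartz_bounded' g))) V') :
    IsVersion (T t (tensor (weyl ζ) (fun y => f y - g y) (hf.sub g.continuous)
      (exists_bound_sub hfb (schwartz_bounded' g)))) fun y => V y - V' y := by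
  rw [← tensor_sub_right (weyl ζ) f g hf hfb g.continuous (schwartz_bounded' g), (T t).map_sub]
  exact hV.sub hV'

/-- Boundedness of `T_t` preserves uniform approximation by Schwartz functions, and weakly
continuous versions survive uniform limits. -/
theorem exists_version_weyl (hT : IsQuasiFreeSemigroup T S noise)
    (hdata : HasData S noise Z α A ν) {t : ℝ} (ht : 0 ≤ t) (ζ : QPhase n) {f : CPhase s → ℂ}
    (hf hfb) (happ : ∀ ε > 0, ∃ g : 𝓢(CPhase s, ℂ), ∀ y, ‖f y - g y‖ ≤ ε) :
    ∃ V, IsVersion (T t (tensor (weyl ζ) f hf hfb)) V := by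
  obtain ⟨C, hC0, hC⟩ := hT.bounded t ht
  refine exists_version_of_approx _ fun ε hε => ?_
  -- The bound `C` of `T_t` may be `0`, hence the denominator `C + 1`.
  obtain ⟨g, hg⟩ := happ (ε / (C + 1)) (by positivity)
  obtain ⟨V, hV, -⟩ := exists_version_weyl_schwartz hT hdata ht ζ g g.continuous
    (schwartz_bounded' g)
  refine ⟨_, V, hV, ?_⟩
  rw [← (T t).map_sub, tensor_sub_right (weyl ζ) f g hf hfb g.continuous (schwartz_bounded' g)
    (hf.sub g.continuous) (exists_bound_sub hfb (schwartz_bounded' g))]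
  have h := hC _ _ (essBound_tensor_weyl ζ (fun y => f y - g y) (hf.sub g.continuous)
    (exists_bound_sub hfb (schwartz_bounded' g)) hg)
  filter_upwards [h] with x hx
  refine hx.trans ?_
  rw [mul_div_assoc', div_le_iff₀ (by positivity)]
  nlinarith

theorem isVersion_zero (hT : IsQuasiFreeSemigroup T S noise) (ζ : QPhase n) {f : CPhase s → ℂ}
    (hf hfb) {V : CPhase s → Op n} (hV : IsVersion (T 0 (tensor (weyl ζ) f hf hfb)) V)
    (x : CPhase s) : V x = f x • weyl ζ := by
  rw [hT.zero] at hV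
  exact hV.unique (isVersion_tensor _ f hf hfb) x

/-- With equal jets at `x` only the jump integrals differ. The difference of their integrands is `f
- g` at `x + y` times a phase, hence at most `ε` times the Lévy weight. -/
theorem norm_inner_genK_sub_le (hdata : HasData S noise Z α A ν) (ζ : QPhase n)
    {f : CPhase s → ℂ} {M : ℝ} (hM : ∀ x, ‖f x‖ ≤ M) (hf1 : Differentiable ℝ f)
    (hf2 : Differentiable ℝ (fderiv ℝ f)) (g : 𝓢(CPhase s, ℂ)) (x : CPhase s)
    (h0 : g x = f x) (h1 : ∀ j, pd j g x = pd j f x)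
    (h2 : ∀ i j, pd i (pd j g) x = pd i (pd j f) x) {ε : ℝ} (hε : 0 ≤ ε)
    (h3 : ∀ y, ‖f y - g y‖ ≤ ε * min 1 (‖y - x‖ ^ 2)) (φ ψ : 𝓢(Config n, ℂ)) :
    ‖(inner ℂ (toH ψ) (genK Z α A ν (weyl ζ) (weylS ζ) f x φ) : ℂ)
      - inner ℂ (toH ψ) (genK Z α A ν (weyl ζ) (weylS ζ) g x φ)‖
      ≤ ε * (∫ η, levyWeight η ∂ν) * (‖toH ψ‖ * ‖toH φ‖) := by
  have hA : Aᵀ = A := hdata.posSemidef.isHermitian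
  have hν := hdata.levy
  obtain ⟨N, hN⟩ := schwartz_bounded' g
  have hg1 : Differentiable ℝ g := g.differentiable
  have hg2 : Differentiable ℝ (fderiv ℝ g) :=
    ((g.smooth 2).fderiv_right (m := 1) (by norm_num)).differentiable (by norm_num)
  rw [inner_genK_weyl Z α hA hν ζ hM hf1 hf2, inner_genK_weyl Z α hA hν ζ hN hg1 hg2]
  simp only [h0, h1, h2]
  have h4 : ∀ u p q J J', jetForm Z α A x ζ φ ψ u p q J - jetForm Z α A x ζ φ ψ u p q J'
      = (J - J') * inner ℂ (toH ψ) (weyl ζ (toH φ)) := fun u p q J J' => by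
    rw [jetForm, jetForm]
    ring
  rw [h4, ← integral_sub (integrable_jumpKer hν hM hf1 hf2 x ζ)
    (integrable_jumpKer hν hN hg1 hg2 x ζ), norm_mul]
  have h5 : ‖(inner ℂ (toH ψ) (weyl ζ (toH φ)) : ℂ)‖ ≤ ‖toH ψ‖ * ‖toH φ‖ := by
    rw [← norm_weyl_apply ζ (toH φ)]
    exact norm_inner_le_norm _ _
  have h7 : 0 ≤ ∫ η, levyWeight η ∂ν := integral_nonneg levyWeight_nonneg
  refine mul_le_mul ?_ h5 (norm_nonneg _) (by positivity)
  rw [← integral_const_mul]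
  refine norm_integral_le_of_norm_le ((integrable_levyWeight hν).const_mul ε)
    (Eventually.of_forall fun η => ?_)
  have h6 : jumpKer f x ζ η - jumpKer g x ζ η = (f (x + cPart η) - g (x + cPart η))
      * cexp (I * ((∑ i, qPart η i * ζ i : ℝ) : ℂ)) := by
    simp only [jumpKer, h0, h1]
    ring
  rw [h6, norm_mul, norm_exp_I_le, mul_one]
  refine (h3 _).trans (mul_le_mul_of_nonneg_left ?_ hε)
  rw [add_sub_cancel_left, levyWeight]
  have := norm_cPart_le η
  gcongr

/-- A Schwartz function with the same jet at `x` replaces `f`: its orbit is differentiable, its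
generator differs by `O(ε)`, and the orbit of the difference is at most `O(tε)` at `x`. The
approximant depends on `x` and `ε`, which is harmless because the point is fixed. -/
theorem hasDerivWithinAt_weyl (hT : IsQuasiFreeSemigroup T S noise)
    (hdata : HasData S noise Z α A ν) (ζ : QPhase n) {f : CPhase s → ℂ}
    (hfb : ∃ M : ℝ, ∀ x, ‖f x‖ ≤ M) (hf1 : Differentiable ℝ f)
    (hf2 : Differentiable ℝ (fderiv ℝ f)) (hf0 : Tendsto f (cocompact _) (𝓝 0))
    {V : ℝ → CPhase s → Op n}
    (hV : ∀ t, 0 ≤ t → IsVersion (T t (tensor (weyl ζ) f hf1.continuous hfb)) (V t))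
    (x : CPhase s) (φ ψ : 𝓢(Config n, ℂ)) :
    HasDerivWithinAt (fun t => (inner ℂ (toH ψ) (V t x (toH φ)) : ℂ))
      (inner ℂ (toH ψ) (genK Z α A ν (weyl ζ) (weylS ζ) f x φ)) (Ici 0) 0 := by
  obtain ⟨C, hC0, hC⟩ := exists_remainder_bound hT hdata φ ψ
  obtain ⟨L, hL0, hL⟩ := exists_schwartz_lipschitz hT hdata φ ψ
  obtain ⟨M, hM⟩ := hfb
  -- `K` adds the cost of the generator comparison and that of the remainder bound, both
  -- proportional to the accuracy `ε'`.
  obtain ⟨K, hK⟩ : ∃ K, K = (∫ η, levyWeight η ∂ν) * (‖toH ψ‖ * ‖toH φ‖) + C * (1 + ‖x‖) :=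
    ⟨_, rfl⟩
  have h7 : 0 ≤ ∫ η, levyWeight η ∂ν := integral_nonneg levyWeight_nonneg
  have hK0 : 0 ≤ K := hK ▸ by positivity
  refine hasDerivWithinAt_of_approx fun ε hε => ?_
  obtain ⟨ε', hε'⟩ : ∃ ε', ε' = ε / (K + 1) := ⟨_, rfl⟩
  have hε'0 : 0 < ε' := hε' ▸ by positivity
  have hε'K : ε' * K ≤ ε := by
    rw [hε', div_mul_eq_mul_div, div_le_iff₀ (by positivity)]
    nlinarith
  obtain ⟨g, hg0, hg1, hg2, hg3⟩ := exists_schwartz_approx hf1 hf2 hf0 x hε'0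
  refine ⟨fun t => ∫ k, 𝓕 g k * orbitElem S noise x (toH φ) (toH ψ) t (freq ζ k), _,
    hasDerivWithinAt_schwartz hT hdata ζ g x φ ψ, ?_, fun t ht => ?_⟩
  · refine (norm_inner_genK_sub_le hdata ζ hM hf1 hf2 g x hg0 hg1 hg2 hε'0.le hg3 φ ψ).trans ?_
    have h8 : 0 ≤ ε' * (C * (1 + ‖x‖)) := by positivity
    rw [hK] at hε'K
    linarith
  · have hu0 : ∫ k, 𝓕 g k * orbitElem S noise x (toH φ) (toH ψ) 0 (freq ζ k)
        = f x * inner ℂ (toH ψ) (weyl ζ (toH φ)) := by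
      have := hL 0 (by simp) ζ g x
      rw [zero_mul, hg0] at this
      exact sub_eq_zero.1 (norm_le_zero_iff.1 this)
    have hv0 : (inner ℂ (toH ψ) (V 0 x (toH φ)) : ℂ)
        = f x * inner ℂ (toH ψ) (weyl ζ (toH φ)) := by
      rw [isVersion_zero hT ζ _ _ (hV 0 le_rfl), smul_apply, inner_smul_right]
    obtain ⟨V', hV', hVi⟩ := exists_version_weyl_schwartz hT hdata ht.1 ζ g g.continuous
      (schwartz_bounded' g)
    have h9 := hC t ht ζ x ε' hε'0.le _ _ _ hg3 _
      (isVersion_sub_schwartz ζ hf1.continuous ⟨M, hM⟩ g (hV t ht.1) hV')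
    simp only
    rw [hu0, hv0, sub_sub_sub_cancel_right, ← hVi, ← inner_sub_right, ← sub_apply]
    refine h9.trans (mul_le_mul_of_nonneg_left ?_ ht.1)
    have h8 : 0 ≤ ε' * ((∫ η, levyWeight η ∂ν) * (‖toH ψ‖ * ‖toH φ‖)) := by positivity
    rw [hK] at hε'K
    linarith

end Semigroup

end

section

/-! ### The weak* generator on Weyl operators -/

/-- The counterpart of `exists_taylor_bound` with one constant for all base points in a ball; this
is where continuity of the second derivative enters, through compactness. -/
theorem norm_taylor_le_of_contDiff {f : CPhase s → ℂ} (hf : ContDiff ℝ 2 f) (ρ : ℝ) :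
    ∃ C, 0 ≤ C ∧ ∀ x y : CPhase s, ‖x‖ ≤ ρ → ‖y - x‖ ≤ 1 →
      ‖f y - f x - fderiv ℝ f x (y - x)‖ ≤ C * ‖y - x‖ ^ 2 := by
  have hf1 : Differentiable ℝ f := hf.differentiable (by norm_num)
  have hf' : ContDiff ℝ 1 (fderiv ℝ f) := hf.fderiv_right (by norm_num)
  have hf2 : Differentiable ℝ (fderiv ℝ f) := hf'.differentiable (by norm_num)
  -- The balls of radius `2` about the base points lie in this larger ball. Radius `2` leaves room
  -- for the strict inequality demanded by `norm_sub_le_of_fderiv_le` when `‖y - x‖ = 1`.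
  obtain ⟨C, hC⟩ := (isCompact_closedBall (0 : CPhase s) (ρ + 2)).exists_bound_of_continuousOn
    (hf'.continuous_fderiv (by norm_num)).continuousOn
  refine ⟨|C|, abs_nonneg C, fun x y hx hy => ?_⟩
  have h1 : ∀ z, ‖z - x‖ < 2 → ‖fderiv ℝ f z - fderiv ℝ f x‖ ≤ |C| * ‖z - x‖ := by
    intro z hz
    refine (convex_closedBall x 2).norm_image_sub_le_of_norm_fderiv_le (𝕜 := ℝ)
      (fun w _ => hf2 w) (fun w hw => (hC w ?_).trans (le_abs_self C))
      (Metric.mem_closedBall_self zero_le_two) ?_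
    · rw [Metric.mem_closedBall, dist_eq_norm] at hw
      rw [mem_closedBall_zero_iff]
      have := norm_le_norm_add_norm_sub' w x
      linarith
    · rw [Metric.mem_closedBall, dist_eq_norm]
      exact hz.le
  have hd : ∀ z, HasFDerivAt (fun z => f z - fderiv ℝ f x z) (fderiv ℝ f z - fderiv ℝ f x) z :=
    fun z => (hf1 z).hasFDerivAt.sub (fderiv ℝ f x).hasFDerivAt
  have h2 := norm_sub_le_of_fderiv_le (h := fun z => f z - fderiv ℝ f x z) (x := x) (C := |C|)
    (δ := 2) (fun z => (hd z).differentiableAt) (fun z hz => ?_) (y := y) (by linarith)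
    (abs_nonneg C)
  · rw [map_sub]
    convert h2 using 2
    ring
  · rw [(hd z).fderiv]
    exact h1 z hz

/-- The cut-off first order Taylor polynomial `v ↦ (f(x) + v · ∇f(x)) χ(v)`. -/
def taylorCut (f : CPhase s → ℂ) (x : CPhase s) : 𝓢(CPhase s, ℂ) :=
  f x • bumpMul (fun _ => 1) contDiff_const
    + ∑ j, pd j f x • bumpMul (fun v => ((v j : ℝ) : ℂ))
      (ofRealCLM.contDiff.comp (EuclideanSpace.proj (𝕜 := ℝ) j).contDiff)

theorem taylorCut_apply (f : CPhase s → ℂ) (x v : CPhase s) :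
    taylorCut f x v = ((unitBump s v : ℝ) : ℂ) * (f x + fderiv ℝ f x v) := by
  have h : ∀ j, bumpMul (fun v : CPhase s => ((v j : ℝ) : ℂ))
      (ofRealCLM.contDiff.comp (EuclideanSpace.proj (𝕜 := ℝ) j).contDiff) v
      = ((unitBump s v : ℝ) : ℂ) * ((v j : ℝ) : ℂ) := fun j => rfl
  have h0 : bumpMul (fun _ : CPhase s => 1) contDiff_const v = ((unitBump s v : ℝ) : ℂ) * 1 := rfl
  rw [taylorCut, add_apply, smul_apply, h0, ← sum_mul_pd, _root_.sum_apply, mul_add, Finset.mul_sum]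
  simp only [smul_apply, h, smul_eq_mul]
  congr 1
  · ring
  · refine Finset.sum_congr rfl fun j _ => ?_
    ring

/-- All these profiles are combinations of finitely many fixed Schwartz functions, with the
coefficients `f(x)` and `∂_j f(x)`, bounded for bounded `x`. -/
theorem exists_taylorCut_bound {f : CPhase s → ℂ} (hf : ContDiff ℝ 2 f) (ζ : QPhase n) (ρ : ℝ) :
    ∃ C, 0 ≤ C ∧ ∀ x : CPhase s, ‖x‖ ≤ ρ →
      orbitNorm ζ (taylorCut f x) ≤ C ∧ ∀ v, ‖taylorCut f x v‖ ≤ C := by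
  have hf0 : Continuous f := hf.continuous
  have hpd : ∀ j, Continuous (pd j f) := fun j =>
    (hf.continuous_fderiv (by norm_num)).clm_apply continuous_const
  obtain ⟨M, hM⟩ := (isCompact_closedBall (0 : CPhase s) ρ).exists_bound_of_continuousOn
    hf0.continuousOn
  choose D hD using fun j => (isCompact_closedBall (0 : CPhase s) ρ).exists_bound_of_continuousOn
    (hpd j).continuousOn
  obtain ⟨b, hb⟩ : ∃ b : 𝓢(CPhase s, ℂ), b = bumpMul (fun _ => 1) contDiff_const := ⟨_, rfl⟩
  obtain ⟨b', hb'⟩ : ∃ b' : Fin s → 𝓢(CPhase s, ℂ), ∀ j, b' j =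
      bumpMul (fun v => ((v j : ℝ) : ℂ))
        (ofRealCLM.contDiff.comp (EuclideanSpace.proj (𝕜 := ℝ) j).contDiff) := ⟨_, fun _ => rfl⟩
  have ht : ∀ x, taylorCut f x = f x • b + ∑ j, pd j f x • b' j := fun x => by
    simp only [taylorCut, hb, hb']
  obtain ⟨B, hB0, hB⟩ := schwartz_bounded b
  choose B' hB'0 hB' using fun j => schwartz_bounded (b' j)
  have hN := orbitNorm_nonneg ζ b
  have hN' := fun j => orbitNorm_nonneg ζ (b' j)
  refine ⟨|M| * (orbitNorm ζ b + B) + ∑ j, |D j| * (orbitNorm ζ (b' j) + B' j), ?_,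
    fun x hx => ⟨?_, fun v => ?_⟩⟩
  · have : 0 ≤ ∑ j, |D j| * (orbitNorm ζ (b' j) + B' j) := Finset.sum_nonneg fun j _ =>
      mul_nonneg (abs_nonneg _) (add_nonneg (hN' j) (hB'0 j))
    positivity
  · rw [ht]
    refine (orbitNorm_add_le _ _ _).trans (add_le_add ?_ ((orbitNorm_sum_le _ _ _).trans
      (Finset.sum_le_sum fun j _ => ?_)))
    · rw [orbitNorm_smul]
      have h1 := (hM x (mem_closedBall_zero_iff.2 hx)).trans (le_abs_self M)
      exact mul_le_mul h1 (by linarith) hN (abs_nonneg _)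
    · rw [orbitNorm_smul]
      have h1 := (hD j x (mem_closedBall_zero_iff.2 hx)).trans (le_abs_self (D j))
      exact mul_le_mul h1 (by linarith [hB'0 j]) (hN' j) (abs_nonneg _)
  · rw [ht, add_apply, _root_.sum_apply]
    refine (norm_add_le _ _).trans (add_le_add ?_ ((norm_sum_le _ _).trans
      (Finset.sum_le_sum fun j _ => ?_)))
    · rw [smul_apply, norm_smul]
      have h1 := (hM x (mem_closedBall_zero_iff.2 hx)).trans (le_abs_self M)
      exact mul_le_mul h1 (by linarith [hB v]) (norm_nonneg _) (abs_nonneg _)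
    · rw [smul_apply, norm_smul]
      have h1 := (hD j x (mem_closedBall_zero_iff.2 hx)).trans (le_abs_self (D j))
      exact mul_le_mul h1 (by linarith [hB' j v, hN' j]) (norm_nonneg _) (abs_nonneg _)

section Semigroup

variable {T : ℝ → (HybridAlg n s →ₗ[ℂ] HybridAlg n s)}
  {S : ℝ → (Phase n s →ₗ[ℝ] Phase n s)} {noise : ℝ → Phase n s → ℂ} {Z : PhaseMat n s}
  {α : Phase n s} {A : PhaseMat n s} {ν : Measure (Phase n s)}

/-- The orbit of `weyl ζ ⊗ f` is Lipschitz at time `0`, uniformly on bounded sets. -/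
theorem exists_weyl_lipschitz (hT : IsQuasiFreeSemigroup T S noise)
    (hdata : HasData S noise Z α A ν) (ζ : QPhase n) {f : CPhase s → ℂ}
    (hfc : Continuous f) (hfb : ∃ M : ℝ, ∀ x, ‖f x‖ ≤ M) (hf : ContDiff ℝ 2 f)
    {V : ℝ → CPhase s → Op n}
    (hV : ∀ t, 0 ≤ t → IsVersion (T t (tensor (weyl ζ) f hfc hfb)) (V t))
    (φ ψ : 𝓢(Config n, ℂ)) (ρ : ℝ) :
    ∃ C, 0 ≤ C ∧ ∀ t ∈ Icc (0 : ℝ) 1, ∀ x : CPhase s, ‖x‖ ≤ ρ →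
      ‖(inner ℂ (toH ψ) (V t x (toH φ)) : ℂ) - inner ℂ (toH ψ) (V 0 x (toH φ))‖ ≤ t * C := by
  obtain ⟨M, hM⟩ := hfb
  have hM0 : 0 ≤ M := (norm_nonneg _).trans (hM 0)
  obtain ⟨C, hC0, hC⟩ := exists_remainder_bound hT hdata φ ψ
  obtain ⟨L, hL0, hL⟩ := exists_schwartz_lipschitz hT hdata φ ψ
  obtain ⟨K, hK0, hK⟩ := norm_taylor_le_of_contDiff hf ρ
  obtain ⟨N, hN0, hN⟩ := exists_taylorCut_bound hf ζ ρ
  refine ⟨C * (1 + |ρ|) * (K + (M + N)) + L * (1 + |ρ|) * N, by positivity, fun t ht x hx => ?_⟩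
  have hxρ : ‖x‖ ≤ |ρ| := hx.trans (le_abs_self ρ)
  -- First order agreement is enough for a Lipschitz bound: the remainder is `O(min(1, |y - x|²))`
  -- with a uniform constant and contributes `O(t)`. Convergence of the difference quotients is
  -- obtained separately, point by point.
  obtain ⟨g, hg⟩ : ∃ g, g = (taylorCut f x).compSubConstCLM ℂ x := ⟨_, rfl⟩
  have hgy : ∀ y, g y = taylorCut f x (y - x) := fun y => by
    rw [hg, SchwartzMap.compSubConstCLM_apply]
  have hgx : g x = f x := by
    rw [hgy, taylorCut_apply, sub_self, unitBump_zero, map_zero, ofReal_one, one_mul, add_zero]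
  have hgN : orbitNorm ζ g ≤ N := by
    rw [hg, orbitNorm_translate]
    exact (hN x hx).1
  have hr : ∀ y, ‖f y - g y‖ ≤ (K + (M + N)) * min 1 (‖y - x‖ ^ 2) := by
    intro y
    rcases le_or_gt ‖y - x‖ 1 with h | h
    · rw [min_eq_right (pow_le_one₀ (norm_nonneg _) h), hgy, taylorCut_apply,
        unitBump_of_norm_le h, ofReal_one, one_mul, ← sub_sub]
      refine (hK x y hx h).trans ?_
      gcongr
      linarith
    · rw [min_eq_left (one_le_pow₀ h.le), mul_one]
      refine (norm_sub_le _ _).trans ?_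
      rw [hgy]
      linarith [hM y, (hN x hx).2 (y - x)]
  obtain ⟨V', hV', hVi⟩ := exists_version_weyl_schwartz hT hdata ht.1 ζ g g.continuous
    (schwartz_bounded' g)
  have h1 := hC t ht ζ x (K + (M + N)) (by positivity) _ _ _ hr _
    (isVersion_sub_schwartz ζ hfc ⟨M, hM⟩ g (hV t ht.1) hV')
  have h2 := hL t ht ζ g x
  rw [← hVi, hgx] at h2
  have hv0 : (inner ℂ (toH ψ) (V 0 x (toH φ)) : ℂ)
      = f x * inner ℂ (toH ψ) (weyl ζ (toH φ)) := by
    rw [isVersion_zero hT ζ _ _ (hV 0 le_rfl), smul_apply, inner_smul_right]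
  rw [sub_apply, inner_sub_right] at h1
  rw [hv0]
  have h3 := norm_add_le ((inner ℂ (toH ψ) (V t x (toH φ)) : ℂ) - inner ℂ (toH ψ) (V' x (toH φ)))
    (inner ℂ (toH ψ) (V' x (toH φ)) - f x * inner ℂ (toH ψ) (weyl ζ (toH φ)))
  rw [sub_add_sub_cancel] at h3
  have h4 : t * (C * (1 + ‖x‖) * (K + (M + N))) ≤ t * (C * (1 + |ρ|) * (K + (M + N))) := by
    have := ht.1
    gcongr
  have h5 : t * (L * (1 + ‖x‖) * orbitNorm ζ g) ≤ t * (L * (1 + |ρ|) * N) := by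
    have := ht.1
    have := orbitNorm_nonneg ζ g
    gcongr
  linarith

theorem integrable_mul_inner_version {X : HybridAlg n s} {V : CPhase s → Op n}
    (hV : IsVersion X V) {c : ℝ} (hc : EssBound X c) {p : CPhase s → ℂ} (hp : Integrable p)
    (φ ψ : Hilb n) : Integrable fun x => p x * inner ℂ ψ (V x φ) := by
  refine hp.mul_bdd (c := ‖ψ‖ * (c * ‖φ‖)) (hV.continuous φ ψ).aestronglyMeasurable
    (Eventually.of_forall fun x => ?_)
  refine (norm_inner_le_norm _ _).trans ?_
  gcongr
  exact (V x).le_of_opNorm_le (hV.norm_le hc x) φ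

theorem isPointwiseGenerator_weyl (hT : IsQuasiFreeSemigroup T S noise)
    (hdata : HasData S noise Z α A ν) (ζ : QPhase n) {f : CPhase s → ℂ}
    (hfb : ∃ M : ℝ, ∀ x, ‖f x‖ ≤ M) (hf1 : Differentiable ℝ f)
    (hf2 : Differentiable ℝ (fderiv ℝ f)) (hf0 : Tendsto f (cocompact _) (𝓝 0))
    {V : ℝ → CPhase s → Op n}
    (hV : ∀ t, 0 ≤ t → IsVersion (T t (tensor (weyl ζ) f hf1.continuous hfb)) (V t)) :
    IsPointwiseGenerator T (tensor (weyl ζ) f hf1.continuous hfb)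
      (genK Z α A ν (weyl ζ) (weylS ζ) f) :=
  ⟨V, fun t ht => ⟨(hV t ht).ae_eq, (hV t ht).continuous⟩,
    hasDerivWithinAt_weyl hT hdata ζ hfb hf1 hf2 hf0 hV⟩

/-- The pointwise derivative is integrated against `p`. Compact support of `p` confines `x` to a
ball on which the orbits are uniformly Lipschitz, so a multiple of `|p|` dominates the difference
quotients; this also gives integrability of the limit. -/
theorem isWeakStarGenerator_weyl (hT : IsQuasiFreeSemigroup T S noise)
    (hdata : HasData S noise Z α A ν) (ζ : QPhase n) {f : CPhase s → ℂ}
    (hfb : ∃ M : ℝ, ∀ x, ‖f x‖ ≤ M) (hf1 : Differentiable ℝ f)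
    (hf2 : Differentiable ℝ (fderiv ℝ f)) (hf0 : Tendsto f (cocompact _) (𝓝 0))
    (hf : ContDiff ℝ 2 f) {V : ℝ → CPhase s → Op n}
    (hV : ∀ t, 0 ≤ t → IsVersion (T t (tensor (weyl ζ) f hf1.continuous hfb)) (V t)) :
    IsWeakStarGenerator T (tensor (weyl ζ) f hf1.continuous hfb)
      (genK Z α A ν (weyl ζ) (weylS ζ) f) := by
  intro p φ ψ hp hpc
  obtain ⟨ρ, hρ⟩ := hpc.isCompact.isBounded.subset_closedBall (0 : CPhase s)
  obtain ⟨C, hC0, hC⟩ := exists_weyl_lipschitz hT hdata ζ hf1.continuous hfb hf hV φ ψ ρ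
  have hint : ∀ t, 0 ≤ t → Integrable fun x => p x * inner ℂ (toH ψ) (V t x (toH φ)) := by
    intro t ht
    obtain ⟨M, hM⟩ := hfb
    obtain ⟨K, -, hK⟩ := hT.bounded t ht
    exact integrable_mul_inner_version (hV t ht)
      (hK _ _ (essBound_tensor_weyl ζ f hf1.continuous ⟨M, hM⟩ hM)) hp _ _
  have h := hasDerivWithinAt_integral_of_slope_bound
    (F := fun t x => p x * inner ℂ (toH ψ) (V t x (toH φ)))
    (F' := fun x => p x * inner ℂ (toH ψ) (genK Z α A ν (weyl ζ) (weylS ζ) f x φ))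
    (hp.norm.mul_const C) (fun t ht => hint t ht.1)
    (fun t ht => Eventually.of_forall fun x => ?_)
    (Eventually.of_forall fun x =>
      (hasDerivWithinAt_weyl hT hdata ζ hfb hf1 hf2 hf0 hV x φ ψ).const_mul _)
  · refine ⟨h.1, h.2.congr (fun t ht => ?_) ?_⟩
    · refine integral_congr_ae ?_
      filter_upwards [(hV t ht).ae_eq] with x hx
      rw [hx]
    · refine integral_congr_ae ?_
      filter_upwards [(hV 0 le_rfl).ae_eq] with x hx
      rw [hx]
  · rw [← mul_sub, norm_mul]
    by_cases hx : p x = 0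
    · rw [hx, norm_zero, zero_mul, zero_mul, mul_zero]
    · have hx' := hρ (subset_tsupport p hx)
      refine (mul_le_mul_of_nonneg_left (hC t ht x (mem_closedBall_zero_iff.1 hx'))
        (norm_nonneg _)).trans_eq ?_
      ring

end Semigroup

end

section

/-! ### Linearity in the quantum observable -/

/-- Summing the coordinate bounds makes `‖x‖ ‖f(x)‖` bounded. Only the resulting decay at infinity
is needed for the approximation by Schwartz functions. -/
theorem tendsto_cocompact_of_mul_bounded {f : CPhase s → ℂ}
    (hxf : ∀ j : Fin s, ∃ M : ℝ, ∀ x : CPhase s, ‖(x j : ℂ) * f x‖ ≤ M) :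
    Tendsto f (cocompact _) (𝓝 0) := by
  choose M hM using hxf
  have h1 : ∀ x : CPhase s, ‖x‖ * ‖f x‖ ≤ ∑ j, M j := fun x => by
    have h2 : ‖x‖ ≤ ∑ j, ‖x j‖ := by
      have h := norm_sum_le Finset.univ fun j => x j • EuclideanSpace.single j (1 : ℝ)
      have h3 : ∑ j, x j • EuclideanSpace.single j (1 : ℝ) = x := by
        ext i
        simp [Finset.sum_apply, Pi.single_apply]
      rw [h3] at h
      simpa [norm_smul] using h
    calc ‖x‖ * ‖f x‖ ≤ (∑ j, ‖x j‖) * ‖f x‖ := by gcongr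
      _ = ∑ j, ‖(x j : ℂ) * f x‖ := by
        rw [Finset.sum_mul]
        simp only [norm_mul, Complex.norm_real]
      _ ≤ _ := Finset.sum_le_sum fun j _ => hM j x
  have h2 : Tendsto (fun x : CPhase s => (∑ j, M j) * ‖x‖⁻¹) (cocompact _) (𝓝 0) := by
    have := (tendsto_inv_atTop_zero.comp
      (tendsto_norm_cocompact_atTop (E := CPhase s))).const_mul (∑ j, M j)
    rwa [mul_zero] at this
  refine squeeze_zero_norm' ?_ h2
  filter_upwards [(tendsto_norm_cocompact_atTop (E := CPhase s)).eventually_gt_atTop 0] with x hx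
  rw [← div_eq_mul_inv, le_div_iff₀ hx, mul_comm]
  exact h1 x

theorem Restricts.add {a b : Op n} {a₀ b₀ : SOp n} (ha : Restricts a a₀) (hb : Restricts b b₀) :
    Restricts (a + b) (a₀ + b₀) := fun φ => by
  rw [LinearMap.add_apply, toH_add, ha, hb, add_apply]

theorem Restricts.smul {a : Op n} {a₀ : SOp n} (ha : Restricts a a₀) (c : ℂ) :
    Restricts (c • a) (c • a₀) := fun φ => by
  rw [LinearMap.smul_apply, toH_smul, ha, smul_apply]

theorem conj_add (η : QPhase n) (a b : Op n) : conj η (a + b) = conj η a + conj η b := by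
  simp only [conj, ContinuousLinearMap.add_comp, ContinuousLinearMap.comp_add]

theorem conj_smul (η : QPhase n) (c : ℂ) (a : Op n) : conj η (c • a) = c • conj η a := by
  simp only [conj, ContinuousLinearMap.smul_comp, ContinuousLinearMap.comp_smul]

theorem comm_add (r a b : SOp n) : comm r (a + b) = comm r a + comm r b := by
  simp only [comm, mul_add, add_mul]
  abel

theorem comm_smul (r : SOp n) (c : ℂ) (a : SOp n) : comm r (c • a) = c • comm r a := by
  simp only [comm, mul_smul_comm, smul_mul_assoc, smul_sub]

theorem acomm_add (r a b : SOp n) : acomm r (a + b) = acomm r a + acomm r b := by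
  simp only [acomm, mul_add, add_mul]
  abel

theorem acomm_smul (r : SOp n) (c : ℂ) (a : SOp n) : acomm r (c • a) = c • acomm r a := by
  simp only [acomm, mul_smul_comm, smul_mul_assoc, smul_add]

theorem Lq1_add (Z : PhaseMat n s) (α : Phase n s) (A : PhaseMat n s) (a b : SOp n) :
    Lq1 Z α A (a + b) = Lq1 Z α A a + Lq1 Z α A b := by
  have h : ∀ i j, matG Z A i j • (R i * (a + b) * R j - (1 / 2 : ℂ) • acomm (R i * R j) (a + b))
      = matG Z A i j • (R i * a * R j - (1 / 2 : ℂ) • acomm (R i * R j) a)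
        + matG Z A i j • (R i * b * R j - (1 / 2 : ℂ) • acomm (R i * R j) b) := fun i j => by
    rw [acomm_add, mul_add, add_mul]
    module
  simp only [Lq1, h, comm_add, smul_add, Finset.sum_add_distrib]
  abel

theorem Lq1_smul (Z : PhaseMat n s) (α : Phase n s) (A : PhaseMat n s) (c : ℂ) (a : SOp n) :
    Lq1 Z α A (c • a) = c • Lq1 Z α A a := by
  have h : ∀ i j, matG Z A i j • (R i * (c • a) * R j - (1 / 2 : ℂ) • acomm (R i * R j) (c • a))
      = c • matG Z A i j • (R i * a * R j - (1 / 2 : ℂ) • acomm (R i * R j) a) := fun i j => by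
    rw [acomm_smul, mul_smul_comm, smul_mul_assoc]
    module
  simp only [Lq1, h, comm_smul, smul_add, Finset.smul_sum, smul_comm I c]

theorem Kint1_add (Z : PhaseMat n s) (a b : SOp n) (f : CPhase s → ℂ) (x : CPhase s) :
    Kint1 Z (a + b) f x = Kint1 Z a f x + Kint1 Z b f x := by
  simp only [Kint1, comm_add, smul_add]

theorem Kint1_smul (Z : PhaseMat n s) (c : ℂ) (a : SOp n) (f : CPhase s → ℂ) (x : CPhase s) :
    Kint1 Z (c • a) f x = c • Kint1 Z a f x := by
  rw [Kint1, Kint1, comm_smul]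
  module

theorem Kint2_add (Z A : PhaseMat n s) (a b : SOp n) (f : CPhase s → ℂ) (x : CPhase s) :
    Kint2 Z A (a + b) f x = Kint2 Z A a f x + Kint2 Z A b f x := by
  simp only [Kint2, acomm_add, smul_add, Finset.sum_add_distrib, neg_add]

theorem Kint2_smul (Z A : PhaseMat n s) (c : ℂ) (a : SOp n) (f : CPhase s → ℂ) (x : CPhase s) :
    Kint2 Z A (c • a) f x = c • Kint2 Z A a f x := by
  simp only [Kint2, acomm_smul, smul_neg, Finset.smul_sum, smul_comm c]

theorem Kint3_add (Z A : PhaseMat n s) (a b : SOp n) (f : CPhase s → ℂ) (x : CPhase s) :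
    Kint3 Z A (a + b) f x = Kint3 Z A a f x + Kint3 Z A b f x := by
  simp only [Kint3, comm_add, smul_add, Finset.sum_add_distrib]

theorem Kint3_smul (Z A : PhaseMat n s) (c : ℂ) (a : SOp n) (f : CPhase s → ℂ) (x : CPhase s) :
    Kint3 Z A (c • a) f x = c • Kint3 Z A a f x := by
  simp only [Kint3, comm_smul, Finset.smul_sum, smul_comm c]

theorem Lq2Integrand_add (a b : Op n) (a₀ b₀ : SOp n) (φ : 𝓢(Config n, ℂ)) :
    Lq2Integrand (s := s) (a + b) (a₀ + b₀) φ
      = fun η => Lq2Integrand a a₀ φ η + Lq2Integrand b b₀ φ η := by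
  funext η
  simp only [Lq2Integrand, conj_add, comm_add, LinearMap.add_apply, toH_add, add_apply, smul_add]
  abel

theorem Lq2Integrand_smul (c : ℂ) (a : Op n) (a₀ : SOp n) (φ : 𝓢(Config n, ℂ)) :
    Lq2Integrand (s := s) (c • a) (c • a₀) φ = fun η => c • Lq2Integrand a a₀ φ η := by
  funext η
  rw [Lq2Integrand, Lq2Integrand, conj_smul, comm_smul, LinearMap.smul_apply, toH_smul, smul_apply,
    smul_apply]
  module

theorem Kint4Integrand_add (a b : Op n) (f : CPhase s → ℂ) (x : CPhase s)
    (φ : 𝓢(Config n, ℂ)) :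
    Kint4Integrand (a + b) f x φ
      = fun η => Kint4Integrand a f x φ η + Kint4Integrand b f x φ η := by
  funext η
  rw [Kint4Integrand, Kint4Integrand, Kint4Integrand, conj_add, add_apply, add_apply]
  module

theorem Kint4Integrand_smul (c : ℂ) (a : Op n) (f : CPhase s → ℂ) (x : CPhase s)
    (φ : 𝓢(Config n, ℂ)) :
    Kint4Integrand (c • a) f x φ = fun η => c • Kint4Integrand a f x φ η := by
  funext η
  rw [Kint4Integrand, Kint4Integrand, conj_smul, smul_apply, smul_apply]
  module

section Generator

variable {Z : PhaseMat n s} {α : Phase n s} {A : PhaseMat n s} {ν : Measure (Phase n s)}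

/-- Additivity of the jump integrals requires their convergence for both operators, so integrability
has to accompany the generator formula through the induction over the span. -/
theorem genK_add {a b : Op n} {a₀ b₀ : SOp n} {f : CPhase s → ℂ}
    (ha2 : ∀ φ, Integrable (Lq2Integrand a a₀ φ) ν) (hb2 : ∀ φ, Integrable (Lq2Integrand b b₀ φ) ν)
    (ha4 : ∀ x φ, Integrable (Kint4Integrand a f x φ) ν)
    (hb4 : ∀ x φ, Integrable (Kint4Integrand b f x φ) ν) (x : CPhase s) (φ : 𝓢(Config n, ℂ)) :
    genK Z α A ν (a + b) (a₀ + b₀) f x φ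
      = genK Z α A ν a a₀ f x φ + genK Z α A ν b b₀ f x φ := by
  have h2 : Lq2 ν (a + b) (a₀ + b₀) φ = Lq2 ν a a₀ φ + Lq2 ν b b₀ φ := by
    rw [Lq2, Lq2Integrand_add, integral_add (ha2 φ) (hb2 φ), Lq2, Lq2]
  have h4 : Kint4 ν (a + b) f x φ = Kint4 ν a f x φ + Kint4 ν b f x φ := by
    rw [Kint4, Kint4Integrand_add, integral_add (ha4 x φ) (hb4 x φ), Kint4, Kint4]
  simp only [genK, h2, h4, Lq1_add, Kint1_add, Kint2_add, Kint3_add, LinearMap.add_apply, toH_add,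
    add_apply, smul_add]
  abel

theorem genK_smul (c : ℂ) (a : Op n) (a₀ : SOp n) (f : CPhase s → ℂ) (x : CPhase s)
    (φ : 𝓢(Config n, ℂ)) :
    genK Z α A ν (c • a) (c • a₀) f x φ = c • genK Z α A ν a a₀ f x φ := by
  have h2 : Lq2 ν (c • a) (c • a₀) φ = c • Lq2 ν a a₀ φ := by
    rw [Lq2, Lq2Integrand_smul, integral_smul, Lq2]
  have h4 : Kint4 ν (c • a) f x φ = c • Kint4 ν a f x φ := by
    rw [Kint4, Kint4Integrand_smul, integral_smul, Kint4]
  rw [genK, genK, h2, h4, Lq1_smul, Kint1_smul, Kint2_smul, Kint3_smul, LinearMap.smul_apply,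
    LinearMap.smul_apply, LinearMap.smul_apply, LinearMap.smul_apply, toH_smul, toH_smul, toH_smul,
    toH_smul, smul_apply]
  module

end Generator

section Semigroup

variable {T : ℝ → (HybridAlg n s →ₗ[ℂ] HybridAlg n s)} {X Y : HybridAlg n s}
  {k l m : CPhase s → 𝓢(Config n, ℂ) → Hilb n}

theorem IsPointwiseGenerator.add (hX : IsPointwiseGenerator T X k)
    (hY : IsPointwiseGenerator T Y l) (hm : ∀ x φ, m x φ = k x φ + l x φ) :
    IsPointwiseGenerator T (X + Y) m := by
  obtain ⟨V, hV, hVd⟩ := hX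
  obtain ⟨W, hW, hWd⟩ := hY
  have hv : ∀ t, 0 ≤ t → IsVersion (T t (X + Y)) fun x => V t x + W t x := fun t ht => by
    rw [(T t).map_add]
    exact IsVersion.add ⟨(hV t ht).1, (hV t ht).2⟩ ⟨(hW t ht).1, (hW t ht).2⟩
  refine ⟨fun t x => V t x + W t x, fun t ht => ⟨(hv t ht).ae_eq, (hv t ht).continuous⟩,
    fun x φ ψ => ?_⟩
  simp only [add_apply, inner_add_right, hm]
  exact (hVd x φ ψ).add (hWd x φ ψ)

theorem IsPointwiseGenerator.smul (hX : IsPointwiseGenerator T X k) (c : ℂ)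
    (hm : ∀ x φ, m x φ = c • k x φ) : IsPointwiseGenerator T (c • X) m := by
  obtain ⟨V, hV, hVd⟩ := hX
  have hv : ∀ t, 0 ≤ t → IsVersion (T t (c • X)) fun x => c • V t x := fun t ht => by
    rw [(T t).map_smul]
    exact IsVersion.smul ⟨(hV t ht).1, (hV t ht).2⟩ c
  refine ⟨fun t x => c • V t x, fun t ht => ⟨(hv t ht).ae_eq, (hv t ht).continuous⟩,
    fun x φ ψ => ?_⟩
  simp only [smul_apply, inner_smul_right, hm]
  exact (hVd x φ ψ).const_mul c

theorem integrable_mul_inner_rep (X : HybridAlg n s) {p : CPhase s → ℂ} (hp : Integrable p)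
    (φ ψ : Hilb n) : Integrable fun x => p x * inner ℂ ψ (rep X x φ) := by
  obtain ⟨C, hC⟩ := exists_inner_rep_bound X φ ψ
  exact hp.mul_bdd (aestronglyMeasurable_inner_rep X φ ψ) hC

theorem integral_mul_inner_rep_add (X Y : HybridAlg n s) {p : CPhase s → ℂ} (hp : Integrable p)
    (φ ψ : Hilb n) : ∫ x, p x * inner ℂ ψ (rep (X + Y) x φ)
      = (∫ x, p x * inner ℂ ψ (rep X x φ)) + ∫ x, p x * inner ℂ ψ (rep Y x φ) := by
  rw [← integral_add (integrable_mul_inner_rep X hp φ ψ) (integrable_mul_inner_rep Y hp φ ψ)]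
  refine integral_congr_ae ?_
  filter_upwards [rep_add X Y] with x hx
  rw [hx, add_apply, inner_add_right, mul_add]

theorem IsWeakStarGenerator.add (hX : IsWeakStarGenerator T X k)
    (hY : IsWeakStarGenerator T Y l) (hm : ∀ x φ, m x φ = k x φ + l x φ) :
    IsWeakStarGenerator T (X + Y) m := by
  intro p φ ψ hp hpc
  obtain ⟨h1, h2⟩ := hX p φ ψ hp hpc
  obtain ⟨h3, h4⟩ := hY p φ ψ hp hpc
  have h5 : (fun x => p x * inner ℂ (toH ψ) (m x φ)) = fun x =>
      p x * inner ℂ (toH ψ) (k x φ) + p x * inner ℂ (toH ψ) (l x φ) := by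
    funext x
    rw [hm, inner_add_right, mul_add]
  have h6 : ∀ t, ∫ x, p x * inner ℂ (toH ψ) (rep (T t (X + Y)) x (toH φ)) =
      (∫ x, p x * inner ℂ (toH ψ) (rep (T t X) x (toH φ)))
        + ∫ x, p x * inner ℂ (toH ψ) (rep (T t Y) x (toH φ)) := fun t => by
    have h8 := (T t).map_add X Y
    simp only [h8]
    exact integral_mul_inner_rep_add (T t X) (T t Y) hp (toH φ) (toH ψ)
  have h7 : ∫ x, p x * inner ℂ (toH ψ) (m x φ) = (∫ x, p x * inner ℂ (toH ψ) (k x φ))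
      + ∫ x, p x * inner ℂ (toH ψ) (l x φ) := by
    rw [h5]
    exact integral_add h1 h3
  refine ⟨h5 ▸ h1.add h3, ?_⟩
  rw [h7]
  exact (h2.fun_add h4).congr (fun t _ => h6 t) (h6 0)

theorem IsWeakStarGenerator.smul (hX : IsWeakStarGenerator T X k) (c : ℂ)
    (hm : ∀ x φ, m x φ = c • k x φ) : IsWeakStarGenerator T (c • X) m := by
  intro p φ ψ hp hpc
  obtain ⟨h1, h2⟩ := hX p φ ψ hp hpc
  have h5 : (fun x => p x * inner ℂ (toH ψ) (m x φ)) = fun x =>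
      c * (p x * inner ℂ (toH ψ) (k x φ)) := by
    funext x
    rw [hm, inner_smul_right]
    ring
  have h6 : ∀ t, ∫ x, p x * inner ℂ (toH ψ) (rep (T t (c • X)) x (toH φ))
      = c * ∫ x, p x * inner ℂ (toH ψ) (rep (T t X) x (toH φ)) := fun t => by
    rw [(T t).map_smul, ← integral_const_mul]
    refine integral_congr_ae ?_
    filter_upwards [rep_smul c (T t X)] with x hx
    rw [hx, smul_apply, inner_smul_right]
    ring
  simp only [h6, h5]
  rw [integral_const_mul]
  exact ⟨h1.const_mul c, h2.const_mul c⟩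

end Semigroup

end

end HybridQF

end

/-- Linearity in `a`, by induction over the span. The restriction `a₀` is built along with `a`, as
the same linear combination of the restricted Weyl operators. -/
theorem HybridQF.generator_of_mem_weylSpan {n s : ℕ}
    {T : ℝ → (HybridQF.HybridAlg n s →ₗ[ℂ] HybridQF.HybridAlg n s)}
    {S : ℝ → (HybridQF.Phase n s →ₗ[ℝ] HybridQF.Phase n s)}
    {noise : ℝ → HybridQF.Phase n s → ℂ}
    (hT : HybridQF.IsQuasiFreeSemigroup T S noise)
    {Z : HybridQF.PhaseMat n s} {α : HybridQF.Phase n s} {A : HybridQF.PhaseMat n s}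
    {ν : Measure (HybridQF.Phase n s)}
    (hdata : HybridQF.HasData S noise Z α A ν)
    {f : HybridQF.CPhase s → ℂ} (hf : ∃ M : ℝ, ∀ x, ‖f x‖ ≤ M)
    (hf1 : Differentiable ℝ f) (hf2 : Differentiable ℝ (fderiv ℝ f))
    (hf0 : Filter.Tendsto f (Filter.cocompact _) (nhds 0))
    (a : HybridQF.Op n) (ha : a ∈ HybridQF.weylSpan n) :
    ∃ a₀ : HybridQF.SOp n, HybridQF.Restricts a a₀ ∧
      (∀ φ, Integrable (HybridQF.Lq2Integrand a a₀ φ) ν) ∧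
      (∀ x φ, Integrable (HybridQF.Kint4Integrand a f x φ) ν) ∧
      HybridQF.IsPointwiseGenerator T (HybridQF.tensor a f hf1.continuous hf)
        (HybridQF.genK Z α A ν a a₀ f) ∧
      (ContDiff ℝ 2 f → HybridQF.IsWeakStarGenerator T
        (HybridQF.tensor a f hf1.continuous hf) (HybridQF.genK Z α A ν a a₀ f)) := by
  obtain ⟨M, hM⟩ := hf
  have hweyl : ∀ ζ, ∃ a₀ : HybridQF.SOp n, HybridQF.Restricts (HybridQF.weyl ζ) a₀ ∧
      (∀ φ, Integrable (HybridQF.Lq2Integrand (HybridQF.weyl ζ) a₀ φ) ν) ∧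
      (∀ x φ, Integrable (HybridQF.Kint4Integrand (HybridQF.weyl ζ) f x φ) ν) ∧
      HybridQF.IsPointwiseGenerator T
        (HybridQF.tensor (HybridQF.weyl ζ) f hf1.continuous ⟨M, hM⟩)
        (HybridQF.genK Z α A ν (HybridQF.weyl ζ) a₀ f) ∧
      (ContDiff ℝ 2 f → HybridQF.IsWeakStarGenerator T
        (HybridQF.tensor (HybridQF.weyl ζ) f hf1.continuous ⟨M, hM⟩)
        (HybridQF.genK Z α A ν (HybridQF.weyl ζ) a₀ f)) := by
    intro ζ
    have hex : ∀ t, ∃ V, 0 ≤ t → HybridQF.IsVersion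
        (T t (HybridQF.tensor (HybridQF.weyl ζ) f hf1.continuous ⟨M, hM⟩)) V := fun t => by
      by_cases ht : 0 ≤ t
      -- At the base point `0`, forgetting the jet, the approximation lemma gives plain uniform
      -- approximation, since the weight is at most `1`.
      · obtain ⟨V, hV⟩ := HybridQF.exists_version_weyl hT hdata ht ζ hf1.continuous ⟨M, hM⟩
          fun ε hε => by
            obtain ⟨g, -, -, -, hg⟩ := HybridQF.exists_schwartz_approx hf1 hf2 hf0 0 hε
            exact ⟨g, fun y => (hg y).trans (mul_le_of_le_one_right hε.le (min_le_left _ _))⟩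
        exact ⟨V, fun _ => hV⟩
      · exact ⟨0, fun h => absurd h ht⟩
    choose V hV using hex
    exact ⟨HybridQF.weylS ζ, HybridQF.weylS_restricts ζ,
      HybridQF.integrable_Lq2Integrand_weyl hdata.levy ζ,
      fun x φ => HybridQF.integrable_Kint4Integrand_weyl hdata.levy hM hf1 hf2 x ζ φ,
      HybridQF.isPointwiseGenerator_weyl hT hdata ζ ⟨M, hM⟩ hf1 hf2 hf0 hV,
      fun hf => HybridQF.isWeakStarGenerator_weyl hT hdata ζ ⟨M, hM⟩ hf1 hf2 hf0 hf hV⟩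
  have hsmul : ∀ (c : ℂ) (a : HybridQF.Op n), (∃ a₀ : HybridQF.SOp n, HybridQF.Restricts a a₀ ∧
      (∀ φ, Integrable (HybridQF.Lq2Integrand a a₀ φ) ν) ∧
      (∀ x φ, Integrable (HybridQF.Kint4Integrand a f x φ) ν) ∧
      HybridQF.IsPointwiseGenerator T (HybridQF.tensor a f hf1.continuous ⟨M, hM⟩)
        (HybridQF.genK Z α A ν a a₀ f) ∧
      (ContDiff ℝ 2 f → HybridQF.IsWeakStarGenerator T
        (HybridQF.tensor a f hf1.continuous ⟨M, hM⟩) (HybridQF.genK Z α A ν a a₀ f))) →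
      ∃ a₀ : HybridQF.SOp n, HybridQF.Restricts (c • a) a₀ ∧
      (∀ φ, Integrable (HybridQF.Lq2Integrand (c • a) a₀ φ) ν) ∧
      (∀ x φ, Integrable (HybridQF.Kint4Integrand (c • a) f x φ) ν) ∧
      HybridQF.IsPointwiseGenerator T (HybridQF.tensor (c • a) f hf1.continuous ⟨M, hM⟩)
        (HybridQF.genK Z α A ν (c • a) a₀ f) ∧
      (ContDiff ℝ 2 f → HybridQF.IsWeakStarGenerator T
        (HybridQF.tensor (c • a) f hf1.continuous ⟨M, hM⟩)
        (HybridQF.genK Z α A ν (c • a) a₀ f)) := by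
    rintro c a ⟨a₀, h1, h2, h3, h4, h5⟩
    rw [HybridQF.tensor_smul_left]
    refine ⟨c • a₀, h1.smul c, fun φ => ?_, fun x φ => ?_,
      h4.smul c fun x φ => HybridQF.genK_smul c a a₀ f x φ,
      fun hf => (h5 hf).smul c fun x φ => HybridQF.genK_smul c a a₀ f x φ⟩
    · rw [HybridQF.Lq2Integrand_smul]
      exact (h2 φ).smul c
    · rw [HybridQF.Kint4Integrand_smul]
      exact (h3 x φ).smul c
  refine Submodule.span_induction (p := fun a _ => ∃ a₀ : HybridQF.SOp n,
      HybridQF.Restricts a a₀ ∧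
      (∀ φ, Integrable (HybridQF.Lq2Integrand a a₀ φ) ν) ∧
      (∀ x φ, Integrable (HybridQF.Kint4Integrand a f x φ) ν) ∧
      HybridQF.IsPointwiseGenerator T (HybridQF.tensor a f hf1.continuous ⟨M, hM⟩)
        (HybridQF.genK Z α A ν a a₀ f) ∧
      (ContDiff ℝ 2 f → HybridQF.IsWeakStarGenerator T
        (HybridQF.tensor a f hf1.continuous ⟨M, hM⟩) (HybridQF.genK Z α A ν a a₀ f)))
    ?_ ?_ ?_ (fun c a _ h => hsmul c a h) ha
  · rintro _ ⟨ζ, rfl⟩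
    exact hweyl ζ
  -- The zero operator is treated as `0` times a Weyl operator.
  · have h := hsmul 0 _ (hweyl 0)
    rw [zero_smul] at h
    exact h
  · rintro a b - - ⟨a₀, h1, h2, h3, h4, h5⟩ ⟨b₀, k1, k2, k3, k4, k5⟩
    rw [HybridQF.tensor_add_left]
    refine ⟨a₀ + b₀, h1.add k1, fun φ => ?_, fun x φ => ?_,
      h4.add k4 (HybridQF.genK_add h2 k2 h3 k3),
      fun hf => (h5 hf).add (k5 hf) (HybridQF.genK_add h2 k2 h3 k3)⟩
    · rw [HybridQF.Lq2Integrand_add]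
      exact (h2 φ).add (k2 φ)
    · rw [HybridQF.Kint4Integrand_add]
      exact (h3 x φ).add (k3 x φ)

theorem proposition2 {n s : ℕ}
    (T : ℝ → (HybridQF.HybridAlg n s →ₗ[ℂ] HybridQF.HybridAlg n s))
    (S : ℝ → (HybridQF.Phase n s →ₗ[ℝ] HybridQF.Phase n s))
    (noise : ℝ → HybridQF.Phase n s → ℂ)
    (hT : HybridQF.IsQuasiFreeSemigroup T S noise)
    (Z : HybridQF.PhaseMat n s) (α : HybridQF.Phase n s) (A : HybridQF.PhaseMat n s)
    (ν : Measure (HybridQF.Phase n s))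
    (hdata : HybridQF.HasData S noise Z α A ν)
    (a : HybridQF.Op n) (ha : a ∈ HybridQF.weylSpan n)
    (f : HybridQF.CPhase s → ℂ) (hf : ∃ M : ℝ, ∀ x, ‖f x‖ ≤ M)
    (hf1 : Differentiable ℝ f) (hf2 : Differentiable ℝ (fderiv ℝ f))
    (hxf : ∀ j : Fin s, ∃ M : ℝ, ∀ x : HybridQF.CPhase s, ‖(x j : ℂ) * f x‖ ≤ M) :
    (∀ i j, (HybridQF.matE Z A i j).im = -(1 / 2) * Z.toBlocks₁₂ i j ∧
      (HybridQF.matE Z A i j).re = ((HybridQF.sigma n)ᵀ * A.toBlocks₁₂) i j) ∧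
    ∃ a₀ : HybridQF.SOp n, HybridQF.Restricts a a₀ ∧
      (∀ φ, Integrable (HybridQF.Lq2Integrand a a₀ φ) ν) ∧
      (∀ x, Integrable (HybridQF.Kcl2Integrand f x) ν) ∧
      (∀ x φ, Integrable (HybridQF.Kint4Integrand a f x φ) ν) ∧
      HybridQF.IsPointwiseGenerator T (HybridQF.tensor a f hf1.continuous hf)
        (HybridQF.genK Z α A ν a a₀ f) ∧
      (ContDiff ℝ 2 f → HybridQF.IsWeakStarGenerator T
        (HybridQF.tensor a f hf1.continuous hf) (HybridQF.genK Z α A ν a a₀ f)) := by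
  have hf0 := HybridQF.tendsto_cocompact_of_mul_bounded hxf
  refine ⟨fun i j => ⟨HybridQF.matE_im Z A i j, HybridQF.matE_re Z A i j⟩, ?_⟩
  obtain ⟨a₀, h1, h2, h3, h4, h5⟩ :=
    HybridQF.generator_of_mem_weylSpan hT hdata hf hf1 hf2 hf0 a ha
  obtain ⟨M, hM⟩ := hf
  exact ⟨a₀, h1, h2, HybridQF.integrable_Kcl2Integrand hdata.levy hM hf1 hf2, h3, h4, h5⟩
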